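/- **Conventions.** Fix a universe of small sets; categories are moderate (their sets of objects and of morphisms are of the size of the class of all small sets) and need not be locally small. An *arity class* is a class $\kappa$ of small cardinals with $1\in\kappa$ such that for every $\lambda\in\kappa$ and every family $(\alpha_i)_{i\in\lambda}$ of small cardinals: if all $\alpha_i\in\kappa$ then $\sum_i\alpha_i\in\kappa$; and if $\sum_i\alpha_i\in\kappa$ then all $\alpha_i\in\kappa$. A family is *$\kappa$-ary* if it is indexed by a set whose cardinality lies in $\kappa$. **Sites.** A *$\kappa$-ary cocone* $P$ on $u$ is a $\kappa$-ary family of morphisms $(p_i:v_i\to u)_i$. For two such, $P\le Q$ means that every $p_i$ factors through some $q_j$. A *weakly $\kappa$-ary topology* on a category $\mathbf C$ is a class of $\kappa$-ary cocones, called covering, such that $\{1_u\}$ is covering; if $P$ covers $u$ and $f:x\to u$, there is a covering $Q$ of $x$ with $fQ\le P$; if $P$ covers $u$ and each $Q_i$ covers the domain of $p_i$, then the family of all composites $p_iq_{ij}$ covers $u$; and if $P$ covers $u$ and $P\le Q$, then $Q$ covers $u$. An *array* over a functor $g:\mathbf J\to\mathbf C$ is a small family of cones over $g$. A cone $S$ over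 $g$ *factors locally* through an array $T$ if there is a covering family $P$ of the vertex of $S$ such that every restricted cone $Sp_i$ factors through some cone in $T$. A *local $\kappa$-prelimit* of $g$ is a $\kappa$-ary array over $g$ through which every cone over $g$ factors locally. A *locally $\kappa$-ary site* (resp. *$\kappa$-ary site*) is a category with a weakly $\kappa$-ary topology in which all finite connected diagrams (resp. all finite diagrams) have local $\kappa$-prelimits. A functor $F:\mathbf C\to\mathbf D$ between sites is a *morphism of sites* if it takes covering families to covering families and is covering-flat, i.e. for every finite diagram $g$ in $\mathbf C$ every cone over $Fg$ factors locally through the $F$-image of some array over $g$. It is a *pre-morphism of sites* if it takes local $\kappa$-prelimits of finite connected diagrams to local $\kappa$-prelimits. $\mathrm{SITE}_\kappa$ is the 2-category of $\kappa$-ary sites, morphisms of sites and all natural transformations; $\mathrm{LSITE}_\kappa$ is the 2-category of locally $\kappa$-ary sites, pre-morphisms of sites and all natural transformations. **Allegories.** A *$\kappa$-ary allegory* is a 2-category $\mathcal A$ whose hom-categories are posets with binary meets and $\kappa$-ary joins, such that composition and binary meets preserve $\kappa$-ary joins in each variable, with an identity-on-objects order-preserving involution $(-)^\circ:\mathcal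 A^{\mathrm{op}}\to\mathcal A$ satisfying the modular law $\psi\phi\wedge\chi\le(\psi\wedge\chi\phi^\circ)\phi$. A *map* is a morphism with a right adjoint. An *allegory functor* is a 2-functor preserving the involution, binary meets and $\kappa$-ary joins; an *allegory transformation* is an oplax natural transformation whose components are maps. A *framed $\kappa$-ary allegory* is a $\kappa$-ary allegory $\mathcal A$ together with a category $\mathrm{TMap}$ of *tight maps* with the same objects and an identity-on-objects functor $f\mapsto f_\bullet$ from $\mathrm{TMap}$ to the category of maps of $\mathcal A$; write $f^\bullet=(f_\bullet)^\circ$. A framed functor consists of an allegory functor and a functor on tight maps compatible with $(-)_\bullet$; a framed transformation consists of an allegory transformation and a natural transformation on tight maps compatible with $(-)_\bullet$. A framed $\kappa$-ary allegory is *weakly $\kappa$-tabular* if (i) every morphism $\phi:x\to y$ is a join $\bigvee_i (f_i)_\bullet(g_i)^\bullet$ for $\kappa$-ary cocones $(f_i:u_i\to y)$ and $(g_i:u_i\to x)$ of tight maps, and (ii) if $f,g:x\to y$ are tight with $f_\bullet=g_\bullet$, there is a $\kappa$-ary cocone $(p_i)$ of tight maps to $x$ with $fp_i=gp_i$ for all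 $i$ and $\bigvee_i (p_i)_\bullet (p_i)^\bullet=1_x$. An allegory has *local maxima* if every hom-poset has a top element. A *weak $\kappa$-unit* is a $\kappa$-ary family of objects $(u_i)$ such that every object $x$ admits morphisms $\phi_i:x\to u_i$ with $1_x\le\bigvee_i\phi_i^\circ\phi_i$. $\mathrm{FALL}_\kappa^{\mathrm{wt}}$ is the 2-category of weakly $\kappa$-tabular framed $\kappa$-ary allegories with all framed functors and framed transformations; $\mathrm{FALL}_\kappa^{\mathrm{wt}\times}$ is its locally full sub-2-category of those with local maxima and a weak $\kappa$-unit, and of the framed functors that preserve top elements of hom-posets and weak $\kappa$-units. **The construction.** For a locally $\kappa$-ary site $\mathbf C$, the framed allegory $\mathrm{Rel}_\kappa(\mathbf C)$ has the objects of $\mathbf C$; its hom-poset from $x$ to $y$ is the poset reflection of the preordered class of $\kappa$-ary families of spans $P=(x\leftarrow w_i\to y)_i$, where $P$ is below $Q$ if each span of $P$ factors locally through $Q$; identities are the classes of $\{1_x,1_x\}$; composites are computed by local $\kappa$-pre-pullbacks, binary meets by local $\kappa$-prelimits of the diagrams formed by two spans from $x$ to $y$, joins by disjoint union, and the involution by reversal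 of spans; its tight maps are the morphisms of $\mathbf C$, with $f_\bullet$ the class of $\{1_x,f\}$. A pre-morphism of sites acts on objects, tight maps and families of spans by application, and a natural transformation acts by its components. **Theorem.** Let $\kappa$ be an arity class. These data define strict 2-functors $\mathrm{Rel}_\kappa:\mathrm{SITE}_\kappa\to\mathrm{FALL}_\kappa^{\mathrm{wt}\times}$ and $\mathrm{Rel}_\kappa:\mathrm{LSITE}_\kappa\to\mathrm{FALL}_\kappa^{\mathrm{wt}}$, and both are 2-equivalences: they induce isomorphisms of hom-categories, and every object of the target is isomorphic to one in the image. -/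

import Mathlib

open CategoryTheory

universe w v u v₁ u₁ v₂ u₂

namespace RelSite

/-! ## Arity classes and families -/

/-- An arity class: a class of small cardinals that contains `1` and is closed under indexed sums
and under indexed decompositions. Small means living in `Type w`. -/
structure ArityClass where
  carrier : Set Cardinal.{w}
  one_mem : 1 ∈ carrier
  sum_mem : ∀ {ι : Type w} (a : ι → Cardinal.{w}), Cardinal.mk ι ∈ carrier →
    (∀ i, a i ∈ carrier) → Cardinal.sum a ∈ carrier
  mem_of_sum_mem : ∀ {ι : Type w} (a : ι → Cardinal.{w}), Cardinal.mk ι ∈ carrier →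
    Cardinal.sum a ∈ carrier → ∀ i, a i ∈ carrier

/-- A small type is `κ`-small if its cardinality belongs to `κ`. -/
def ArityClass.Small (κ : ArityClass.{w}) (I : Type w) : Prop :=
  Cardinal.mk I ∈ κ.carrier

namespace ArityClass

variable (κ : ArityClass.{w})

theorem small_punit : κ.Small PUnit.{w + 1} := by
  simpa [Small] using κ.one_mem

theorem small_sigma {I : Type w} {A : I → Type w} (hI : κ.Small I) (hA : ∀ i, κ.Small (A i)) :
    κ.Small (Σ i, A i) := by
  unfold Small
  rw [Cardinal.mk_sigma]
  exact κ.sum_mem _ hI hA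

end ArityClass

section Sites

variable {κ : ArityClass.{w}} {C : Type u} [Category.{v} C]

/-- A `κ`-ary cocone with vertex `u`: a `κ`-small family of morphisms with target `u`. -/
structure AryCocone (κ : ArityClass.{w}) {C : Type u} [Category.{v} C] (u : C) where
  I : Type w
  small : κ.Small I
  dom : I → C
  hom : ∀ i, dom i ⟶ u

namespace AryCocone

/-- `P ≤ Q`: every member of `P` factors through some member of `Q`. -/
def Refines {u : C} (P Q : AryCocone κ u) : Prop :=
  ∀ i, ∃ (j : Q.I) (h : P.dom i ⟶ Q.dom j), P.hom i = h ≫ Q.hom j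

/-- The singleton cocone `{f}`. -/
def single (κ : ArityClass.{w}) {x u : C} (f : x ⟶ u) : AryCocone κ u where
  I := PUnit
  small := κ.small_punit
  dom _ := x
  hom _ := f

/-- The cocone `f Q`. -/
def postcomp {x u : C} (Q : AryCocone κ x) (f : x ⟶ u) : AryCocone κ u where
  I := Q.I
  small := Q.small
  dom := Q.dom
  hom i := Q.hom i ≫ f

/-- The cocone `P (⊔ Q_v)`. -/
def bind {u : C} (P : AryCocone κ u) (Q : ∀ i, AryCocone κ (P.dom i)) : AryCocone κ u where
  I := Σ i, (Q i).I
  small := κ.small_sigma P.small fun i => (Q i).small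
  dom k := (Q k.1).dom k.2
  hom k := (Q k.1).hom k.2 ≫ P.hom k.1

/-- The image of a cocone under a functor. -/
def map {D : Type u₁} [Category.{v₁} D] (F : C ⥤ D) {u : C} (P : AryCocone κ u) :
    AryCocone κ (F.obj u) where
  I := P.I
  small := P.small
  dom i := F.obj (P.dom i)
  hom i := F.map (P.hom i)

end AryCocone

/-- A weakly `κ`-ary topology on a category. -/
structure WeakTopology (κ : ArityClass.{w}) (C : Type u) [Category.{v} C] where
  Covers : ∀ {u : C}, AryCocone κ u → Prop
  covers_id : ∀ u : C, Covers (AryCocone.single κ (𝟙 u))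
  exists_pullback : ∀ {u x : C} (P : AryCocone κ u) (f : x ⟶ u), Covers P →
    ∃ Q : AryCocone κ x, Covers Q ∧ (Q.postcomp f).Refines P
  covers_bind : ∀ {u : C} (P : AryCocone κ u) (Q : ∀ i, AryCocone κ (P.dom i)),
    Covers P → (∀ i, Covers (Q i)) → Covers (P.bind Q)
  covers_of_refines : ∀ {u : C} (P Q : AryCocone κ u), Covers P → P.Refines Q → Covers Q

/-- An array over a functor `g`, that is a small family of cones over `g`. -/
structure ConeArray {J : Type u₁} [Category.{v₁} J] (g : J ⥤ C) where
  I : Type w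
  cone : I → Limits.Cone g

/-- The image of an array over `g` under a functor, an array over `g ⋙ F`. -/
def ConeArray.map {J : Type u₁} [Category.{v₁} J] {g : J ⥤ C} (T : ConeArray.{w} g)
    {D : Type u₂} [Category.{v₂} D] (F : C ⥤ D) : ConeArray.{w} (g ⋙ F) where
  I := T.I
  cone i := F.mapCone (T.cone i)

/-- A `κ`-sourced array over a pair `{x, y}`, that is a `κ`-small family of spans
from `x` to `y`. -/
structure SpanArray (κ : ArityClass.{w}) {C : Type u} [Category.{v} C] (x y : C) where
  I : Type w
  small : κ.Small I
  src : I → C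
  l : ∀ i, src i ⟶ x
  r : ∀ i, src i ⟶ y

namespace WeakTopology

variable (τ : WeakTopology κ C)

/-- A cone `S` over `g` factors locally through the array `T` over `g`. -/
def FactorsLocally {J : Type u₁} [Category.{v₁} J] {g : J ⥤ C} (S : Limits.Cone g)
    (T : ConeArray.{w} g) : Prop :=
  ∃ P : AryCocone κ S.pt, τ.Covers P ∧ ∀ i, ∃ (k : T.I) (h : P.dom i ⟶ (T.cone k).pt),
    ∀ j, P.hom i ≫ S.π.app j = h ≫ (T.cone k).π.app j

/-- `T` is a local `κ`-prelimit of `g`. -/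
def IsLocalPrelimit {J : Type u₁} [Category.{v₁} J] {g : J ⥤ C} (T : ConeArray.{w} g) : Prop :=
  κ.Small T.I ∧ ∀ S : Limits.Cone g, τ.FactorsLocally S T

/-- `P` locally refines `Q`, for `κ`-sourced arrays over `{x, y}`. -/
def LocallyRefines {x y : C} (P Q : SpanArray κ x y) : Prop :=
  ∀ i, ∃ V : AryCocone κ (P.src i), τ.Covers V ∧
    ∀ k, ∃ (j : Q.I) (h : V.dom k ⟶ Q.src j),
      V.hom k ≫ P.l i = h ≫ Q.l j ∧ V.hom k ≫ P.r i = h ≫ Q.r j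

/-- The existence of local `κ`-prelimits of all finite connected diagrams. -/
def HasFiniteConnectedLocalPrelimits : Prop :=
  ∀ (J : Type) [SmallCategory J] [FinCategory J] [IsConnected J] (g : J ⥤ C),
    ∃ T : ConeArray.{w} g, τ.IsLocalPrelimit T

/-- The existence of local `κ`-prelimits of all finite diagrams. -/
def HasFiniteLocalPrelimits : Prop :=
  ∀ (J : Type) [SmallCategory J] [FinCategory J] (g : J ⥤ C),
    ∃ T : ConeArray.{w} g, τ.IsLocalPrelimit T

/-- `φ` holds locally at `a`. -/
def Locally (a : C) (φ : ∀ ⦃b : C⦄, (b ⟶ a) → Prop) : Prop :=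
  ∃ P : AryCocone κ a, τ.Covers P ∧ ∀ i, φ (P.hom i)

variable {τ}

theorem Locally.of {a : C} {φ : ∀ ⦃b : C⦄, (b ⟶ a) → Prop} (h : φ (𝟙 a)) : τ.Locally a φ :=
  ⟨_, τ.covers_id a, fun _ => h⟩

theorem Locally.mono {a : C} {φ ψ : ∀ ⦃b : C⦄, (b ⟶ a) → Prop} (h : τ.Locally a φ)
    (H : ∀ ⦃b : C⦄ (f : b ⟶ a), φ f → ψ f) : τ.Locally a ψ := by
  obtain ⟨P, hP, h⟩ := h
  exact ⟨P, hP, fun i => H _ (h i)⟩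

theorem Locally.bind {a : C} {φ ψ : ∀ ⦃b : C⦄, (b ⟶ a) → Prop} (h : τ.Locally a φ)
    (H : ∀ ⦃b : C⦄ (f : b ⟶ a), φ f → τ.Locally b fun _ g => ψ (g ≫ f)) : τ.Locally a ψ := by
  obtain ⟨P, hP, h⟩ := h
  choose Q hQ hQ' using fun i => H _ (h i)
  exact ⟨P.bind Q, τ.covers_bind P Q hP hQ, fun k => hQ' k.1 k.2⟩

theorem Locally.pullback {a b : C} {φ : ∀ ⦃b : C⦄, (b ⟶ a) → Prop} (h : τ.Locally a φ)
    (H : ∀ ⦃b c : C⦄ (g : c ⟶ b) (f : b ⟶ a), φ f → φ (g ≫ f)) (f : b ⟶ a) :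
    τ.Locally b fun _ g => φ (g ≫ f) := by
  obtain ⟨P, hP, h⟩ := h
  obtain ⟨Q, hQ, hQP⟩ := τ.exists_pullback P f hP
  refine ⟨Q, hQ, fun i => ?_⟩
  obtain ⟨j, k, e⟩ := hQP i
  change Q.hom i ≫ f = _ at e
  simp only [e]
  exact H _ _ (h j)

theorem Locally.and {a : C} {φ ψ : ∀ ⦃b : C⦄, (b ⟶ a) → Prop} (h : τ.Locally a φ)
    (h' : τ.Locally a ψ) (H : ∀ ⦃b c : C⦄ (g : c ⟶ b) (f : b ⟶ a), φ f → φ (g ≫ f))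
    (H' : ∀ ⦃b c : C⦄ (g : c ⟶ b) (f : b ⟶ a), ψ f → ψ (g ≫ f)) :
    τ.Locally a fun _ f => φ f ∧ ψ f :=
  h.bind fun _ f hf => (h'.pullback H' f).mono fun _ g hg => ⟨H g f hf, hg⟩

theorem FactorsLocally_iff {J : Type u₁} [Category.{v₁} J] {g : J ⥤ C} (S : Limits.Cone g)
    (T : ConeArray.{w} g) : τ.FactorsLocally S T ↔
      τ.Locally S.pt fun b p => ∃ (k : T.I) (h : b ⟶ (T.cone k).pt),
        ∀ j, p ≫ S.π.app j = h ≫ (T.cone k).π.app j := Iff.rfl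

theorem covers_iff_locally {u : C} (P : AryCocone κ u) :
    τ.Covers P ↔ τ.Locally u fun b p => ∃ (i : P.I) (h : b ⟶ P.dom i), p = h ≫ P.hom i :=
  ⟨fun h => ⟨P, h, fun i => ⟨i, 𝟙 _, by simp⟩⟩, fun ⟨Q, hQ, h⟩ => τ.covers_of_refines Q P hQ h⟩

end WeakTopology

/-! ### Functors between weakly `κ`-ary sites -/

section Functors

variable {D : Type u₁} [Category.{v₁} D] {E : Type u₂} [Category.{v₂} E]

/-- `F` preserves covering families. -/
def PreservesCovers (τ : WeakTopology κ C) (σ : WeakTopology κ D) (F : C ⥤ D) : Prop :=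
  ∀ ⦃u : C⦄ (P : AryCocone κ u), τ.Covers P → σ.Covers (P.map F)

/-- `F` is covering-flat: for every finite diagram `g` in `C`, every cone over `g ⋙ F` factors
locally through the image of some array over `g`. -/
def CoveringFlat (σ : WeakTopology κ D) (F : C ⥤ D) : Prop :=
  ∀ (J : Type) [SmallCategory J] [FinCategory J] (g : J ⥤ C) (S : Limits.Cone (g ⋙ F)),
    ∃ T : ConeArray.{w} g, σ.FactorsLocally S (T.map F)

/-- `F` is a morphism of sites: it is covering-flat and preserves covering families. -/
def IsMorphismOfSites (τ : WeakTopology κ C) (σ : WeakTopology κ D) (F : C ⥤ D) : Prop :=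
  CoveringFlat σ F ∧ PreservesCovers τ σ F

/-- `F` is a pre-morphism of sites: it preserves local `κ`-prelimits of finite connected
diagrams. -/
def IsPreMorphismOfSites (τ : WeakTopology κ C) (σ : WeakTopology κ D) (F : C ⥤ D) : Prop :=
  ∀ (J : Type) [SmallCategory J] [FinCategory J] [IsConnected J] (g : J ⥤ C)
    (T : ConeArray.{w} g), τ.IsLocalPrelimit T → σ.IsLocalPrelimit (T.map F)

variable {τ : WeakTopology κ C} {σ : WeakTopology κ D} {ρ : WeakTopology κ E}

theorem PreservesCovers.locally {F : C ⥤ D} (hF : PreservesCovers τ σ F) {a : C}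
    {φ : ∀ ⦃b : C⦄, (b ⟶ a) → Prop} {ψ : ∀ ⦃b : D⦄, (b ⟶ F.obj a) → Prop}
    (h : τ.Locally a φ) (H : ∀ ⦃b : C⦄ (f : b ⟶ a), φ f → ψ (F.map f)) :
    σ.Locally (F.obj a) ψ := by
  obtain ⟨P, hP, h⟩ := h
  exact ⟨P.map F, hF P hP, fun i => H _ (h i)⟩

theorem IsPreMorphismOfSites.id : IsPreMorphismOfSites τ τ (𝟭 C) := by
  intro J _ _ _ _ T hT
  exact hT

theorem IsPreMorphismOfSites.comp {F : C ⥤ D} {G : D ⥤ E} (hF : IsPreMorphismOfSites τ σ F)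
    (hG : IsPreMorphismOfSites σ ρ G) : IsPreMorphismOfSites τ ρ (F ⋙ G) := by
  intro J _ _ _ g T hT
  exact hG J (g ⋙ F) (T.map F) (hF J g T hT)

theorem IsMorphismOfSites.id : IsMorphismOfSites τ τ (𝟭 C) :=
  ⟨fun _ _ _ g S => ⟨⟨PUnit, fun _ => S⟩, ⟨_, τ.covers_id _, fun _ => ⟨⟨⟩, 𝟙 _, fun _ => rfl⟩⟩⟩,
    fun _ _ hP => hP⟩

theorem CoveringFlat.locally {F : C ⥤ D} (h : CoveringFlat σ F) (J : Type) [SmallCategory J]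
    [FinCategory J] (g : J ⥤ C) (S : Limits.Cone (g ⋙ F)) :
    σ.Locally S.pt fun b p => ∃ (T : Limits.Cone g) (h : b ⟶ F.obj T.pt),
        ∀ j, p ≫ S.π.app j = h ≫ F.map (T.π.app j) := by
  obtain ⟨T, hT⟩ := h J g S
  exact ((WeakTopology.FactorsLocally_iff _ _).1 hT).mono fun b p ⟨k, h, e⟩ => ⟨T.cone k, h, e⟩

theorem CoveringFlat.of_locally {F : C ⥤ D}
    (H : ∀ (J : Type) [SmallCategory J]
      [FinCategory J] (g : J ⥤ C) (S : Limits.Cone (g ⋙ F)),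
      σ.Locally S.pt fun b p => ∃ (T : Limits.Cone g) (h : b ⟶ F.obj T.pt),
        ∀ j, p ≫ S.π.app j = h ≫ F.map (T.π.app j)) : CoveringFlat σ F := by
  intro J _ _ g S
  obtain ⟨P, hP, h⟩ := H J g S
  choose T k e using h
  exact ⟨⟨P.I, T⟩, P, hP, fun i => ⟨i, k i, e i⟩⟩

theorem IsMorphismOfSites.comp {F : C ⥤ D} {G : D ⥤ E} (hF : IsMorphismOfSites τ σ F)
    (hG : IsMorphismOfSites σ ρ G) : IsMorphismOfSites τ ρ (F ⋙ G) := by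
  refine ⟨CoveringFlat.of_locally ?_, fun u P hP => hG.2 _ (hF.2 P hP)⟩
  intro J _ _ g S
  refine (hG.1.locally J (g ⋙ F) S).bind ?_
  rintro b p ⟨T, k, e⟩
  refine ((hG.2.locally (ψ := fun b q => ∃ (T' : Limits.Cone g) (l : b ⟶ G.obj (F.obj T'.pt)),
    ∀ j, q ≫ G.map (T.π.app j) = l ≫ G.map (F.map (T'.π.app j)))
    (hF.1.locally J g T) ?_).pullback ?_ k).mono ?_
  · rintro a f ⟨T', l, e'⟩
    exact ⟨T', G.map l, fun j => by rw [← G.map_comp, e' j, G.map_comp]⟩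
  · rintro a c q f ⟨T', l, e'⟩
    exact ⟨T', q ≫ l, fun j => by rw [Category.assoc, e' j, Category.assoc]⟩
  · rintro c q ⟨T', l, e'⟩
    refine ⟨T', l, fun j => ?_⟩
    rw [Category.assoc, e j, ← Category.assoc]
    exact e' j

/-- A morphism of sites preserves all finite local `κ`-prelimits that exist; in particular it is a
pre-morphism of sites. -/
theorem IsMorphismOfSites.isLocalPrelimit_map {F : C ⥤ D} (hF : IsMorphismOfSites τ σ F)
    (J : Type) [SmallCategory J] [FinCategory J] (g : J ⥤ C) (T : ConeArray.{w} g)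
    (hT : τ.IsLocalPrelimit T) : σ.IsLocalPrelimit (T.map F) := by
  refine ⟨hT.1, fun S => (WeakTopology.FactorsLocally_iff _ _).2 ?_⟩
  refine (hF.1.locally J g S).bind ?_
  rintro b p ⟨R, k, e⟩
  refine ((hF.2.locally (ψ := fun b q => ∃ (i : T.I) (l : b ⟶ F.obj (T.cone i).pt),
    ∀ j, q ≫ F.map (R.π.app j) = l ≫ F.map ((T.cone i).π.app j))
    ((WeakTopology.FactorsLocally_iff _ _).1 (hT.2 R)) ?_).pullback ?_ k).mono ?_
  · rintro a f ⟨i, l, e'⟩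
    exact ⟨i, F.map l, fun j => by rw [← F.map_comp, e' j, F.map_comp]⟩
  · rintro a c q f ⟨i, l, e'⟩
    exact ⟨i, q ≫ l, fun j => by rw [Category.assoc, e' j, Category.assoc]⟩
  · rintro c q ⟨i, l, e'⟩
    refine ⟨i, l, fun j => ?_⟩
    rw [Category.assoc, e j, ← Category.assoc]
    exact e' j

theorem IsMorphismOfSites.isPreMorphismOfSites {F : C ⥤ D} (hF : IsMorphismOfSites τ σ F) :
    IsPreMorphismOfSites τ σ F :=
  fun J _ _ _ g T hT => hF.isLocalPrelimit_map J g T hT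

end Functors

end Sites

section Spans

variable {κ : ArityClass.{w}} {C : Type u} [Category.{v} C] {D : Type u₁} [Category.{v₁} D]

/-! ## Arrays of spans and local prelimits of cospans and parallel pairs -/

namespace SpanArray

/-- The identity array `{1_x, 1_x}`, and more generally `{1_x, f}`. -/
def graph (κ : ArityClass.{w}) {x y : C} (f : x ⟶ y) : SpanArray κ x y where
  I := PUnit
  small := κ.small_punit
  src _ := x
  l _ := 𝟙 x
  r _ := f

/-- The reversed array. -/
def inv {x y : C} (P : SpanArray κ x y) : SpanArray κ y x where
  I := P.I
  small := P.small
  src := P.src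
  l := P.r
  r := P.l

/-- The disjoint union of a `κ`-small family of arrays over `{x, y}`. -/
def union {x y : C} {A : Type w} (hA : κ.Small A) (P : A → SpanArray κ x y) :
    SpanArray κ x y where
  I := Σ a, (P a).I
  small := κ.small_sigma hA fun a => (P a).small
  src k := (P k.1).src k.2
  l k := (P k.1).l k.2
  r k := (P k.1).r k.2

/-- The image of an array under a functor. -/
def map (F : C ⥤ D) {x y : C} (P : SpanArray κ x y) : SpanArray κ (F.obj x) (F.obj y) where
  I := P.I
  small := P.small
  src i := F.obj (P.src i)
  l i := F.map (P.l i)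
  r i := F.map (P.r i)

end SpanArray

namespace WeakTopology

variable (τ : WeakTopology κ C)

/-- The span `(f, g)` factors locally through the array `P`. -/
def Holds {x y : C} (P : SpanArray κ x y) {a : C} (f : a ⟶ x) (g : a ⟶ y) : Prop :=
  τ.Locally a fun b p => ∃ (i : P.I) (h : b ⟶ P.src i), p ≫ f = h ≫ P.l i ∧ p ≫ g = h ≫ P.r i

/-- `R` is a local `κ`-pre-pullback of `f` and `g`, in elementary terms. -/
def IsLocalPrePullback {x y z : C} (f : x ⟶ z) (g : y ⟶ z) (R : SpanArray κ x y) : Prop :=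
  (∀ i, R.l i ≫ f = R.r i ≫ g) ∧
    ∀ ⦃a : C⦄ (h : a ⟶ x) (k : a ⟶ y), h ≫ f = k ≫ g → τ.Holds R h k

/-- `R` is a local `κ`-pre-equalizer of `f` and `g`, in elementary terms. -/
def IsLocalPreEqualizer {x y : C} (f g : x ⟶ y) (R : AryCocone κ x) : Prop :=
  (∀ i, R.hom i ≫ f = R.hom i ≫ g) ∧
    ∀ ⦃a : C⦄ (h : a ⟶ x), h ≫ f = h ≫ g →
      τ.Locally a fun b p => ∃ (i : R.I) (m : b ⟶ R.dom i), p ≫ h = m ≫ R.hom i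

variable {τ}

theorem Holds.precomp {x y : C} {P : SpanArray κ x y} {a b : C} {f : a ⟶ x} {g : a ⟶ y}
    (h : τ.Holds P f g) (p : b ⟶ a) : τ.Holds P (p ≫ f) (p ≫ g) := by
  refine (Locally.pullback h ?_ p).mono ?_
  · rintro b c q r ⟨i, h, e, e'⟩
    exact ⟨i, q ≫ h, by simp [e], by simp [e']⟩
  · rintro c q ⟨i, h, e, e'⟩
    exact ⟨i, h, by simpa using e, by simpa using e'⟩

theorem Holds.glue {x y : C} {P : SpanArray κ x y} {a : C} {f : a ⟶ x} {g : a ⟶ y}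
    (h : τ.Locally a fun _ p => τ.Holds P (p ≫ f) (p ≫ g)) : τ.Holds P f g := by
  refine Locally.bind h fun b p hp => hp.mono ?_
  rintro c q ⟨i, h, e, e'⟩
  exact ⟨i, h, by simpa using e, by simpa using e'⟩

theorem holds_self {x y : C} (P : SpanArray κ x y) (i : P.I) : τ.Holds P (P.l i) (P.r i) :=
  Locally.of ⟨i, 𝟙 _, rfl, rfl⟩

theorem holds_of_factor {x y : C} (P : SpanArray κ x y) (i : P.I) {a : C} (h : a ⟶ P.src i) :
    τ.Holds P (h ≫ P.l i) (h ≫ P.r i) :=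
  (holds_self P i).precomp h

theorem locallyRefines_iff {x y : C} {P Q : SpanArray κ x y} :
    τ.LocallyRefines P Q ↔ ∀ i, τ.Holds Q (P.l i) (P.r i) := Iff.rfl

theorem Holds.trans {x y : C} {P Q : SpanArray κ x y} (H : τ.LocallyRefines P Q) {a : C}
    {f : a ⟶ x} {g : a ⟶ y} (h : τ.Holds P f g) : τ.Holds Q f g := by
  refine Holds.glue (Locally.mono h ?_)
  rintro b p ⟨i, m, e, e'⟩
  rw [e, e']
  exact Holds.precomp (H i) m

theorem locallyRefines_iff' {x y : C} {P Q : SpanArray κ x y} :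
    τ.LocallyRefines P Q ↔ ∀ ⦃a : C⦄ (f : a ⟶ x) (g : a ⟶ y), τ.Holds P f g → τ.Holds Q f g :=
  ⟨fun H _ _ _ h => h.trans H, fun H i => H _ _ (holds_self P i)⟩

theorem locallyRefines_refl {x y : C} (P : SpanArray κ x y) : τ.LocallyRefines P P :=
  holds_self P

theorem LocallyRefines.trans {x y : C} {P Q R : SpanArray κ x y} (h : τ.LocallyRefines P Q)
    (h' : τ.LocallyRefines Q R) : τ.LocallyRefines P R := fun i => Holds.trans h' (h i)

theorem holds_graph {x y a : C} (f : x ⟶ y) (g : a ⟶ x) (h : a ⟶ y) :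
    τ.Holds (SpanArray.graph κ f) g h ↔ τ.Locally a fun _ p => p ≫ g ≫ f = p ≫ h := by
  constructor
  · intro H
    refine Locally.mono H ?_
    rintro b p ⟨i, m, (e : _ = m ≫ 𝟙 x), (e' : _ = m ≫ f)⟩
    have e2 : p ≫ g = m := e.trans (Category.comp_id m)
    rw [← Category.assoc, e2]
    exact e'.symm
  · intro H
    refine Locally.mono H ?_
    intro b p e
    exact ⟨⟨⟩, p ≫ g, (Category.comp_id _).symm, e.symm.trans (Category.assoc _ _ _).symm⟩

theorem holds_inv {x y a : C} (P : SpanArray κ x y) (f : a ⟶ y) (g : a ⟶ x) :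
    τ.Holds P.inv f g ↔ τ.Holds P g f := by
  constructor <;> exact fun H => Locally.mono H fun b p ⟨i, h, e, e'⟩ => ⟨i, h, e', e⟩

theorem holds_union {x y a : C} {A : Type w} (hA : κ.Small A) (P : A → SpanArray κ x y)
    (f : a ⟶ x) (g : a ⟶ y) : τ.Holds (SpanArray.union hA P) f g ↔
      τ.Locally a fun _ p => ∃ i, τ.Holds (P i) (p ≫ f) (p ≫ g) := by
  constructor
  · intro H
    refine Locally.mono H ?_
    rintro b p ⟨⟨i, k⟩, h, e, e'⟩
    exact ⟨i, by rw [e, e']; exact holds_of_factor (P i) k h⟩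
  · intro H
    refine Locally.bind H ?_
    rintro b p ⟨i, hi⟩
    refine Locally.mono hi ?_
    rintro c q ⟨k, h, e, e'⟩
    exact ⟨⟨i, k⟩, h, (Category.assoc _ _ _).trans e, (Category.assoc _ _ _).trans e'⟩

/-! ### Existence and preservation of the elementary prelimits -/

/-- An array over a cospan, as an array of cones. -/
def cospanArray {x y z : C} (f : x ⟶ z) (g : y ⟶ z) (R : SpanArray κ x y)
    (h : ∀ i, R.l i ≫ f = R.r i ≫ g) : ConeArray.{w} (Limits.cospan f g) where
  I := R.I
  cone i := Limits.PullbackCone.mk (R.l i) (R.r i) (h i)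

theorem cospanArray_isLocalPrelimit {x y z : C} {f : x ⟶ z} {g : y ⟶ z} {R : SpanArray κ x y}
    (h : τ.IsLocalPrePullback f g R) : τ.IsLocalPrelimit (cospanArray f g R h.1) := by
  refine ⟨R.small, fun S => (FactorsLocally_iff _ _).2 ?_⟩
  have e : S.π.app .left ≫ f = S.π.app .right ≫ g := by
    have h1 := S.w Limits.WalkingCospan.Hom.inl
    have h2 := S.w Limits.WalkingCospan.Hom.inr
    exact h1.trans h2.symm
  refine Locally.mono (h.2 _ _ e) ?_
  rintro b p ⟨i, m, e1, e2⟩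
  refine ⟨i, m, ?_⟩
  have h1 := S.w Limits.WalkingCospan.Hom.inl
  rintro (_ | _ | _)
  · rw [← h1]
    exact (Category.assoc _ _ _).symm.trans ((congrArg (· ≫ f) e1).trans (Category.assoc _ _ _))
  · exact e1
  · exact e2

/-- An array of cocones equalizing `f` and `g`, as an array of cones. -/
def parallelPairArray {x y : C} (f g : x ⟶ y) (R : AryCocone κ x)
    (h : ∀ i, R.hom i ≫ f = R.hom i ≫ g) : ConeArray.{w} (Limits.parallelPair f g) where
  I := R.I
  cone i := Limits.Fork.ofι (R.hom i) (h i)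

theorem parallelPairArray_isLocalPrelimit {x y : C} {f g : x ⟶ y} {R : AryCocone κ x}
    (h : τ.IsLocalPreEqualizer f g R) : τ.IsLocalPrelimit (parallelPairArray f g R h.1) := by
  refine ⟨R.small, fun S => (FactorsLocally_iff _ _).2 ?_⟩
  have h1 : S.π.app .zero ≫ f = S.π.app .one := S.w Limits.WalkingParallelPairHom.left
  have h2 : S.π.app .zero ≫ g = S.π.app .one := S.w Limits.WalkingParallelPairHom.right
  refine Locally.mono (h.2 _ (h1.trans h2.symm)) ?_
  rintro b p ⟨i, m, e1⟩
  refine ⟨i, m, ?_⟩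
  rintro (_ | _)
  · exact e1
  · rw [← h1]
    exact (Category.assoc _ _ _).symm.trans ((congrArg (· ≫ f) e1).trans (Category.assoc _ _ _))

variable (hτ : τ.HasFiniteConnectedLocalPrelimits)

/-- A chosen local `κ`-pre-pullback of `f` and `g`. -/
noncomputable def prePullback {x y z : C} (f : x ⟶ z) (g : y ⟶ z) : SpanArray κ x y where
  I := (hτ _ (Limits.cospan f g)).choose.I
  small := (hτ _ (Limits.cospan f g)).choose_spec.1
  src i := ((hτ _ (Limits.cospan f g)).choose.cone i).pt
  l i := ((hτ _ (Limits.cospan f g)).choose.cone i).π.app .left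
  r i := ((hτ _ (Limits.cospan f g)).choose.cone i).π.app .right

theorem prePullback_spec {x y z : C} (f : x ⟶ z) (g : y ⟶ z) :
    τ.IsLocalPrePullback f g (prePullback hτ f g) := by
  constructor
  · intro i
    have h1 := ((hτ _ (Limits.cospan f g)).choose.cone i).w Limits.WalkingCospan.Hom.inl
    have h2 := ((hτ _ (Limits.cospan f g)).choose.cone i).w Limits.WalkingCospan.Hom.inr
    exact h1.trans h2.symm
  · intro a h k e
    refine Locally.mono ((FactorsLocally_iff _ _).1
      ((hτ _ (Limits.cospan f g)).choose_spec.2 (Limits.PullbackCone.mk h k e))) ?_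
    rintro b p ⟨i, m, H⟩
    exact ⟨i, m, H .left, H .right⟩

theorem exists_preEqualizer (hτ : τ.HasFiniteConnectedLocalPrelimits) {x y : C} (f g : x ⟶ y) :
    ∃ R : AryCocone κ x, τ.IsLocalPreEqualizer f g R := by
  obtain ⟨T, hT⟩ := hτ _ (Limits.parallelPair f g)
  refine ⟨⟨T.I, hT.1, fun i => (T.cone i).pt, fun i => (T.cone i).π.app .zero⟩, ?_, ?_⟩
  · intro i
    have h1 := (T.cone i).w Limits.WalkingParallelPairHom.left
    have h2 := (T.cone i).w Limits.WalkingParallelPairHom.right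
    exact h1.trans h2.symm
  · intro a h e
    refine Locally.mono ((FactorsLocally_iff _ _).1 (hT.2 (Limits.Fork.ofι h e))) ?_
    rintro b p ⟨i, m, H⟩
    exact ⟨i, m, H .zero⟩

end WeakTopology

namespace IsPreMorphismOfSites

open WeakTopology

variable {τ : WeakTopology κ C} {σ : WeakTopology κ D} {F : C ⥤ D}

theorem map_prePullback (hF : IsPreMorphismOfSites τ σ F) {x y z : C} {f : x ⟶ z} {g : y ⟶ z}
    {R : SpanArray κ x y} (h : τ.IsLocalPrePullback f g R) :
    σ.IsLocalPrePullback (F.map f) (F.map g) (R.map F) := by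
  refine ⟨fun i => ?_, fun a p q e => ?_⟩
  · change F.map _ ≫ _ = F.map _ ≫ _
    rw [← F.map_comp, h.1 i, F.map_comp]
  · have H := (hF _ _ _ (cospanArray_isLocalPrelimit h)).2
      ((Limits.Cone.postcompose (Limits.cospanCompIso F f g).inv).obj
        (Limits.PullbackCone.mk p q e))
    refine Locally.mono ((FactorsLocally_iff _ _).1 H) ?_
    rintro b r ⟨i, m, H⟩
    exact ⟨i, m, (congrArg (r ≫ ·) (Category.comp_id p)).symm.trans (H .left),
      (congrArg (r ≫ ·) (Category.comp_id q)).symm.trans (H .right)⟩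

theorem map_preEqualizer (hF : IsPreMorphismOfSites τ σ F) {x y : C} {f g : x ⟶ y}
    {R : AryCocone κ x} (h : τ.IsLocalPreEqualizer f g R) :
    σ.IsLocalPreEqualizer (F.map f) (F.map g) (R.map F) := by
  refine ⟨fun i => ?_, fun a p e => ?_⟩
  · change F.map _ ≫ _ = F.map _ ≫ _
    rw [← F.map_comp, h.1 i, F.map_comp]
  · have H := (hF _ _ _ (parallelPairArray_isLocalPrelimit h)).2
      ((Limits.Cone.postcompose (Limits.parallelPair.ext (F := Limits.parallelPair f g ⋙ F)
        (G := Limits.parallelPair (F.map f) (F.map g)) (Iso.refl _) (Iso.refl _)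
        (by simp) (by simp)).inv).obj (Limits.Fork.ofι p e))
    refine Locally.mono ((FactorsLocally_iff _ _).1 H) ?_
    rintro b r ⟨i, m, H⟩
    exact ⟨i, m, (congrArg (r ≫ ·) (Category.comp_id p)).symm.trans (H .zero)⟩

theorem preservesCovers (hF : IsPreMorphismOfSites τ σ F) : PreservesCovers τ σ F := by
  intro u P hP
  let g : Discrete PUnit.{1} ⥤ C := Discrete.functor fun _ => u
  let T : ConeArray.{w} g :=
    ⟨P.I, fun i => ⟨P.dom i, Discrete.natTrans fun _ => P.hom i⟩⟩
  have hT : τ.IsLocalPrelimit T := by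
    refine ⟨P.small, fun S => (FactorsLocally_iff _ _).2 ?_⟩
    refine (((covers_iff_locally P).1 hP).pullback ?_ (S.π.app ⟨⟨⟩⟩)).mono ?_
    · rintro b c q f ⟨i, h, rfl⟩
      exact ⟨i, q ≫ h, by simp⟩
    · rintro b p ⟨i, h, e⟩
      exact ⟨i, h, fun _ => e⟩
  refine (covers_iff_locally _).2 ?_
  refine Locally.mono ((FactorsLocally_iff _ _).1
    ((hF _ g T hT).2 ⟨F.obj u, Discrete.natTrans fun _ => 𝟙 _⟩)) ?_
  rintro b p ⟨i, m, H⟩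
  refine ⟨i, m, ?_⟩
  exact (Category.comp_id p).symm.trans (H ⟨⟨⟩⟩)

end IsPreMorphismOfSites

theorem PreservesCovers.holds {τ : WeakTopology κ C} {σ : WeakTopology κ D} {F : C ⥤ D}
    (hF : PreservesCovers τ σ F) {x y a : C} {P : SpanArray κ x y} {f : a ⟶ x} {g : a ⟶ y}
    (h : τ.Holds P f g) : σ.Holds (P.map F) (F.map f) (F.map g) := by
  refine hF.locally h ?_
  rintro b p ⟨i, m, e, e'⟩
  exact ⟨i, F.map m, by rw [← F.map_comp, e, F.map_comp]; rfl,
    by rw [← F.map_comp, e', F.map_comp]; rfl⟩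

/-! ### Composites and meets of arrays of spans -/

namespace WeakTopology

variable {τ : WeakTopology κ C}

theorem holds_of_comp {x y z : C} {P : SpanArray κ x y} {Q : SpanArray κ y z}
    {R : SpanArray κ x z} {B : ∀ (i : P.I) (j : Q.I), SpanArray κ (P.src i) (Q.src j)}
    (hB : ∀ i j, τ.IsLocalPrePullback (P.r i) (Q.l j) (B i j))
    (hR : ∀ i j k, τ.Holds R ((B i j).l k ≫ P.l i) ((B i j).r k ≫ Q.r j))
    {a : C} {f : a ⟶ x} {g : a ⟶ y} {h : a ⟶ z} (hP : τ.Holds P f g) (hQ : τ.Holds Q g h) :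
    τ.Holds R f h := by
  refine Holds.glue (Locally.bind (Locally.and hP hQ ?_ ?_) ?_)
  · rintro b c q p ⟨i, h, e, e'⟩
    exact ⟨i, q ≫ h, by simp [e], by simp [e']⟩
  · rintro b c q p ⟨i, h, e, e'⟩
    exact ⟨i, q ≫ h, by simp [e], by simp [e']⟩
  · rintro b p ⟨⟨i, m, e1, e2⟩, ⟨j, n, e3, e4⟩⟩
    refine Locally.mono ((hB i j).2 m n (e2.symm.trans e3)) ?_
    rintro c q ⟨k, t, e5, e6⟩
    have := (hR i j k).precomp t
    rwa [← Category.assoc, ← e5, ← Category.assoc, ← e6, Category.assoc, ← e1, Category.assoc,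
      ← e4, ← Category.assoc, ← Category.assoc] at this

theorem holds_of_meet {x y : C} {P Q R : SpanArray κ x y}
    {B : ∀ (i : P.I) (j : Q.I), SpanArray κ (P.src i) (Q.src j)}
    (hB : ∀ i j, τ.IsLocalPrePullback (P.l i) (Q.l j) (B i j))
    {E : ∀ (i : P.I) (j : Q.I) (k : (B i j).I), AryCocone κ ((B i j).src k)}
    (hE : ∀ i j k, τ.IsLocalPreEqualizer ((B i j).l k ≫ P.r i) ((B i j).r k ≫ Q.r j) (E i j k))
    (hR : ∀ i j k t, τ.Holds R ((E i j k).hom t ≫ (B i j).l k ≫ P.l i)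
      ((E i j k).hom t ≫ (B i j).l k ≫ P.r i))
    {a : C} {f : a ⟶ x} {g : a ⟶ y} (hP : τ.Holds P f g) (hQ : τ.Holds Q f g) :
    τ.Holds R f g := by
  refine Holds.glue (Locally.bind (Locally.and hP hQ ?_ ?_) ?_)
  · rintro b c q p ⟨i, h, e, e'⟩
    exact ⟨i, q ≫ h, by simp [e], by simp [e']⟩
  · rintro b c q p ⟨i, h, e, e'⟩
    exact ⟨i, q ≫ h, by simp [e], by simp [e']⟩
  · rintro b p ⟨⟨i, m, e1, e2⟩, ⟨j, n, e3, e4⟩⟩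
    refine Locally.bind ((hB i j).2 m n (e1.symm.trans e3)) ?_
    rintro c q ⟨k, s, e5, e6⟩
    refine Locally.mono ((hE i j k).2 s ?_) ?_
    · rw [← Category.assoc, ← e5, ← Category.assoc, ← e6, Category.assoc, Category.assoc, ← e2,
        ← e4]
    · rintro d r ⟨t, l, e7⟩
      have := (hR i j k t).precomp l
      rw [← Category.assoc l, ← e7, ← Category.assoc l, ← e7] at this
      simp only [Category.assoc] at this ⊢
      rwa [← Category.assoc s, ← e5, ← Category.assoc s, ← e5, Category.assoc, ← e1,
        Category.assoc, ← e2] at this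

end WeakTopology

end Spans

/-! ## Allegories and framed allegories -/

/-- A (moderate) `κ`-ary allegory. The hom-categories are posets, so the 2-category structure
amounts to a category whose homs are partially ordered and whose composition is monotone. Joins are
expressed by `IsLUB`; composition is written in diagrammatic order. -/
structure Allegory (κ : ArityClass.{w}) where
  Obj : Type (w + 1)
  [category : Category.{w + 1} Obj]
  [order : ∀ x y : Obj, SemilatticeInf (x ⟶ y)]
  comp_le_comp : ∀ {x y z : Obj} {φ φ' : x ⟶ y} {ψ ψ' : y ⟶ z}, φ ≤ φ' → ψ ≤ ψ' →
    φ ≫ ψ ≤ φ' ≫ ψ'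
  exists_join : ∀ {x y : Obj} {I : Type w}, κ.Small I → ∀ φ : I → (x ⟶ y),
    ∃ s, IsLUB (Set.range φ) s
  join_comp : ∀ {x y z : Obj} {I : Type w} {φ : I → (x ⟶ y)} {s : x ⟶ y} (ψ : y ⟶ z),
    κ.Small I → IsLUB (Set.range φ) s → IsLUB (Set.range fun i => φ i ≫ ψ) (s ≫ ψ)
  comp_join : ∀ {x y z : Obj} {I : Type w} {φ : I → (y ⟶ z)} {s : y ⟶ z} (ψ : x ⟶ y),
    κ.Small I → IsLUB (Set.range φ) s → IsLUB (Set.range fun i => ψ ≫ φ i) (ψ ≫ s)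
  join_inf : ∀ {x y : Obj} {I : Type w} {φ : I → (x ⟶ y)} {s : x ⟶ y} (ψ : x ⟶ y),
    κ.Small I → IsLUB (Set.range φ) s → IsLUB (Set.range fun i => φ i ⊓ ψ) (s ⊓ ψ)
  inv : ∀ {x y : Obj}, (x ⟶ y) → (y ⟶ x)
  inv_le_inv : ∀ {x y : Obj} {φ ψ : x ⟶ y}, φ ≤ ψ → inv φ ≤ inv ψ
  inv_id : ∀ x : Obj, inv (𝟙 x) = 𝟙 x
  inv_comp : ∀ {x y z : Obj} (φ : x ⟶ y) (ψ : y ⟶ z), inv (φ ≫ ψ) = inv ψ ≫ inv φ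
  inv_inv : ∀ {x y : Obj} (φ : x ⟶ y), inv (inv φ) = φ
  modular : ∀ {x y z : Obj} (φ : x ⟶ y) (ψ : y ⟶ z) (χ : x ⟶ z),
    φ ≫ ψ ⊓ χ ≤ φ ≫ (ψ ⊓ inv φ ≫ χ)

attribute [instance] Allegory.category Allegory.order

namespace Allegory

variable {κ : ArityClass.{w}}

/-- A map in an allegory: a morphism with a right adjoint. -/
def IsMap (A : Allegory κ) {x y : A.Obj} (φ : x ⟶ y) : Prop :=
  ∃ ψ : y ⟶ x, 𝟙 x ≤ φ ≫ ψ ∧ ψ ≫ φ ≤ 𝟙 y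

theorem isMap_id (A : Allegory κ) (x : A.Obj) : A.IsMap (𝟙 x) :=
  ⟨𝟙 x, by simp, by simp⟩

theorem IsMap.comp {A : Allegory κ} {x y z : A.Obj} {φ : x ⟶ y} {ψ : y ⟶ z} (h : A.IsMap φ)
    (h' : A.IsMap ψ) : A.IsMap (φ ≫ ψ) := by
  obtain ⟨φ', h1, h2⟩ := h
  obtain ⟨ψ', h3, h4⟩ := h'
  refine ⟨ψ' ≫ φ', ?_, ?_⟩
  · calc 𝟙 x ≤ φ ≫ 𝟙 y ≫ φ' := by simpa using h1
      _ ≤ φ ≫ (ψ ≫ ψ') ≫ φ' := A.comp_le_comp le_rfl (A.comp_le_comp h3 le_rfl)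
      _ = _ := by simp
  · calc (ψ' ≫ φ') ≫ φ ≫ ψ = ψ' ≫ (φ' ≫ φ) ≫ ψ := by simp
      _ ≤ ψ' ≫ 𝟙 y ≫ ψ := A.comp_le_comp le_rfl (A.comp_le_comp h2 le_rfl)
      _ ≤ 𝟙 z := by simpa using h4

/-- Every hom-poset has a top element. -/
def HasLocalMaxima (A : Allegory κ) : Prop :=
  ∀ x y : A.Obj, ∃ t : x ⟶ y, IsTop t

/-- A weak `κ`-unit: a `κ`-ary family `U` of objects such that every object `x` admits a cone
`Φ` to `U` with `1 ≤ ⋁ (Φ° Φ)`. -/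
def IsWeakUnit (A : Allegory κ) {I : Type w} (U : I → A.Obj) : Prop :=
  κ.Small I ∧ ∀ x : A.Obj, ∃ (Φ : ∀ i, x ⟶ U i) (s : x ⟶ x),
    IsLUB (Set.range fun i => Φ i ≫ A.inv (Φ i)) s ∧ 𝟙 x ≤ s

/-- The existence of a weak `κ`-unit. -/
def HasWeakUnit (A : Allegory κ) : Prop :=
  ∃ (I : Type w) (U : I → A.Obj), A.IsWeakUnit U

end Allegory

/-- A `κ`-ary allegory functor. -/
structure AllegoryFunctor {κ : ArityClass.{w}} (A B : Allegory κ) extends A.Obj ⥤ B.Obj where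
  map_le_map : ∀ {x y : A.Obj} {φ ψ : x ⟶ y}, φ ≤ ψ → map φ ≤ map ψ
  map_inv : ∀ {x y : A.Obj} (φ : x ⟶ y), map (A.inv φ) = B.inv (map φ)
  map_inf : ∀ {x y : A.Obj} (φ ψ : x ⟶ y), map (φ ⊓ ψ) = map φ ⊓ map ψ
  map_join : ∀ {x y : A.Obj} {I : Type w} {φ : I → (x ⟶ y)} {s : x ⟶ y}, κ.Small I →
    IsLUB (Set.range φ) s → IsLUB (Set.range fun i => map (φ i)) (map s)

namespace AllegoryFunctor

variable {κ : ArityClass.{w}} {A B C : Allegory κ}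

/-- The identity allegory functor. -/
def id (A : Allegory κ) : AllegoryFunctor A A where
  __ := 𝟭 A.Obj
  map_le_map h := h
  map_inv _ := rfl
  map_inf _ _ := rfl
  map_join _ h := h

/-- Composition of allegory functors. -/
def comp (F : AllegoryFunctor A B) (G : AllegoryFunctor B C) : AllegoryFunctor A C where
  __ := F.toFunctor ⋙ G.toFunctor
  map_le_map h := G.map_le_map (F.map_le_map h)
  map_inv φ := (congrArg G.map (F.map_inv φ)).trans (G.map_inv _)
  map_inf φ ψ := (congrArg G.map (F.map_inf φ ψ)).trans (G.map_inf _ _)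
  map_join hI h := G.map_join hI (F.map_join hI h)

theorem isMap_map (F : AllegoryFunctor A B) {x y : A.Obj} {φ : x ⟶ y} (h : A.IsMap φ) :
    B.IsMap (F.map φ) := by
  obtain ⟨ψ, h1, h2⟩ := h
  refine ⟨F.map ψ, ?_, ?_⟩
  · simpa using F.map_le_map h1
  · simpa using F.map_le_map h2

/-- `F` preserves the top elements of the hom-posets. -/
def PreservesLocalMaxima (F : AllegoryFunctor A B) : Prop :=
  ∀ ⦃x y : A.Obj⦄ (t : x ⟶ y), IsTop t → IsTop (F.map t)

/-- `F` preserves weak `κ`-units. -/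
def PreservesWeakUnits (F : AllegoryFunctor A B) : Prop :=
  ∀ ⦃I : Type w⦄ (U : I → A.Obj), A.IsWeakUnit U → B.IsWeakUnit fun i => F.obj (U i)

end AllegoryFunctor

/-- An allegory transformation: an oplax natural transformation whose components are maps. -/
structure AllegoryTransformation {κ : ArityClass.{w}} {A B : Allegory κ}
    (F G : AllegoryFunctor A B) where
  app : ∀ x : A.Obj, F.obj x ⟶ G.obj x
  isMap_app : ∀ x, B.IsMap (app x)
  oplax : ∀ {x y : A.Obj} (φ : x ⟶ y), F.map φ ≫ app y ≤ app x ≫ G.map φ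

/-- A framed `κ`-ary allegory: an allegory together with a category of tight maps with the same
objects and an identity-on-objects functor `J` from tight maps to the maps of the allegory. -/
structure FramedAllegory (κ : ArityClass.{w}) extends Allegory κ where
  Tight : Obj → Obj → Type (w + 1)
  tid : ∀ x, Tight x x
  tcomp : ∀ {x y z}, Tight x y → Tight y z → Tight x z
  tid_tcomp : ∀ {x y} (f : Tight x y), tcomp (tid x) f = f
  tcomp_tid : ∀ {x y} (f : Tight x y), tcomp f (tid y) = f
  tassoc : ∀ {x y z t} (f : Tight x y) (g : Tight y z) (h : Tight z t),
    tcomp (tcomp f g) h = tcomp f (tcomp g h)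
  J : ∀ {x y}, Tight x y → (x ⟶ y)
  J_tid : ∀ x, J (tid x) = 𝟙 x
  J_tcomp : ∀ {x y z} (f : Tight x y) (g : Tight y z), J (tcomp f g) = J f ≫ J g
  isMap_J : ∀ {x y} (f : Tight x y), toAllegory.IsMap (J f)

namespace FramedAllegory

variable {κ : ArityClass.{w}}

/-- The category of tight maps of a framed allegory. -/
def TMap (A : FramedAllegory κ) : Type (w + 1) := A.Obj

instance (A : FramedAllegory κ) : Category.{w + 1} A.TMap where
  Hom x y := A.Tight x y
  id x := A.tid x
  comp f g := A.tcomp f g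
  id_comp f := A.tid_tcomp f
  comp_id f := A.tcomp_tid f
  assoc f g h := A.tassoc f g h

/-- The loose map `f_•` underlying a tight map. -/
def loose (A : FramedAllegory κ) {x y : A.TMap} (f : x ⟶ y) :
    @Quiver.Hom A.Obj _ x y := A.J f

/-- The right adjoint `f^•` of the loose map underlying a tight map. -/
def coloose (A : FramedAllegory κ) {x y : A.TMap} (f : x ⟶ y) :
    @Quiver.Hom A.Obj _ y x := A.inv (A.J f)

/-- A `κ`-ary cocone `P` of tight maps is covering if `⋁ (P_• P^•) = 1`. -/
def IsCovering (A : FramedAllegory κ) {u : A.Obj} (P : AryCocone κ (C := A.TMap) u) : Prop :=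
  IsLUB (Set.range fun i => A.coloose (P.hom i) ≫ A.loose (P.hom i)) (𝟙 u)

/-- A framed allegory is weakly `κ`-tabular if every morphism `φ` is a join `⋁ (F_• G^•)` for
`κ`-ary cocones `F`, `G` of tight maps (with the same source), and if every two parallel tight maps
with the same underlying loose map are equalized by a covering cocone of tight maps. -/
structure IsWeaklyTabular (A : FramedAllegory κ) : Prop where
  exists_tabulation : ∀ {x y : A.Obj} (φ : x ⟶ y),
    ∃ P : SpanArray κ (C := A.TMap) x y,
      IsLUB (Set.range fun i => A.coloose (P.l i) ≫ A.loose (P.r i)) φ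
  exists_covering : ∀ {x y : A.TMap} (f g : x ⟶ y), A.loose f = A.loose g →
    ∃ P : AryCocone κ x, A.IsCovering P ∧ ∀ i, P.hom i ≫ f = P.hom i ≫ g

/-- A framed `κ`-ary allegory functor. -/
structure Functor (A B : FramedAllegory κ) extends
    AllegoryFunctor A.toAllegory B.toAllegory where
  tmap : ∀ {x y : A.Obj}, A.Tight x y → B.Tight (obj x) (obj y)
  tmap_tid : ∀ x : A.Obj, tmap (A.tid x) = B.tid (obj x)
  tmap_tcomp : ∀ {x y z : A.Obj} (f : A.Tight x y) (g : A.Tight y z),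
    tmap (A.tcomp f g) = B.tcomp (tmap f) (tmap g)
  J_tmap : ∀ {x y : A.Obj} (f : A.Tight x y), B.J (tmap f) = map (A.J f)

/-- A framed `κ`-ary allegory transformation: an allegory transformation together with a
compatible natural transformation on tight maps. -/
structure Transformation {A B : FramedAllegory κ} (F G : Functor A B) extends
    AllegoryTransformation F.toAllegoryFunctor G.toAllegoryFunctor where
  tapp : ∀ x : A.Obj, B.Tight (F.obj x) (G.obj x)
  tnaturality : ∀ {x y : A.Obj} (f : A.Tight x y),
    B.tcomp (F.tmap f) (tapp y) = B.tcomp (tapp x) (G.tmap f)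
  J_tapp : ∀ x : A.Obj, B.J (tapp x) = app x

theorem Transformation.ext' {A B : FramedAllegory κ} {F G : Functor A B}
    {α β : Transformation F G} (h : ∀ x, α.tapp x = β.tapp x) : α = β := by
  obtain ⟨⟨a, _, _⟩, a', _, ha⟩ := α
  obtain ⟨⟨b, _, _⟩, b', _, hb⟩ := β
  obtain rfl : a' = b' := funext h
  obtain rfl : a = b := funext fun x => (ha x).symm.trans (hb x)
  rfl

instance (A B : FramedAllegory κ) : Category.{w + 1} (Functor A B) where
  Hom F G := Transformation F G
  id F :=
    { app := fun x => 𝟙 (F.obj x)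
      isMap_app := fun _ => B.isMap_id _
      oplax := fun φ => by simp
      tapp := fun x => B.tid (F.obj x)
      tnaturality := fun f => by rw [B.tid_tcomp, B.tcomp_tid]
      J_tapp := fun _ => B.J_tid _ }
  comp {F G H} α β :=
    { app := fun x => α.app x ≫ β.app x
      isMap_app := fun x => (α.isMap_app x).comp (β.isMap_app x)
      oplax := fun {x y} φ => by
        calc F.map φ ≫ α.app y ≫ β.app y = (F.map φ ≫ α.app y) ≫ β.app y := by simp
          _ ≤ (α.app x ≫ G.map φ) ≫ β.app y := B.comp_le_comp (α.oplax φ) le_rfl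
          _ = α.app x ≫ G.map φ ≫ β.app y := by simp
          _ ≤ α.app x ≫ β.app x ≫ H.map φ := B.comp_le_comp le_rfl (β.oplax φ)
          _ = _ := by simp
      tapp := fun x => B.tcomp (α.tapp x) (β.tapp x)
      tnaturality := fun f => by
        rw [← B.tassoc, α.tnaturality, B.tassoc, β.tnaturality, B.tassoc]
      J_tapp := fun x => by rw [B.J_tcomp, α.J_tapp, β.J_tapp] }
  id_comp α := Transformation.ext' fun x => B.tid_tcomp _
  comp_id α := Transformation.ext' fun x => B.tcomp_tid _
  assoc α β γ := Transformation.ext' fun x => B.tassoc _ _ _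

/-- The identity framed allegory functor. -/
def Functor.id (A : FramedAllegory κ) : Functor A A where
  __ := AllegoryFunctor.id A.toAllegory
  tmap f := f
  tmap_tid _ := rfl
  tmap_tcomp _ _ := rfl
  J_tmap _ := rfl

/-- Composition of framed allegory functors. -/
def Functor.comp {A B C : FramedAllegory κ} (F : Functor A B) (G : Functor B C) :
    Functor A C where
  __ := F.toAllegoryFunctor.comp G.toAllegoryFunctor
  tmap f := G.tmap (F.tmap f)
  tmap_tid x := (congrArg G.tmap (F.tmap_tid x)).trans (G.tmap_tid _)
  tmap_tcomp f g := (congrArg G.tmap (F.tmap_tcomp f g)).trans (G.tmap_tcomp _ _)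
  J_tmap f := (G.J_tmap _).trans (congrArg G.map (F.J_tmap f))

/-- Whiskering on the left. -/
def whiskerLeft {A B C : FramedAllegory κ} (F : Functor A B) {G H : Functor B C} (α : G ⟶ H) :
    F.comp G ⟶ F.comp H where
  app x := α.app (F.obj x)
  isMap_app x := α.isMap_app _
  oplax φ := α.oplax (F.map φ)
  tapp x := α.tapp (F.obj x)
  tnaturality f := α.tnaturality (F.tmap f)
  J_tapp x := α.J_tapp _

/-- Whiskering on the right. -/
def whiskerRight {A B C : FramedAllegory κ} {F G : Functor A B} (α : F ⟶ G) (H : Functor B C) :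
    F.comp H ⟶ G.comp H where
  app x := H.map (α.app x)
  isMap_app x := H.isMap_map (α.isMap_app x)
  oplax {x y} φ := by
    have := H.map_le_map (α.oplax φ)
    rwa [H.map_comp, H.map_comp] at this
  tapp x := H.tmap (α.tapp x)
  tnaturality f := by
    have := congrArg H.tmap (α.tnaturality f)
    rwa [H.tmap_tcomp, H.tmap_tcomp] at this
  J_tapp x := (H.J_tmap _).trans (congrArg H.map (α.J_tapp x))

@[simp]
theorem tapp_id {A B : FramedAllegory κ} (F : Functor A B) (x : A.Obj) :
    Transformation.tapp (𝟙 F) x = B.tid (F.obj x) := rfl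

@[simp]
theorem tapp_comp {A B : FramedAllegory κ} {F G H : Functor A B} (α : F ⟶ G) (β : G ⟶ H)
    (x : A.Obj) : Transformation.tapp (α ≫ β) x = B.tcomp (α.tapp x) (β.tapp x) := rfl

/-- The 2-category of framed `κ`-ary allegories. -/
instance : Bicategory.{w + 1, w + 1} (FramedAllegory κ) where
  Hom A B := Functor A B
  id A := Functor.id A
  comp F G := F.comp G
  homCategory A B := inferInstanceAs (Category (Functor A B))
  whiskerLeft F _ _ α := whiskerLeft F α
  whiskerRight α H := whiskerRight α H
  associator F G H := Iso.refl ((F.comp G).comp H)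
  leftUnitor F := Iso.refl F
  rightUnitor F := Iso.refl F
  whiskerLeft_id _ _ := rfl
  whiskerLeft_comp _ _ _ _ _ _ := rfl
  id_whiskerLeft {_ B} _ _ α := Transformation.ext' fun x =>
    ((B.tid_tcomp _).trans (B.tcomp_tid _)).symm
  comp_whiskerLeft {_ _ _ D} F G _ _ α := Transformation.ext' fun x =>
    ((D.tid_tcomp _).trans (D.tcomp_tid _)).symm
  id_whiskerRight F G := Transformation.ext' fun x => G.tmap_tid _
  comp_whiskerRight _ _ H := Transformation.ext' fun x => H.tmap_tcomp _ _
  whiskerRight_id {_ B} _ _ α := Transformation.ext' fun x =>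
    ((B.tid_tcomp _).trans (B.tcomp_tid _)).symm
  whiskerRight_comp {_ _ _ D} _ _ _ _ _ := Transformation.ext' fun x =>
    ((D.tid_tcomp _).trans (D.tcomp_tid _)).symm
  whisker_assoc {_ _ _ D} _ _ _ _ _ := Transformation.ext' fun x =>
    ((D.tid_tcomp _).trans (D.tcomp_tid _)).symm
  whisker_exchange α β := Transformation.ext' fun x => (β.tnaturality (α.tapp x)).symm
  pentagon {_ _ _ _ E} F G H K := Transformation.ext' fun x => by
    refine (congrArg (fun t => E.tcomp t _) (K.tmap_tid _)).trans ?_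
    exact E.tid_tcomp _
  triangle {_ _ C} F G := Transformation.ext' fun x =>
    (C.tid_tcomp _).trans (G.tmap_tid _).symm

instance : Bicategory.Strict (FramedAllegory κ) where
  id_comp _ := rfl
  comp_id _ := rfl
  assoc _ _ _ := rfl
  leftUnitor_eqToIso _ := rfl
  rightUnitor_eqToIso _ := rfl
  associator_eqToIso _ _ _ := Iso.ext rfl

end FramedAllegory

/-! ## The 2-category of weakly `κ`-ary sites and locally full sub-2-categories -/

/-- A (moderate) weakly `κ`-ary site. -/
structure WeakSite (κ : ArityClass.{w}) where
  Obj : Type (w + 1)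
  [category : Category.{w + 1} Obj]
  top : WeakTopology κ Obj

attribute [instance] WeakSite.category

namespace WeakSite

variable {κ : ArityClass.{w}}

/-- The 2-category of weakly `κ`-ary sites, all functors and all natural transformations; the
2-categories of sites below are locally full sub-2-categories of it. -/
instance : Bicategory.{w + 1, w + 1} (WeakSite κ) where
  Hom C D := C.Obj ⥤ D.Obj
  id C := 𝟭 C.Obj
  comp F G := F ⋙ G
  homCategory C D := inferInstanceAs (Category (C.Obj ⥤ D.Obj))
  whiskerLeft F _ _ α := CategoryTheory.Functor.whiskerLeft F α
  whiskerRight α H := CategoryTheory.Functor.whiskerRight α H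
  associator F G H := CategoryTheory.Functor.associator F G H
  leftUnitor F := CategoryTheory.Functor.leftUnitor F
  rightUnitor F := CategoryTheory.Functor.rightUnitor F
  whisker_exchange {_ _ _ _ _ _ _} α β := by
    apply NatTrans.ext
    funext x
    exact (β.naturality (α.app x)).symm

instance : Bicategory.Strict (WeakSite κ) where
  id_comp _ := rfl
  comp_id _ := rfl
  assoc _ _ _ := rfl
  leftUnitor_eqToIso _ := Iso.ext rfl
  rightUnitor_eqToIso _ := Iso.ext rfl
  associator_eqToIso _ _ _ := Iso.ext rfl

end WeakSite

/-- A locally full sub-2-category: a class of objects, and a class of 1-cells containing identities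
and closed under composition. -/
structure SubTwoCategory (B : Type u) [Bicategory.{w, v} B] where
  objProp : B → Prop
  homProp : ∀ {a b : B}, (a ⟶ b) → Prop
  id_mem : ∀ a : B, homProp (𝟙 a)
  comp_mem : ∀ {a b c : B} (f : a ⟶ b) (g : b ⟶ c), homProp f → homProp g → homProp (f ≫ g)

namespace SubTwoCategory

variable {B : Type u} [Bicategory.{w, v} B]

/-- The objects of a locally full sub-2-category. -/
@[ext]
structure Carrier (S : SubTwoCategory B) where
  obj : B
  property : S.objProp obj

/-- The 1-cells of a locally full sub-2-category. -/
@[ext]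
structure OneCell {S : SubTwoCategory B} (a b : S.Carrier) where
  hom : a.obj ⟶ b.obj
  property : S.homProp hom

variable {S : SubTwoCategory B}

instance (a b : S.Carrier) : Category (OneCell a b) where
  Hom f g := f.hom ⟶ g.hom
  id f := 𝟙 f.hom
  comp α β := CategoryStruct.comp (obj := a.obj ⟶ b.obj) α β
  id_comp _ := Category.id_comp (obj := a.obj ⟶ b.obj) _
  comp_id _ := Category.comp_id (obj := a.obj ⟶ b.obj) _
  assoc _ _ _ := Category.assoc (obj := a.obj ⟶ b.obj) _ _ _

/-- An invertible 2-cell of the ambient 2-category between 1-cells of the sub-2-category. -/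
def isoMk {a b : S.Carrier} {f g : OneCell a b} (e : f.hom ≅ g.hom) : f ≅ g where
  hom := e.hom
  inv := e.inv
  hom_inv_id := e.hom_inv_id
  inv_hom_id := e.inv_hom_id

open Bicategory in
/-- The 2-cells of a locally full sub-2-category are all those of the ambient 2-category. -/
instance : Bicategory.{w, v} S.Carrier where
  Hom a b := OneCell a b
  id a := ⟨𝟙 a.obj, S.id_mem _⟩
  comp f g := ⟨f.hom ≫ g.hom, S.comp_mem _ _ f.property g.property⟩
  homCategory a b := inferInstanceAs (Category (OneCell a b))
  whiskerLeft f _ _ α := Bicategory.whiskerLeft (B := B) f.hom α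
  whiskerRight α h := Bicategory.whiskerRight (B := B) α h.hom
  associator f g h := isoMk (α_ f.hom g.hom h.hom)
  leftUnitor f := isoMk (λ_ f.hom)
  rightUnitor f := isoMk (ρ_ f.hom)
  whiskerLeft_id f g := Bicategory.whiskerLeft_id (B := B) f.hom g.hom
  whiskerLeft_comp f _ _ _ α β := Bicategory.whiskerLeft_comp (B := B) f.hom α β
  id_whiskerLeft α := Bicategory.id_whiskerLeft (B := B) α
  comp_whiskerLeft f g _ _ α := Bicategory.comp_whiskerLeft (B := B) f.hom g.hom α
  id_whiskerRight f g := Bicategory.id_whiskerRight (B := B) f.hom g.hom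
  comp_whiskerRight α β h := Bicategory.comp_whiskerRight (B := B) α β h.hom
  whiskerRight_id α := Bicategory.whiskerRight_id (B := B) α
  whiskerRight_comp α g h := Bicategory.whiskerRight_comp (B := B) α g.hom h.hom
  whisker_assoc f _ _ α h := Bicategory.whisker_assoc (B := B) f.hom α h.hom
  whisker_exchange α β := Bicategory.whisker_exchange (B := B) α β
  pentagon f g h i := Bicategory.pentagon (B := B) f.hom g.hom h.hom i.hom
  triangle f g := Bicategory.triangle (B := B) f.hom g.hom

theorem eqToHom_eq {a b : S.Carrier} {f g : a ⟶ b} (h : f = g) :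
    (eqToHom h : f ⟶ g) =
      (eqToHom (congrArg OneCell.hom h) : OneCell.hom f ⟶ OneCell.hom g) := by
  cases h
  rfl

instance [Bicategory.Strict B] : Bicategory.Strict S.Carrier where
  id_comp f := OneCell.ext (Bicategory.Strict.id_comp f.hom)
  comp_id f := OneCell.ext (Bicategory.Strict.comp_id f.hom)
  assoc f g h := OneCell.ext (Bicategory.Strict.assoc f.hom g.hom h.hom)
  leftUnitor_eqToIso {a b} f := by
    have e : 𝟙 a ≫ f = f := OneCell.ext (Bicategory.Strict.id_comp f.hom)
    have e' := congrArg Iso.hom (Bicategory.Strict.leftUnitor_eqToIso f.hom)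
    exact Iso.ext (e'.trans (eqToHom_eq e).symm)
  rightUnitor_eqToIso {a b} f := by
    have e : f ≫ 𝟙 b = f := OneCell.ext (Bicategory.Strict.comp_id f.hom)
    have e' := congrArg Iso.hom (Bicategory.Strict.rightUnitor_eqToIso f.hom)
    exact Iso.ext (e'.trans (eqToHom_eq e).symm)
  associator_eqToIso f g h := by
    have e : (f ≫ g) ≫ h = f ≫ g ≫ h :=
      OneCell.ext (Bicategory.Strict.assoc f.hom g.hom h.hom)
    have e' := congrArg Iso.hom (Bicategory.Strict.associator_eqToIso f.hom g.hom h.hom)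
    exact Iso.ext (e'.trans (eqToHom_eq e).symm)

end SubTwoCategory

/-- A strict 2-functor between strict 2-categories is a 2-equivalence if it induces isomorphisms of
hom-categories (it is bijective on 1-cells and on 2-cells between given 1-cells) and every object
of the target is isomorphic to one in its image. -/
structure IsTwoEquivalence {B : Type u} [Bicategory.{w, v} B] [Bicategory.Strict B]
    {C : Type u₁} [Bicategory.{v₂, v₁} C] [Bicategory.Strict C]
    (F : StrictPseudofunctor B C) : Prop where
  bijective_map : ∀ a b : B, Function.Bijective fun f : a ⟶ b => F.map f
  bijective_map₂ : ∀ {a b : B} (f g : a ⟶ b), Function.Bijective fun α : f ⟶ g => F.map₂ α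
  exists_iso : ∀ c : C, ∃ (a : B) (e : F.obj a ⟶ c) (e' : c ⟶ F.obj a),
    e ≫ e' = 𝟙 (F.obj a) ∧ e' ≫ e = 𝟙 c

/-! ## The 2-categories of the theorem -/

/-- Locally `κ`-ary sites, pre-morphisms of sites, and all natural transformations. -/
def lsite (κ : ArityClass.{w}) : SubTwoCategory (WeakSite κ) where
  objProp C := C.top.HasFiniteConnectedLocalPrelimits
  homProp {C D} F := IsPreMorphismOfSites C.top D.top F
  id_mem _ := IsPreMorphismOfSites.id
  comp_mem _ _ hF hG := hF.comp hG

/-- `κ`-ary sites, morphisms of sites, and all natural transformations. -/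
def site (κ : ArityClass.{w}) : SubTwoCategory (WeakSite κ) where
  objProp C := C.top.HasFiniteLocalPrelimits
  homProp {C D} F := IsMorphismOfSites C.top D.top F
  id_mem _ := IsMorphismOfSites.id
  comp_mem _ _ hF hG := hF.comp hG

/-- Weakly `κ`-tabular framed `κ`-ary allegories, all framed allegory functors and
transformations. -/
def fallWT (κ : ArityClass.{w}) : SubTwoCategory (FramedAllegory κ) where
  objProp A := A.IsWeaklyTabular
  homProp _ := True
  id_mem _ := trivial
  comp_mem _ _ _ _ := trivial

/-- Weakly `κ`-tabular framed `κ`-ary allegories with local maxima and weak `κ`-units, framed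
allegory functors preserving local maxima and weak `κ`-units, and all transformations. -/
def fallWTX (κ : ArityClass.{w}) : SubTwoCategory (FramedAllegory κ) where
  objProp A := A.IsWeaklyTabular ∧ A.HasLocalMaxima ∧ A.HasWeakUnit
  homProp F := AllegoryFunctor.PreservesLocalMaxima (FramedAllegory.Functor.toAllegoryFunctor F) ∧
    AllegoryFunctor.PreservesWeakUnits (FramedAllegory.Functor.toAllegoryFunctor F)
  id_mem _ := ⟨fun _ _ _ h => h, fun _ _ h => h⟩
  comp_mem _ _ hF hG := ⟨fun _ _ _ h => hG.1 _ (hF.1 _ h), fun _ _ h => hG.2 _ (hF.2 _ h)⟩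

/-! ## The framed allegory of a locally `κ`-ary site -/

section RelHom

open WeakTopology

variable {κ : ArityClass.{w}} {C : Type u} [Category.{v} C]

/-- Local equivalence of `κ`-sourced arrays over `{x, y}`. -/
def spanSetoid (τ : WeakTopology κ C) (x y : C) : Setoid (SpanArray κ x y) where
  r P Q := τ.LocallyRefines P Q ∧ τ.LocallyRefines Q P
  iseqv := ⟨fun P => ⟨locallyRefines_refl P, locallyRefines_refl P⟩, fun h => ⟨h.2, h.1⟩,
    fun h h' => ⟨h.1.trans h'.1, h'.2.trans h.2⟩⟩

/-- The poset reflection of the preorder of `κ`-sourced arrays over `{x, y}` under local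
refinement. -/
def RelHom (τ : WeakTopology κ C) (x y : C) := Quotient (spanSetoid τ x y)

namespace RelHom

variable {τ : WeakTopology κ C}

/-- The class of an array. -/
def mk (τ : WeakTopology κ C) {x y : C} (P : SpanArray κ x y) : RelHom τ x y :=
  Quotient.mk (spanSetoid τ x y) P

instance (x y : C) : PartialOrder (RelHom τ x y) where
  le := Quotient.lift₂ (s₁ := spanSetoid τ x y) (s₂ := spanSetoid τ x y) τ.LocallyRefines
    fun P Q P' Q' (h : τ.LocallyRefines P P' ∧ τ.LocallyRefines P' P)
      (h' : τ.LocallyRefines Q Q' ∧ τ.LocallyRefines Q' Q) =>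
    propext ⟨fun H => (h.2.trans H).trans h'.1, fun H => (h.1.trans H).trans h'.2⟩
  le_refl φ := Quotient.inductionOn φ fun P => locallyRefines_refl P
  le_trans φ ψ χ := Quotient.inductionOn₃ φ ψ χ fun _ _ _ h h' => LocallyRefines.trans h h'
  le_antisymm φ ψ := Quotient.inductionOn₂ φ ψ fun _ _ h h' => Quotient.sound ⟨h, h'⟩

/-- A span factors locally through some (equivalently, any) array representing `φ`. -/
def Holds {x y : C} (φ : RelHom τ x y) {a : C} (f : a ⟶ x) (g : a ⟶ y) : Prop :=
  Quotient.lift (s := spanSetoid τ x y) (fun P => τ.Holds P f g) (fun P Q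
      (h : τ.LocallyRefines P Q ∧ τ.LocallyRefines Q P) =>
    propext ⟨fun H => H.trans h.1, fun H => H.trans h.2⟩) φ

theorem holds_mk {x y a : C} {P : SpanArray κ x y} {f : a ⟶ x} {g : a ⟶ y} :
    (mk τ P).Holds f g ↔ τ.Holds P f g := Iff.rfl

theorem mk_le_mk {x y : C} {P Q : SpanArray κ x y} :
    mk τ P ≤ mk τ Q ↔ τ.LocallyRefines P Q := Iff.rfl

theorem le_iff {x y : C} {φ ψ : RelHom τ x y} :
    φ ≤ ψ ↔ ∀ ⦃a : C⦄ (f : a ⟶ x) (g : a ⟶ y), φ.Holds f g → ψ.Holds f g :=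
  Quotient.inductionOn₂ φ ψ fun _ _ => locallyRefines_iff'

theorem mk_le_iff {x y : C} {P : SpanArray κ x y} {ψ : RelHom τ x y} :
    mk τ P ≤ ψ ↔ ∀ i, ψ.Holds (P.l i) (P.r i) :=
  Quotient.inductionOn ψ fun _ => Iff.rfl

theorem ext {x y : C} {φ ψ : RelHom τ x y}
    (h : ∀ ⦃a : C⦄ (f : a ⟶ x) (g : a ⟶ y), φ.Holds f g ↔ ψ.Holds f g) : φ = ψ :=
  le_antisymm (le_iff.2 fun _ f g => (h f g).1) (le_iff.2 fun _ f g => (h f g).2)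

theorem Holds.precomp {x y : C} {φ : RelHom τ x y} {a b : C} {f : a ⟶ x} {g : a ⟶ y} :
    φ.Holds f g → ∀ p : b ⟶ a, φ.Holds (p ≫ f) (p ≫ g) :=
  Quotient.inductionOn φ fun _ h p => WeakTopology.Holds.precomp h p

theorem Holds.glue {x y : C} {φ : RelHom τ x y} {a : C} {f : a ⟶ x} {g : a ⟶ y} :
    (τ.Locally a fun _ p => φ.Holds (p ≫ f) (p ≫ g)) → φ.Holds f g :=
  Quotient.inductionOn φ fun _ h => WeakTopology.Holds.glue h

/-- The class of the array `{1_x, f}`. -/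
def graph (τ : WeakTopology κ C) {x y : C} (f : x ⟶ y) : RelHom τ x y :=
  mk τ (SpanArray.graph κ f)

theorem holds_graph {x y a : C} (f : x ⟶ y) (g : a ⟶ x) (h : a ⟶ y) :
    (graph τ f).Holds g h ↔ τ.Locally a fun _ p => p ≫ g ≫ f = p ≫ h :=
  WeakTopology.holds_graph f g h

/-- The involution. -/
def inv {x y : C} (φ : RelHom τ x y) : RelHom τ y x :=
  Quotient.map (sa := spanSetoid τ x y) (sb := spanSetoid τ y x) SpanArray.inv (fun P Q
      (h : τ.LocallyRefines P Q ∧ τ.LocallyRefines Q P) =>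
    ⟨fun i => (holds_inv Q _ _).2 (h.1 i), fun i => (holds_inv P _ _).2 (h.2 i)⟩) φ

theorem holds_inv {x y a : C} (φ : RelHom τ x y) (f : a ⟶ y) (g : a ⟶ x) :
    φ.inv.Holds f g ↔ φ.Holds g f :=
  Quotient.inductionOn φ fun P => WeakTopology.holds_inv P f g

section Choice

variable (hτ : τ.HasFiniteConnectedLocalPrelimits)

/-- The composite of arrays `P` over `{x, y}` and `Q` over `{y, z}`, by local
`κ`-pre-pullbacks. -/
noncomputable def compArray {x y z : C} (P : SpanArray κ x y) (Q : SpanArray κ y z) :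
    SpanArray κ x z where
  I := Σ (i : P.I) (j : Q.I), (prePullback hτ (P.r i) (Q.l j)).I
  small := κ.small_sigma P.small fun _ => κ.small_sigma Q.small fun _ =>
    (prePullback hτ _ _).small
  src k := (prePullback hτ (P.r k.1) (Q.l k.2.1)).src k.2.2
  l k := (prePullback hτ (P.r k.1) (Q.l k.2.1)).l k.2.2 ≫ P.l k.1
  r k := (prePullback hτ (P.r k.1) (Q.l k.2.1)).r k.2.2 ≫ Q.r k.2.1

theorem holds_compArray {x y z a : C} (P : SpanArray κ x y) (Q : SpanArray κ y z) (f : a ⟶ x)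
    (h : a ⟶ z) : τ.Holds (compArray hτ P Q) f h ↔
      τ.Locally a fun b p => ∃ g : b ⟶ y, τ.Holds P (p ≫ f) g ∧ τ.Holds Q g (p ≫ h) := by
  constructor
  · intro H
    refine Locally.mono H ?_
    rintro b p ⟨⟨i, j, k⟩, m, e, e'⟩
    refine ⟨m ≫ (prePullback hτ (P.r i) (Q.l j)).l k ≫ P.r i, ?_, ?_⟩
    · rw [e]
      exact WeakTopology.Holds.precomp (holds_of_factor P i _) m
    · have e2 := congrArg (m ≫ ·) ((prePullback_spec hτ (P.r i) (Q.l j)).1 k)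
      have := WeakTopology.Holds.precomp
        (holds_of_factor (τ := τ) Q j ((prePullback hτ (P.r i) (Q.l j)).r k)) m
      rw [e']
      exact (congrArg (fun t => τ.Holds Q t _) e2).mpr this
  · intro H
    refine WeakTopology.Holds.glue (H.mono ?_)
    rintro b p ⟨g, h1, h2⟩
    exact holds_of_comp (fun i j => prePullback_spec hτ (P.r i) (Q.l j))
      (fun i j k => holds_self (compArray hτ P Q) ⟨i, j, k⟩) h1 h2

/-- Composition. -/
noncomputable def comp {x y z : C} (φ : RelHom τ x y) (ψ : RelHom τ y z) : RelHom τ x z :=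
  Quotient.map₂ (sa := spanSetoid τ x y) (sb := spanSetoid τ y z) (sc := spanSetoid τ x z)
    (compArray hτ) (fun P P' (h : τ.LocallyRefines P P' ∧ τ.LocallyRefines P' P)
      Q Q' (h' : τ.LocallyRefines Q Q' ∧ τ.LocallyRefines Q' Q) => by
    constructor <;> refine locallyRefines_iff'.2 fun a f g H => ?_ <;>
      refine (holds_compArray hτ _ _ _ _).2 (((holds_compArray hτ _ _ _ _).1 H).mono ?_)
    · exact fun b p ⟨g, h1, h2⟩ => ⟨g, h1.trans h.1, h2.trans h'.1⟩
    · exact fun b p ⟨g, h1, h2⟩ => ⟨g, h1.trans h.2, h2.trans h'.2⟩) φ ψ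

theorem holds_comp {x y z a : C} (φ : RelHom τ x y) (ψ : RelHom τ y z) (f : a ⟶ x)
    (h : a ⟶ z) : (comp hτ φ ψ).Holds f h ↔
      τ.Locally a fun b p => ∃ g : b ⟶ y, φ.Holds (p ≫ f) g ∧ ψ.Holds g (p ≫ h) :=
  Quotient.inductionOn₂ φ ψ fun P Q => holds_compArray hτ P Q f h

theorem holds_comp_of {x y z a : C} {φ : RelHom τ x y} {ψ : RelHom τ y z} {f : a ⟶ x}
    {h : a ⟶ z} (g : a ⟶ y) (h1 : φ.Holds f g) (h2 : ψ.Holds g h) :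
    (comp hτ φ ψ).Holds f h :=
  (holds_comp hτ φ ψ f h).2 (Locally.of ⟨g, by simpa using h1, by simpa using h2⟩)

/-- A chosen local `κ`-pre-equalizer of `f` and `g`. -/
noncomputable def preEqualizer {x y : C} (f g : x ⟶ y) : AryCocone κ x :=
  (exists_preEqualizer hτ f g).choose

/-- The meet of arrays over `{x, y}`: the disjoint union of local `κ`-prelimits of the diagrams
formed by a member of `P` and a member of `Q`. -/
noncomputable def meetArray {x y : C} (P Q : SpanArray κ x y) : SpanArray κ x y where
  I := Σ (i : P.I) (j : Q.I) (k : (prePullback hτ (P.l i) (Q.l j)).I),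
    (preEqualizer hτ ((prePullback hτ (P.l i) (Q.l j)).l k ≫ P.r i)
      ((prePullback hτ (P.l i) (Q.l j)).r k ≫ Q.r j)).I
  small := κ.small_sigma P.small fun _ => κ.small_sigma Q.small fun _ =>
    κ.small_sigma (prePullback hτ _ _).small fun _ => (preEqualizer hτ _ _).small
  src t := (preEqualizer hτ ((prePullback hτ (P.l t.1) (Q.l t.2.1)).l t.2.2.1 ≫ P.r t.1)
    ((prePullback hτ (P.l t.1) (Q.l t.2.1)).r t.2.2.1 ≫ Q.r t.2.1)).dom t.2.2.2
  l t := (preEqualizer hτ _ _).hom t.2.2.2 ≫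
    (prePullback hτ (P.l t.1) (Q.l t.2.1)).l t.2.2.1 ≫ P.l t.1
  r t := (preEqualizer hτ _ _).hom t.2.2.2 ≫
    (prePullback hτ (P.l t.1) (Q.l t.2.1)).l t.2.2.1 ≫ P.r t.1

theorem holds_meetArray {x y a : C} (P Q : SpanArray κ x y) (f : a ⟶ x) (g : a ⟶ y) :
    τ.Holds (meetArray hτ P Q) f g ↔ τ.Holds P f g ∧ τ.Holds Q f g := by
  constructor
  · intro H
    refine ⟨H.trans ?_, H.trans ?_⟩ <;> rintro ⟨i, j, k, t⟩
    · exact WeakTopology.Holds.precomp (holds_of_factor P i _) _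
    · change τ.Holds Q ((preEqualizer hτ _ _).hom t ≫ (prePullback hτ (P.l i) (Q.l j)).l k ≫ P.l i)
        ((preEqualizer hτ _ _).hom t ≫ (prePullback hτ (P.l i) (Q.l j)).l k ≫ P.r i)
      rw [(prePullback_spec hτ (P.l i) (Q.l j)).1 k]
      refine (congrArg (fun t => τ.Holds Q _ t) ((exists_preEqualizer hτ ((prePullback hτ (P.l i) (Q.l j)).l k ≫ P.r i)
      ((prePullback hτ (P.l i) (Q.l j)).r k ≫ Q.r j)).choose_spec.1 t)).mpr ?_
      exact WeakTopology.Holds.precomp (holds_of_factor Q j _) _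
  · rintro ⟨h1, h2⟩
    exact holds_of_meet (fun i j => prePullback_spec hτ (P.l i) (Q.l j))
      (fun i j k => (exists_preEqualizer hτ _ _).choose_spec)
      (fun i j k t => holds_self (meetArray hτ P Q) ⟨i, j, k, t⟩) h1 h2

/-- Binary meets. -/
noncomputable def inf {x y : C} (φ ψ : RelHom τ x y) : RelHom τ x y :=
  Quotient.map₂ (sa := spanSetoid τ x y) (sb := spanSetoid τ x y) (sc := spanSetoid τ x y)
    (meetArray hτ) (fun P P' (h : τ.LocallyRefines P P' ∧ τ.LocallyRefines P' P)
      Q Q' (h' : τ.LocallyRefines Q Q' ∧ τ.LocallyRefines Q' Q) => by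
    constructor <;> refine locallyRefines_iff'.2 fun a f g H => ?_ <;>
      refine (holds_meetArray hτ _ _ _ _).2 ?_ <;>
      have H := (holds_meetArray hτ _ _ _ _).1 H
    · exact ⟨H.1.trans h.1, H.2.trans h'.1⟩
    · exact ⟨H.1.trans h.2, H.2.trans h'.2⟩) φ ψ

theorem holds_inf {x y a : C} (φ ψ : RelHom τ x y) (f : a ⟶ x) (g : a ⟶ y) :
    (inf hτ φ ψ).Holds f g ↔ φ.Holds f g ∧ ψ.Holds f g :=
  Quotient.inductionOn₂ φ ψ fun P Q => holds_meetArray hτ P Q f g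

end Choice

/-- `κ`-ary joins, by disjoint union of arrays. -/
noncomputable def join {x y : C} {I : Type w} (hI : κ.Small I) (φ : I → RelHom τ x y) :
    RelHom τ x y :=
  mk τ (SpanArray.union hI fun i => (φ i).out)

theorem holds_join {x y a : C} {I : Type w} (hI : κ.Small I) (φ : I → RelHom τ x y)
    (f : a ⟶ x) (g : a ⟶ y) : (join hI φ).Holds f g ↔
      τ.Locally a fun _ p => ∃ i, (φ i).Holds (p ≫ f) (p ≫ g) := by
  refine (holds_union hI _ f g).trans ?_
  have : ∀ i {b : C} (f : b ⟶ x) (g : b ⟶ y),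
      τ.Holds (φ i).out f g ↔ (φ i).Holds f g := by
    intro i b f g
    conv_rhs => rw [← Quotient.out_eq (φ i)]
    exact Iff.rfl
  simp only [this]

theorem isLUB_join {x y : C} {I : Type w} (hI : κ.Small I) (φ : I → RelHom τ x y) :
    IsLUB (Set.range φ) (join hI φ) := by
  constructor
  · rintro _ ⟨i, rfl⟩
    refine le_iff.2 fun a f g h => (holds_join hI φ f g).2 (Locally.of ⟨i, ?_⟩)
    simpa using h
  · intro ψ hψ
    refine le_iff.2 fun a f g h => Holds.glue (((holds_join hI φ f g).1 h).mono ?_)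
    rintro b p ⟨i, hi⟩
    exact le_iff.1 (hψ ⟨i, rfl⟩) _ _ hi

theorem isLUB_iff {x y : C} {I : Type w} (hI : κ.Small I) (φ : I → RelHom τ x y)
    (s : RelHom τ x y) : IsLUB (Set.range φ) s ↔ ∀ ⦃a : C⦄ (f : a ⟶ x) (g : a ⟶ y),
      s.Holds f g ↔ τ.Locally a fun _ p => ∃ i, (φ i).Holds (p ≫ f) (p ≫ g) := by
  constructor
  · intro h a f g
    rw [h.unique (isLUB_join hI φ), holds_join]
  · intro h
    have : s = join hI φ := ext fun a f g => by rw [h, holds_join]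
    rw [this]
    exact isLUB_join hI φ

end RelHom

namespace RelHom

section Laws

variable {τ : WeakTopology κ C} (hτ : τ.HasFiniteConnectedLocalPrelimits)

theorem graph_id_comp {x y : C} (φ : RelHom τ x y) : comp hτ (graph τ (𝟙 x)) φ = φ :=
  ext fun a f h => by
    refine (holds_comp hτ _ _ f h).trans ⟨fun H => ?_, fun H => ?_⟩
    · refine Holds.glue (H.bind ?_)
      rintro b p ⟨g, h1, h2⟩
      refine ((holds_graph _ _ _).1 h1).mono ?_
      intro c q e
      rw [Category.comp_id] at e
      rw [Category.assoc, Category.assoc, e]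
      exact h2.precomp q
    · refine Locally.of ⟨f, (holds_graph _ _ _).2 (Locally.of ?_), by simpa using H⟩
      simp

theorem comp_graph_id {x y : C} (φ : RelHom τ x y) : comp hτ φ (graph τ (𝟙 y)) = φ :=
  ext fun a f h => by
    refine (holds_comp hτ _ _ f h).trans ⟨fun H => ?_, fun H => ?_⟩
    · refine Holds.glue (H.bind ?_)
      rintro b p ⟨g, h1, h2⟩
      refine ((holds_graph _ _ _).1 h2).mono ?_
      intro c q e
      rw [Category.comp_id] at e
      rw [Category.assoc, Category.assoc, ← e]
      exact h1.precomp q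
    · refine Locally.of ⟨h, by simpa using H, (holds_graph _ _ _).2 (Locally.of ?_)⟩
      simp

theorem comp_assoc {x y z t : C} (φ : RelHom τ x y) (ψ : RelHom τ y z) (χ : RelHom τ z t) :
    comp hτ (comp hτ φ ψ) χ = comp hτ φ (comp hτ ψ χ) := ext fun a f h => by
  refine (holds_comp hτ _ _ f h).trans (Iff.trans ?_ (holds_comp hτ _ _ f h).symm)
  constructor
  · intro H
    refine H.bind ?_
    rintro b p ⟨g, h1, h2⟩
    refine ((holds_comp hτ _ _ _ _).1 h1).mono ?_
    rintro c q ⟨k, h3, h4⟩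
    refine ⟨k, by simpa using h3, holds_comp_of hτ _ h4 ?_⟩
    simpa using h2.precomp q
  · intro H
    refine H.bind ?_
    rintro b p ⟨g, h1, h2⟩
    refine ((holds_comp hτ _ _ _ _).1 h2).mono ?_
    rintro c q ⟨k, h3, h4⟩
    refine ⟨k, holds_comp_of hτ _ ?_ h3, by simpa using h4⟩
    simpa using h1.precomp q

theorem comp_le_comp {x y z : C} {φ φ' : RelHom τ x y} {ψ ψ' : RelHom τ y z} (h : φ ≤ φ')
    (h' : ψ ≤ ψ') : comp hτ φ ψ ≤ comp hτ φ' ψ' :=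
  le_iff.2 fun _ f g H => (holds_comp hτ φ' ψ' f g).2
    (((holds_comp hτ φ ψ f g).1 H).mono fun _ _ ⟨k, h1, h2⟩ =>
      ⟨k, le_iff.1 h _ _ h1, le_iff.1 h' _ _ h2⟩)

theorem inf_le_left {x y : C} (φ ψ : RelHom τ x y) : inf hτ φ ψ ≤ φ :=
  le_iff.2 fun _ f g h => ((holds_inf hτ φ ψ f g).1 h).1

theorem inf_le_right {x y : C} (φ ψ : RelHom τ x y) : inf hτ φ ψ ≤ ψ :=
  le_iff.2 fun _ f g h => ((holds_inf hτ φ ψ f g).1 h).2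

theorem le_inf {x y : C} {φ ψ χ : RelHom τ x y} (h : φ ≤ ψ) (h' : φ ≤ χ) : φ ≤ inf hτ ψ χ :=
  le_iff.2 fun _ f g H => (holds_inf hτ ψ χ f g).2 ⟨le_iff.1 h f g H, le_iff.1 h' f g H⟩

theorem join_comp {x y z : C} {I : Type w} (hI : κ.Small I) {φ : I → RelHom τ x y}
    {s : RelHom τ x y} (ψ : RelHom τ y z) (h : IsLUB (Set.range φ) s) :
    IsLUB (Set.range fun i => comp hτ (φ i) ψ) (comp hτ s ψ) :=
  (isLUB_iff hI _ _).2 fun a f g => by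
    have h := (isLUB_iff hI _ _).1 h
    refine (holds_comp hτ s ψ f g).trans ⟨fun H => H.bind ?_, fun H => H.bind ?_⟩
    · rintro b p ⟨k, h1, h2⟩
      refine ((h _ _).1 h1).mono ?_
      rintro c q ⟨i, h3⟩
      exact ⟨i, holds_comp_of hτ (q ≫ k) (by simpa using h3) (by simpa using h2.precomp q)⟩
    · rintro b p ⟨i, h1⟩
      refine ((holds_comp hτ _ _ _ _).1 h1).mono ?_
      rintro c q ⟨k, h2, h3⟩
      refine ⟨k, (h _ _).2 (Locally.of ⟨i, ?_⟩), by simpa using h3⟩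
      simpa using h2

theorem comp_join {x y z : C} {I : Type w} (hI : κ.Small I) {φ : I → RelHom τ y z}
    {s : RelHom τ y z} (ψ : RelHom τ x y) (h : IsLUB (Set.range φ) s) :
    IsLUB (Set.range fun i => comp hτ ψ (φ i)) (comp hτ ψ s) :=
  (isLUB_iff hI _ _).2 fun a f g => by
    have h := (isLUB_iff hI _ _).1 h
    refine (holds_comp hτ ψ s f g).trans ⟨fun H => H.bind ?_, fun H => H.bind ?_⟩
    · rintro b p ⟨k, h1, h2⟩
      refine ((h _ _).1 h2).mono ?_
      rintro c q ⟨i, h3⟩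
      exact ⟨i, holds_comp_of hτ (q ≫ k) (by simpa using h1.precomp q) (by simpa using h3)⟩
    · rintro b p ⟨i, h1⟩
      refine ((holds_comp hτ _ _ _ _).1 h1).mono ?_
      rintro c q ⟨k, h2, h3⟩
      refine ⟨k, by simpa using h2, (h _ _).2 (Locally.of ⟨i, ?_⟩)⟩
      simpa using h3

theorem join_inf {x y : C} {I : Type w} (hI : κ.Small I) {φ : I → RelHom τ x y}
    {s : RelHom τ x y} (ψ : RelHom τ x y) (h : IsLUB (Set.range φ) s) :
    IsLUB (Set.range fun i => inf hτ (φ i) ψ) (inf hτ s ψ) :=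
  (isLUB_iff hI _ _).2 fun a f g => by
    have h := (isLUB_iff hI _ _).1 h
    refine (holds_inf hτ s ψ f g).trans ⟨fun H => ?_, fun H => ?_⟩
    · refine ((h _ _).1 H.1).mono ?_
      rintro b p ⟨i, h1⟩
      exact ⟨i, (holds_inf hτ _ _ _ _).2 ⟨h1, H.2.precomp p⟩⟩
    · constructor
      · refine (h _ _).2 (H.mono ?_)
        rintro b p ⟨i, h1⟩
        exact ⟨i, ((holds_inf hτ _ _ _ _).1 h1).1⟩
      · refine Holds.glue (H.mono ?_)
        rintro b p ⟨i, h1⟩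
        exact ((holds_inf hτ _ _ _ _).1 h1).2

theorem inv_le_inv {x y : C} {φ ψ : RelHom τ x y} (h : φ ≤ ψ) : inv φ ≤ inv ψ :=
  le_iff.2 fun _ f g H => (holds_inv ψ f g).2 (le_iff.1 h _ _ ((holds_inv φ f g).1 H))

theorem inv_graph_id (x : C) : inv (graph τ (𝟙 x)) = graph τ (𝟙 x) := ext fun a f g => by
  refine (holds_inv _ f g).trans ?_
  refine (holds_graph _ _ _).trans (Iff.trans ?_ (holds_graph _ _ _).symm)
  constructor <;> refine fun H => H.mono fun b p e => ?_ <;>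
    rw [Category.comp_id] at e ⊢ <;> exact e.symm

theorem inv_comp {x y z : C} (φ : RelHom τ x y) (ψ : RelHom τ y z) :
    inv (comp hτ φ ψ) = comp hτ (inv ψ) (inv φ) := ext fun a f g => by
  refine (holds_inv _ f g).trans ?_
  refine (holds_comp hτ φ ψ _ _).trans (Iff.trans ?_ (holds_comp hτ _ _ _ _).symm)
  constructor <;> refine fun H => H.mono ?_
  · rintro b p ⟨k, h1, h2⟩
    exact ⟨k, (holds_inv _ _ _).2 h2, (holds_inv _ _ _).2 h1⟩
  · rintro b p ⟨k, h1, h2⟩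
    exact ⟨k, (holds_inv _ _ _).1 h2, (holds_inv _ _ _).1 h1⟩

theorem inv_inv {x y : C} (φ : RelHom τ x y) : inv (inv φ) = φ :=
  ext fun _ f g => (holds_inv _ f g).trans (holds_inv _ g f)

theorem modular {x y z : C} (φ : RelHom τ x y) (ψ : RelHom τ y z) (χ : RelHom τ x z) :
    inf hτ (comp hτ φ ψ) χ ≤ comp hτ φ (inf hτ ψ (comp hτ (inv φ) χ)) := le_iff.2 fun a f g H => by
  obtain ⟨h1, h2⟩ := (holds_inf hτ _ _ f g).1 H
  refine (holds_comp hτ _ _ f g).2 (((holds_comp hτ φ ψ f g).1 h1).mono ?_)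
  rintro b p ⟨k, h3, h4⟩
  refine ⟨k, h3, (holds_inf hτ _ _ _ _).2 ⟨h4, ?_⟩⟩
  exact holds_comp_of hτ (p ≫ f) ((holds_inv _ _ _).2 h3) (h2.precomp p)

theorem holds_comp_graph {x y z a : C} (φ : RelHom τ x y) (k : y ⟶ z) (f : a ⟶ x)
    (g : a ⟶ z) : (comp hτ φ (graph τ k)).Holds f g ↔
      τ.Locally a fun b p => ∃ h : b ⟶ y, φ.Holds (p ≫ f) h ∧ h ≫ k = p ≫ g := by
  refine (holds_comp hτ _ _ f g).trans ⟨fun H => H.bind ?_, fun H => H.mono ?_⟩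
  · rintro b p ⟨h, h1, h2⟩
    refine ((holds_graph _ _ _).1 h2).mono ?_
    intro c q e
    exact ⟨q ≫ h, by simpa using h1.precomp q, by simpa using e⟩
  · rintro b p ⟨h, h1, h2⟩
    exact ⟨h, h1, (holds_graph _ _ _).2 (Locally.of (by simpa using h2))⟩

theorem holds_graph_comp {x y z a : C} (k : x ⟶ y) (φ : RelHom τ y z) (f : a ⟶ x)
    (g : a ⟶ z) : (comp hτ (graph τ k) φ).Holds f g ↔ φ.Holds (f ≫ k) g := by
  refine (holds_comp hτ _ _ f g).trans ⟨fun H => Holds.glue (H.bind ?_), fun H => ?_⟩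
  · rintro b p ⟨h, h1, h2⟩
    refine ((holds_graph _ _ _).1 h1).mono ?_
    intro c q e
    have := h2.precomp q
    rw [← e] at this
    simpa using this
  · refine Locally.of ⟨f ≫ k, (holds_graph _ _ _).2 (Locally.of (by simp)), ?_⟩
    simpa using H

theorem graph_comp {x y z : C} (f : x ⟶ y) (g : y ⟶ z) :
    graph τ (f ≫ g) = comp hτ (graph τ f) (graph τ g) := ext fun a h k => by
  refine Iff.trans ?_ (holds_graph_comp hτ f (graph τ g) h k).symm
  refine (holds_graph _ _ _).trans (Iff.trans ?_ (holds_graph _ _ _).symm)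
  constructor <;> exact fun H => H.mono fun b p e => by simpa using e

theorem graph_unit {x y : C} (f : x ⟶ y) :
    graph τ (𝟙 x) ≤ comp hτ (graph τ f) (inv (graph τ f)) := le_iff.2 fun a h k H => by
  refine (holds_graph_comp hτ f _ h k).2 ((holds_inv _ _ _).2 ?_)
  refine (holds_graph _ _ _).2 (((holds_graph _ _ _).1 H).mono ?_)
  intro b p e
  rw [Category.comp_id] at e
  rw [← Category.assoc, ← e, Category.assoc]

theorem graph_counit {x y : C} (f : x ⟶ y) :
    comp hτ (inv (graph τ f)) (graph τ f) ≤ graph τ (𝟙 y) := le_iff.2 fun a h k H => by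
  refine (holds_graph _ _ _).2 (((holds_comp_graph hτ _ f h k).1 H).bind ?_)
  rintro b p ⟨l, h1, h2⟩
  refine ((holds_graph _ _ _).1 ((holds_inv _ _ _).1 h1)).mono ?_
  intro c q e
  rw [Category.assoc, Category.assoc, ← h2, e]
  simp

/-- The class `[P]` is the join of the composites of the members of `P`. -/
theorem isLUB_tabulation {x y : C} (P : SpanArray κ x y) :
    IsLUB (Set.range fun i => comp hτ (inv (graph τ (P.l i))) (graph τ (P.r i))) (mk τ P) := by
  refine (isLUB_iff P.small _ _).2 fun a f g => ⟨fun H => ?_, fun H => ?_⟩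
  · refine Locally.mono (show τ.Holds P f g from H) ?_
    rintro b p ⟨i, m, e, e'⟩
    refine ⟨i, holds_comp_of hτ m ((holds_inv _ _ _).2 ?_) ?_⟩
    · exact (holds_graph _ _ _).2 (Locally.of (by rw [e]))
    · exact (holds_graph _ _ _).2 (Locally.of (by rw [e']))
  · refine WeakTopology.Holds.glue (H.bind ?_)
    rintro b p ⟨i, h⟩
    refine ((holds_comp hτ _ _ _ _).1 h).bind ?_
    rintro c q ⟨m, h1, h2⟩
    refine (((holds_graph _ _ _).1 ((holds_inv _ _ _).1 h1)).and ((holds_graph _ _ _).1 h2)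
      ?_ ?_).mono ?_
    · intro d t r s e
      rw [Category.assoc, e, Category.assoc]
    · intro d t r s e
      rw [Category.assoc, e, Category.assoc]
    · rintro d r ⟨e, e'⟩
      have := holds_of_factor (τ := τ) P i (r ≫ m)
      simp only [Category.assoc] at this e e' ⊢
      rwa [e, e'] at this

end Laws

section Functoriality

variable {D : Type u₁} [Category.{v₁} D] {τ : WeakTopology κ C} {σ : WeakTopology κ D} {F : C ⥤ D}

/-- The action of a cover-preserving functor on classes of arrays. -/
def map (hF : PreservesCovers τ σ F) {x y : C} (φ : RelHom τ x y) :
    RelHom σ (F.obj x) (F.obj y) :=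
  Quotient.map (sa := spanSetoid τ x y) (sb := spanSetoid σ (F.obj x) (F.obj y))
    (SpanArray.map F) (fun P Q (h : τ.LocallyRefines P Q ∧ τ.LocallyRefines Q P) =>
      ⟨fun i => hF.holds (h.1 i), fun i => hF.holds (h.2 i)⟩) φ

variable (hF : PreservesCovers τ σ F)

theorem holds_map {x y a : C} {φ : RelHom τ x y} {f : a ⟶ x} {g : a ⟶ y} :
    φ.Holds f g → (map hF φ).Holds (F.map f) (F.map g) :=
  Quotient.inductionOn φ fun _ h => hF.holds h

theorem map_le_iff {x y : C} {φ : RelHom τ x y} {ψ : RelHom σ (F.obj x) (F.obj y)} :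
    map hF φ ≤ ψ ↔
      ∀ ⦃a : C⦄ (f : a ⟶ x) (g : a ⟶ y), φ.Holds f g → ψ.Holds (F.map f) (F.map g) := by
  refine ⟨fun h a f g H => le_iff.1 h _ _ (holds_map hF H), ?_⟩
  refine Quotient.inductionOn φ fun P H => ?_
  exact mk_le_iff.2 fun i => H _ _ (holds_self P i)

theorem map_le_map {x y : C} {φ ψ : RelHom τ x y} (h : φ ≤ ψ) : map hF φ ≤ map hF ψ :=
  (map_le_iff hF).2 fun _ f g H => holds_map hF (le_iff.1 h f g H)

theorem map_inv {x y : C} (φ : RelHom τ x y) : map hF (inv φ) = inv (map hF φ) :=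
  Quotient.inductionOn φ fun _ => rfl

theorem map_graph {x y : C} (f : x ⟶ y) : map hF (graph τ f) = graph σ (F.map f) :=
  ext fun a h k => by
    have e : F.map (𝟙 x) = 𝟙 (F.obj x) := F.map_id x
    refine Iff.trans (b := σ.Locally a fun b p => ∃ (_ : PUnit.{w + 1}) (m : b ⟶ F.obj x),
      p ≫ h = m ≫ F.map (𝟙 x) ∧ p ≫ k = m ≫ F.map f) Iff.rfl ?_
    rw [e]
    exact Iff.rfl

theorem map_join {x y : C} {I : Type w} (hI : κ.Small I) {φ : I → RelHom τ x y}
    {s : RelHom τ x y} (h : IsLUB (Set.range φ) s) :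
    IsLUB (Set.range fun i => map hF (φ i)) (map hF s) := by
  constructor
  · rintro _ ⟨i, rfl⟩
    exact map_le_map hF (h.1 ⟨i, rfl⟩)
  · intro ψ hψ
    refine (map_le_iff hF).2 fun a f g H => Holds.glue ?_
    refine hF.locally (((isLUB_iff hI _ _).1 h f g).1 H) ?_
    rintro b p ⟨i, hi⟩
    rw [← F.map_comp, ← F.map_comp]
    exact le_iff.1 (hψ ⟨i, rfl⟩) _ _ (holds_map hF hi)

theorem map_comp (hF' : IsPreMorphismOfSites τ σ F) (hτ : τ.HasFiniteConnectedLocalPrelimits)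
    (hσ : σ.HasFiniteConnectedLocalPrelimits) {x y z : C} (φ : RelHom τ x y)
    (ψ : RelHom τ y z) : map hF (comp hτ φ ψ) = comp hσ (map hF φ) (map hF ψ) := by
  apply le_antisymm
  · refine (map_le_iff hF).2 fun a f g H => (holds_comp hσ _ _ _ _).2 ?_
    refine hF.locally ((holds_comp hτ _ _ _ _).1 H) ?_
    rintro b p ⟨k, h1, h2⟩
    refine ⟨F.map k, ?_, ?_⟩ <;> rw [← F.map_comp]
    · exact holds_map hF h1
    · exact holds_map hF h2
  · refine le_iff.2 fun a f g H => Holds.glue (((holds_comp hσ _ _ _ _).1 H).mono ?_)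
    clear H
    induction φ using Quotient.inductionOn with | _ P
    induction ψ using Quotient.inductionOn with | _ Q
    rintro b p ⟨k, h1, h2⟩
    refine holds_of_comp (R := (compArray hτ P Q).map F)
      (fun i j => hF'.map_prePullback (prePullback_spec hτ (P.r i) (Q.l j))) ?_ h1 h2
    intro i j k
    have := holds_self (τ := σ) ((compArray hτ P Q).map F) ⟨i, j, k⟩
    exact (congrArg₂ (fun s t => σ.Holds _ s t) (F.map_comp _ _) (F.map_comp _ _)).mp this

theorem map_inf (hF' : IsPreMorphismOfSites τ σ F) (hτ : τ.HasFiniteConnectedLocalPrelimits)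
    (hσ : σ.HasFiniteConnectedLocalPrelimits) {x y : C} (φ ψ : RelHom τ x y) :
    map hF (inf hτ φ ψ) = inf hσ (map hF φ) (map hF ψ) := by
  apply le_antisymm
  · exact le_inf hσ (map_le_map hF (inf_le_left hτ φ ψ)) (map_le_map hF (inf_le_right hτ φ ψ))
  · refine le_iff.2 fun a f g H => ?_
    obtain ⟨h1, h2⟩ := (holds_inf hσ _ _ _ _).1 H
    clear H
    induction φ using Quotient.inductionOn with | _ P
    induction ψ using Quotient.inductionOn with | _ Q
    refine holds_of_meet (R := (meetArray hτ P Q).map F)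
      (fun i j => hF'.map_prePullback (prePullback_spec hτ (P.l i) (Q.l j)))
      (E := fun i j k => (preEqualizer hτ ((prePullback hτ (P.l i) (Q.l j)).l k ≫ P.r i)
        ((prePullback hτ (P.l i) (Q.l j)).r k ≫ Q.r j)).map F) ?_ ?_ h1 h2
    · intro i j k
      have := hF'.map_preEqualizer (exists_preEqualizer hτ
        ((prePullback hτ (P.l i) (Q.l j)).l k ≫ P.r i)
        ((prePullback hτ (P.l i) (Q.l j)).r k ≫ Q.r j)).choose_spec
      rw [F.map_comp, F.map_comp] at this
      exact this
    · intro i j k t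
      have := holds_self (τ := σ) ((meetArray hτ P Q).map F) ⟨i, j, k, t⟩
      refine (congrArg₂ (fun s t => σ.Holds _ s t) ?_ ?_).mp this
      · exact (F.map_comp _ _).trans (congrArg _ (F.map_comp _ _))
      · exact (F.map_comp _ _).trans (congrArg _ (F.map_comp _ _))

theorem map_natural (hτ : τ.HasFiniteConnectedLocalPrelimits)
    (hσ : σ.HasFiniteConnectedLocalPrelimits) {G : C ⥤ D} (hG : PreservesCovers τ σ G)
    (α : F ⟶ G) {x y : C} (φ : RelHom τ x y) :
    comp hσ (map hF φ) (graph σ (α.app y)) ≤ comp hσ (graph σ (α.app x)) (map hG φ) := by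
  induction φ using Quotient.inductionOn with | _ P
  refine le_iff.2 fun a f g H => ?_
  refine (holds_graph_comp hσ _ _ _ _).2 (Holds.glue ?_)
  refine ((holds_comp_graph hσ _ _ _ _).1 H).bind ?_
  rintro b p ⟨k, h1, h2⟩
  refine Locally.mono (show σ.Holds (P.map F) (p ≫ f) k from h1) ?_
  rintro c q ⟨(i : P.I), (m : c ⟶ F.obj (P.src i)), (e : _ = m ≫ F.map (P.l i)),
    (e' : _ = m ≫ F.map (P.r i))⟩
  have := holds_of_factor (τ := σ) (P.map G) i (m ≫ α.app _)
  refine (congrArg₂ (fun s t => σ.Holds (P.map G) s t) ?_ ?_).mp this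
  · change (m ≫ α.app _) ≫ G.map (P.l i) = _
    rw [Category.assoc, ← α.naturality, ← Category.assoc, ← e]
    simp
  · change (m ≫ α.app _) ≫ G.map (P.r i) = _
    rw [Category.assoc, ← α.naturality, ← Category.assoc, ← e', Category.assoc, h2]
    simp

end Functoriality

end RelHom

end RelHom

section Rel

open WeakTopology

variable {κ : ArityClass.{w}}

/-- The objects of the allegory of relations of a locally `κ`-ary site: those of the site. -/
def RelObj (C : WeakSite κ) (_ : C.top.HasFiniteConnectedLocalPrelimits) : Type (w + 1) := C.Obj

/-- The underlying object of the site. -/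
def RelObj.un {C : WeakSite κ} {hC : C.top.HasFiniteConnectedLocalPrelimits} (x : RelObj C hC) :
    C.Obj := x

section Objects

variable (C : WeakSite κ) (hC : C.top.HasFiniteConnectedLocalPrelimits)

noncomputable instance relCategory : Category.{w + 1} (RelObj C hC) where
  Hom x y := RelHom C.top x.un y.un
  id x := RelHom.graph C.top (𝟙 x.un)
  comp φ ψ := RelHom.comp hC φ ψ
  id_comp φ := RelHom.graph_id_comp hC φ
  comp_id φ := RelHom.comp_graph_id hC φ
  assoc φ ψ χ := RelHom.comp_assoc hC φ ψ χ

noncomputable instance relOrder (x y : RelObj C hC) : SemilatticeInf (x ⟶ y) where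
  __ := (inferInstance : PartialOrder (RelHom C.top x.un y.un))
  inf φ ψ := RelHom.inf hC φ ψ
  inf_le_left φ ψ := RelHom.inf_le_left hC φ ψ
  inf_le_right φ ψ := RelHom.inf_le_right hC φ ψ
  le_inf _ _ _ h h' := RelHom.le_inf hC h h'

/-- The allegory underlying the framed allegory of a locally `κ`-ary site. -/
noncomputable def relAllegory : Allegory κ where
  Obj := RelObj C hC
  comp_le_comp h h' := RelHom.comp_le_comp hC h h'
  exists_join hI φ := ⟨_, RelHom.isLUB_join hI φ⟩
  join_comp ψ hI h := RelHom.join_comp hC hI ψ h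
  comp_join ψ hI h := RelHom.comp_join hC hI ψ h
  join_inf ψ hI h := RelHom.join_inf hC hI ψ h
  inv φ := RelHom.inv φ
  inv_le_inv h := RelHom.inv_le_inv h
  inv_id x := RelHom.inv_graph_id x.un
  inv_comp φ ψ := RelHom.inv_comp hC φ ψ
  inv_inv φ := RelHom.inv_inv φ
  modular φ ψ χ := RelHom.modular hC φ ψ χ

/-- The framed allegory `Rel_κ(C)` of a locally `κ`-ary site: its tight maps are the morphisms of
`C`, with `f_•` the class of `{1_x, f}`. -/
noncomputable def relFramed : FramedAllegory κ where
  __ := relAllegory C hC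
  Tight x y := RelObj.un x ⟶ RelObj.un y
  tid x := 𝟙 (RelObj.un x)
  tcomp f g := f ≫ g
  tid_tcomp f := Category.id_comp f
  tcomp_tid f := Category.comp_id f
  tassoc f g h := Category.assoc f g h
  J f := RelHom.graph C.top f
  J_tid _ := rfl
  J_tcomp f g := RelHom.graph_comp hC f g
  isMap_J f := ⟨RelHom.inv (RelHom.graph C.top f), RelHom.graph_unit hC f,
    RelHom.graph_counit hC f⟩

theorem isCovering_relFramed {u : C.Obj} (P : AryCocone κ u) (hP : C.top.Covers P) :
    IsLUB (Set.range fun i => RelHom.comp hC (RelHom.inv (RelHom.graph C.top (P.hom i)))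
      (RelHom.graph C.top (P.hom i))) (RelHom.graph C.top (𝟙 u)) := by
  have h := RelHom.isLUB_tabulation hC (⟨P.I, P.small, P.dom, P.hom, P.hom⟩ : SpanArray κ u u)
  convert h using 1
  refine le_antisymm (RelHom.mk_le_iff.2 fun _ => ?_) (RelHom.mk_le_iff.2 fun i => ?_)
  · exact ⟨P, hP, fun i => ⟨i, 𝟙 _, by simp [SpanArray.graph], by simp [SpanArray.graph]⟩⟩
  · exact (RelHom.holds_graph _ _ _).2 (Locally.of (by simp))

theorem exists_cover_of_graph_eq {x y : C.Obj} (f g : x ⟶ y)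
    (e : RelHom.graph C.top f = RelHom.graph C.top g) :
    ∃ P : AryCocone κ x, C.top.Covers P ∧ ∀ i, P.hom i ≫ f = P.hom i ≫ g := by
  have h : (RelHom.graph C.top f).Holds (𝟙 _) f :=
    (RelHom.holds_graph _ _ _).2 (Locally.of (by simp))
  rw [e, RelHom.holds_graph] at h
  obtain ⟨P, hP, h⟩ := h
  exact ⟨P, hP, fun i => by simpa using (h i).symm⟩

theorem isWeaklyTabular_relFramed : (relFramed C hC).IsWeaklyTabular where
  exists_tabulation {x y} φ := by
    induction φ using Quotient.inductionOn with | _ P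
    exact ⟨⟨P.I, P.small, P.src, P.l, P.r⟩, RelHom.isLUB_tabulation hC P⟩
  exists_covering f g e := by
    obtain ⟨P, hP, h⟩ := exists_cover_of_graph_eq C _ _ e
    exact ⟨⟨P.I, P.small, P.dom, P.hom⟩, isCovering_relFramed C hC P hP, h⟩

end Objects

section OneCells

variable {C D : WeakSite κ} (hC : C.top.HasFiniteConnectedLocalPrelimits)
  (hD : D.top.HasFiniteConnectedLocalPrelimits)

/-- The framed allegory functor induced by a pre-morphism of sites. -/
def relMap (F : C.Obj ⥤ D.Obj) (hF : IsPreMorphismOfSites C.top D.top F) :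
    FramedAllegory.Functor (relFramed C hC) (relFramed D hD) where
  obj x := F.obj x
  map φ := RelHom.map hF.preservesCovers φ
  map_id x := (RelHom.map_graph hF.preservesCovers _).trans
    (congrArg (RelHom.graph D.top) (F.map_id _))
  map_comp φ ψ := RelHom.map_comp hF.preservesCovers hF hC hD φ ψ
  map_le_map h := RelHom.map_le_map hF.preservesCovers h
  map_inv φ := RelHom.map_inv hF.preservesCovers φ
  map_inf φ ψ := RelHom.map_inf hF.preservesCovers hF hC hD φ ψ
  map_join hI h := RelHom.map_join hF.preservesCovers hI h
  tmap f := F.map f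
  tmap_tid x := F.map_id _
  tmap_tcomp f g := F.map_comp _ _
  J_tmap f := (RelHom.map_graph hF.preservesCovers f).symm

/-- The framed allegory transformation induced by a natural transformation. -/
def relMap₂ {F G : C.Obj ⥤ D.Obj} (hF : IsPreMorphismOfSites C.top D.top F)
    (hG : IsPreMorphismOfSites C.top D.top G) (α : F ⟶ G) :
    FramedAllegory.Transformation (relMap hC hD F hF) (relMap hC hD G hG) where
  app x := RelHom.graph D.top (α.app x)
  isMap_app x := (relFramed D hD).isMap_J (α.app x)
  oplax {x y} φ := RelHom.map_natural hF.preservesCovers hC hD hG.preservesCovers α φ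
  tapp x := α.app x
  tnaturality f := α.naturality f
  J_tapp _ := rfl

end OneCells

end Rel

section Units

open WeakTopology

variable {κ : ArityClass.{w}}

theorem ArityClass.small_fiber (κ : ArityClass.{w}) {I V : Type w} (hI : κ.Small I)
    (hV : κ.Small V) (i : V → I) (j : I) : κ.Small {v // i v = j} := by
  refine κ.mem_of_sum_mem (fun j => Cardinal.mk {v // i v = j}) hI ?_ j
  rw [← Cardinal.mk_sigma, Cardinal.mk_congr (Equiv.sigmaFiberEquiv i)]
  exact hV

theorem WeakTopology.HasFiniteLocalPrelimits.connected {C : Type u} [Category.{v} C]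
    {τ : WeakTopology κ C} (h : τ.HasFiniteLocalPrelimits) : τ.HasFiniteConnectedLocalPrelimits :=
  fun J _ _ _ g => h J g

variable (C : WeakSite κ) (hC : C.top.HasFiniteLocalPrelimits)

theorem RelHom.exists_isTop (hC : C.top.HasFiniteLocalPrelimits) (x y : C.Obj) : ∃ t : RelHom C.top x y, IsTop t := by
  obtain ⟨T, hT⟩ := hC _ (Limits.pair x y)
  let P : SpanArray κ x y := ⟨T.I, hT.1, fun i => (T.cone i).pt,
    fun i => (T.cone i).π.app ⟨.left⟩, fun i => (T.cone i).π.app ⟨.right⟩⟩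
  refine ⟨RelHom.mk C.top P, fun φ => RelHom.le_iff.2 fun a f g _ => ?_⟩
  refine RelHom.holds_mk.2
    (Locally.mono ((FactorsLocally_iff _ _).1 (hT.2 (Limits.BinaryFan.mk f g))) ?_)
  rintro b p ⟨i, m, e⟩
  exact ⟨i, m, e ⟨.left⟩, e ⟨.right⟩⟩

theorem hasLocalMaxima_relFramed : (relFramed C hC.connected).HasLocalMaxima :=
  fun x y => RelHom.exists_isTop C hC x y

theorem RelHom.exists_unit_le {T : ConeArray (Functor.empty.{0} C.Obj)}
    (hT : C.top.IsLocalPrelimit T) (x : C.Obj) :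
    ∃ (Φ : ∀ i, RelHom C.top x (T.cone i).pt) (s : RelHom C.top x x),
      IsLUB (Set.range fun i => RelHom.comp hC.connected (Φ i) (RelHom.inv (Φ i))) s ∧
        RelHom.graph C.top (𝟙 x) ≤ s := by
  obtain ⟨V, hV, h⟩ := hT.2 ⟨x, Functor.emptyExt _ _ |>.hom⟩
  choose i m _ using h
  let Φ : ∀ j, RelHom C.top (x) (T.cone j).pt := fun j => RelHom.mk C.top
    ⟨{v // i v = j}, κ.small_fiber hT.1 V.small i j, fun v => V.dom v.1, fun v => V.hom v.1,
      fun v => m v.1 ≫ eqToHom (by rw [v.2])⟩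
  refine ⟨Φ, _, RelHom.isLUB_join hT.1 _, RelHom.le_iff.2 fun a f g H => ?_⟩
  refine (RelHom.holds_join _ _ _ _).2 (Locally.bind ((RelHom.holds_graph _ _ _).1 H) ?_)
  intro b p e
  rw [Category.comp_id] at e
  refine (((covers_iff_locally V).1 hV).pullback ?_ (p ≫ f)).mono ?_
  · rintro b c q f ⟨i, h, rfl⟩
    exact ⟨i, q ≫ h, by simp⟩
  · rintro c q ⟨v, n, e'⟩
    have key : (Φ (i v)).Holds (n ≫ V.hom v) (n ≫ m v ≫ 𝟙 _) :=
      holds_of_factor (τ := C.top) (⟨{v' // i v' = i v}, κ.small_fiber hT.1 V.small i (i v),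
        fun v => V.dom v.1, fun v => V.hom v.1,
        fun v => m v.1 ≫ eqToHom (by rw [v.2])⟩ : SpanArray κ _ _) ⟨v, rfl⟩ n
    refine ⟨i v, RelHom.holds_comp_of hC.connected (n ≫ m v ≫ 𝟙 _) ?_
      ((RelHom.holds_inv _ _ _).2 ?_)⟩
    · rw [Category.assoc, e']
      exact key
    · rw [Category.assoc, ← e, e']
      exact key

theorem hasWeakUnit_relFramed : (relFramed C hC.connected).HasWeakUnit := by
  obtain ⟨T, hT⟩ := hC _ (Functor.empty.{0} C.Obj)
  exact ⟨T.I, fun i => (T.cone i).pt, hT.1, fun x => RelHom.exists_unit_le C hC hT x⟩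

variable {C} {D : WeakSite κ} (hD : D.top.HasFiniteLocalPrelimits)

theorem RelHom.isTop_map (hC : C.top.HasFiniteLocalPrelimits) {F : C.Obj ⥤ D.Obj}
    (hF : IsMorphismOfSites C.top D.top F)
    {x y : C.Obj} {t : RelHom C.top x y} (ht : IsTop t) :
    IsTop (RelHom.map hF.isPreMorphismOfSites.preservesCovers t) := by
  intro φ
  refine RelHom.le_iff.2 fun a f g _ => RelHom.Holds.glue ?_
  obtain ⟨T, hT⟩ := hC _ (Limits.pair x y)
  have h := (hF.isLocalPrelimit_map _ _ T hT).2
    ((Limits.Cone.postcompose (Limits.pairComp x y F).inv).obj (Limits.BinaryFan.mk f g))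
  refine Locally.mono ((FactorsLocally_iff _ _).1 h) ?_
  rintro b p ⟨i, m, e⟩
  have e1 : p ≫ f = m ≫ F.map ((T.cone i).π.app ⟨.left⟩) :=
    (congrArg (p ≫ ·) (Category.comp_id f)).symm.trans (e ⟨.left⟩)
  have e2 : p ≫ g = m ≫ F.map ((T.cone i).π.app ⟨.right⟩) :=
    (congrArg (p ≫ ·) (Category.comp_id g)).symm.trans (e ⟨.right⟩)
  have h1 : RelHom.Holds (τ := C.top) (x := x) (y := y) t ((T.cone i).π.app ⟨.left⟩)
      ((T.cone i).π.app ⟨.right⟩) :=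
    RelHom.mk_le_iff.1 (ht (RelHom.mk C.top (⟨PUnit, κ.small_punit, fun _ => (T.cone i).pt,
      fun _ => (T.cone i).π.app ⟨.left⟩, fun _ => (T.cone i).π.app ⟨.right⟩⟩ :
        SpanArray κ x y))) ⟨⟩
  have h2 := (RelHom.holds_map hF.isPreMorphismOfSites.preservesCovers h1).precomp m
  exact (congrArg₂ (fun s t' => RelHom.Holds (τ := D.top) (RelHom.map _ t) s t') e1 e2).mpr h2

theorem preservesLocalMaxima_relMap {F : C.Obj ⥤ D.Obj} (hF : IsMorphismOfSites C.top D.top F) :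
    (relMap hC.connected hD.connected F
      hF.isPreMorphismOfSites).toAllegoryFunctor.PreservesLocalMaxima :=
  fun _ _ _ ht => RelHom.isTop_map hC hF ht

theorem RelHom.exists_unit_le_map {F : C.Obj ⥤ D.Obj} (hF : IsMorphismOfSites C.top D.top F)
    {I : Type w} {U : I → C.Obj} (hI : κ.Small I)
    (hU : ∀ x : C.Obj, ∃ (Φ : ∀ i, RelHom C.top x (U i)) (s : RelHom C.top x x),
      IsLUB (Set.range fun i => RelHom.comp hC.connected (Φ i) (RelHom.inv (Φ i))) s ∧
        RelHom.graph C.top (𝟙 x) ≤ s) (x : D.Obj) :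
    ∃ (Φ : ∀ i, RelHom D.top x (F.obj (U i))) (s : RelHom D.top x x),
      IsLUB (Set.range fun i => RelHom.comp hD.connected (Φ i) (RelHom.inv (Φ i))) s ∧
        RelHom.graph D.top (𝟙 x) ≤ s := by
  have hF' := hF.isPreMorphismOfSites
  obtain ⟨T, hT⟩ := hC _ (Functor.empty.{0} C.Obj)
  obtain ⟨V, hV, h⟩ := (hF.isLocalPrelimit_map _ _ T hT).2
    ⟨x, Functor.emptyExt _ _ |>.hom⟩
  choose t m _ using h
  choose Φ s hs hs' using fun t => hU (T.cone t).pt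
  let Ψ : ∀ i, RelHom D.top (x) (F.obj (U i)) := fun i =>
    RelHom.join V.small fun v => RelHom.comp hD.connected
      (RelHom.inv (RelHom.graph D.top (V.hom v)))
      (RelHom.comp hD.connected (RelHom.graph D.top (m v))
        (RelHom.map hF'.preservesCovers (Φ (t v) i)))
  refine ⟨Ψ, _, RelHom.isLUB_join hI _, RelHom.le_iff.2 fun a f g H => ?_⟩
  refine (RelHom.holds_join _ _ _ _).2 (Locally.bind ((RelHom.holds_graph _ _ _).1 H) ?_)
  intro b p e
  rw [Category.comp_id] at e
  refine (((covers_iff_locally V).1 hV).pullback ?_ (p ≫ f)).bind ?_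
  · rintro b c q f ⟨i, h, rfl⟩
    exact ⟨i, q ≫ h, by simp⟩
  rintro c q ⟨v, n, e'⟩
  have h1 : (RelHom.graph D.top (𝟙 (F.obj (T.cone (t v)).pt))).Holds (n ≫ m v) (n ≫ m v) :=
    (RelHom.holds_graph _ _ _).2 (Locally.of (by simp))
  have h2 : RelHom.graph D.top (𝟙 (F.obj (T.cone (t v)).pt)) ≤
      RelHom.map hF'.preservesCovers (s (t v)) := by
    have := RelHom.map_le_map hF'.preservesCovers (hs' (t v))
    refine le_trans (le_of_eq ?_) this
    exact ((RelHom.map_graph hF'.preservesCovers _).trans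
      (congrArg (RelHom.graph D.top) (F.map_id _))).symm
  have h3 := RelHom.map_join hF'.preservesCovers hI (hs (t v))
  have h4 := ((RelHom.isLUB_iff hI _ _).1 h3 _ _).1 (RelHom.le_iff.1 h2 _ _ h1)
  refine h4.bind ?_
  rintro d r ⟨i, hi⟩
  have h5 := (congrArg (fun χ => RelHom.Holds χ _ _) ((RelHom.map_comp hF'.preservesCovers hF'
    hC.connected hD.connected (Φ (t v) i) (RelHom.inv (Φ (t v) i))).trans
    (congrArg _ (RelHom.map_inv hF'.preservesCovers (Φ (t v) i))))).mp hi
  refine ((RelHom.holds_comp _ _ _ _ _).1 h5).mono ?_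
  rintro k l ⟨z, h6, h7⟩
  have key : ∀ h : k ⟶ x, h = l ≫ r ≫ n ≫ V.hom v →
      (RelHom.map hF'.preservesCovers (Φ (t v) i)).Holds (l ≫ r ≫ n ≫ m v) z →
      (Ψ i).Holds h z := by
    rintro h rfl H
    refine (RelHom.holds_join _ _ _ _).2 (Locally.of ⟨v, ?_⟩)
    rw [Category.id_comp, Category.id_comp]
    refine RelHom.holds_comp_of _ (l ≫ r ≫ n) ((RelHom.holds_inv _ _ _).2 ?_) ?_
    · exact (RelHom.holds_graph _ _ _).2 (Locally.of (by simp))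
    · exact (RelHom.holds_graph_comp _ _ _ _ _).2 (by rw [Category.assoc, Category.assoc]; exact H)
  refine ⟨i, RelHom.holds_comp_of hD.connected z (key _ ?_ h6) ((RelHom.holds_inv _ _ _).2
    (key _ ?_ ((RelHom.holds_inv _ _ _).1 h7)))⟩
  · simp only [Category.assoc] at e' ⊢
    rw [e']
  · simp only [Category.assoc] at e' ⊢
    rw [← e, e']

theorem preservesWeakUnits_relMap {F : C.Obj ⥤ D.Obj} (hF : IsMorphismOfSites C.top D.top F) :
    (relMap hC.connected hD.connected F
      hF.isPreMorphismOfSites).toAllegoryFunctor.PreservesWeakUnits :=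
  fun _ _ h => ⟨h.1, fun x => RelHom.exists_unit_le_map hC hD hF h.1 h.2 x⟩

end Units

/-! ## The 2-functors -/

section TwoFunctors

variable {κ : ArityClass.{w}}

theorem FramedAllegory.Functor.ext' {A B : FramedAllegory κ} {F G : FramedAllegory.Functor A B}
    (ho : F.obj = G.obj) (hm : ∀ {x y : A.Obj} (φ : x ⟶ y), HEq (F.map φ) (G.map φ))
    (ht : ∀ {x y : A.Obj} (f : A.Tight x y), HEq (F.tmap f) (G.tmap f)) : F = G := by
  obtain ⟨⟨⟨fo, fm, _, _⟩, _, _, _, _⟩, ft, _, _, _⟩ := F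
  obtain ⟨⟨⟨go, gm, _, _⟩, _, _, _, _⟩, gt, _, _, _⟩ := G
  obtain rfl : fo = go := ho
  obtain rfl : @fm = @gm := by
    funext x y φ
    exact eq_of_heq (hm φ)
  obtain rfl : @ft = @gt := by
    funext x y f
    exact eq_of_heq (ht f)
  rfl

theorem relMap_id {C : WeakSite κ} (hC : C.top.HasFiniteConnectedLocalPrelimits)
    (h : IsPreMorphismOfSites C.top C.top (𝟭 C.Obj)) :
    relMap hC hC (𝟭 C.Obj) h = FramedAllegory.Functor.id (relFramed C hC) := by
  refine FramedAllegory.Functor.ext' rfl (fun {x y} φ => heq_of_eq ?_) (fun _ => HEq.rfl)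
  exact Quotient.inductionOn φ fun P => rfl

theorem relMap_comp {C D E : WeakSite κ} (hC : C.top.HasFiniteConnectedLocalPrelimits)
    (hD : D.top.HasFiniteConnectedLocalPrelimits) (hE : E.top.HasFiniteConnectedLocalPrelimits)
    {F : C.Obj ⥤ D.Obj} {G : D.Obj ⥤ E.Obj} (hF : IsPreMorphismOfSites C.top D.top F)
    (hG : IsPreMorphismOfSites D.top E.top G) (h : IsPreMorphismOfSites C.top E.top (F ⋙ G)) :
    relMap hC hE (F ⋙ G) h = (relMap hC hD F hF).comp (relMap hD hE G hG) := by
  refine FramedAllegory.Functor.ext' rfl (fun {x y} φ => heq_of_eq ?_) (fun _ => HEq.rfl)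
  exact Quotient.inductionOn φ fun P => rfl

theorem relMap₂_eq {C D : WeakSite κ} (hC : C.top.HasFiniteConnectedLocalPrelimits)
    (hD : D.top.HasFiniteConnectedLocalPrelimits) {F G : C.Obj ⥤ D.Obj}
    (hF : IsPreMorphismOfSites C.top D.top F) (hG : IsPreMorphismOfSites C.top D.top G)
    (α : F ⟶ G) {H H' : FramedAllegory.Functor (relFramed C hC) (relFramed D hD)}
    (β : H ⟶ H') (h : relMap hC hD F hF = H) (h' : H' = relMap hC hD G hG)
    (e : ∀ x : C.Obj, HEq (α.app x) (β.tapp x)) :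
    (relMap₂ hC hD hF hG α : relMap hC hD F hF ⟶ relMap hC hD G hG) =
      eqToHom h ≫ β ≫ eqToHom h' := by
  subst h
  subst h'
  rw [eqToHom_refl, eqToHom_refl, Category.id_comp, Category.comp_id]
  exact FramedAllegory.Transformation.ext' fun x => eq_of_heq (e x)

/-- The 2-functor `Rel_κ` from locally `κ`-ary sites, pre-morphisms and natural transformations to
weakly `κ`-tabular framed allegories. -/
noncomputable def relPre (κ : ArityClass.{w}) :
    StrictPseudofunctor (lsite κ).Carrier (fallWT κ).Carrier :=
  StrictPseudofunctor.mk''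
    { obj := fun C => ⟨relFramed C.obj C.property, isWeaklyTabular_relFramed _ _⟩
      map := fun {C D} F => ⟨relMap C.property D.property F.hom F.property, trivial⟩
      map₂ := fun {C D F G} α => relMap₂ C.property D.property F.property G.property α
      map₂_id := fun _ => FramedAllegory.Transformation.ext' fun _ => rfl
      map₂_comp := fun _ _ => FramedAllegory.Transformation.ext' fun _ => rfl
      map_id := fun C => SubTwoCategory.OneCell.ext (relMap_id C.property IsPreMorphismOfSites.id)
      map_comp := fun {C D E} F G => SubTwoCategory.OneCell.ext
        (relMap_comp C.property D.property E.property F.property G.property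
          (IsPreMorphismOfSites.comp F.property G.property))
      map₂_whisker_left := fun {C D E} F G H α => by
        rw [SubTwoCategory.eqToHom_eq, SubTwoCategory.eqToHom_eq]
        exact relMap₂_eq _ _ _ _ _ _
          (relMap_comp _ _ _ F.property G.property
            (IsPreMorphismOfSites.comp F.property G.property))
          (Eq.symm <| relMap_comp _ _ _ F.property H.property
            (IsPreMorphismOfSites.comp F.property H.property))
          fun _ => HEq.rfl
      map₂_whisker_right := fun {C D E F G} α H => by
        rw [SubTwoCategory.eqToHom_eq, SubTwoCategory.eqToHom_eq]
        exact relMap₂_eq _ _ _ _ _ _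
          (relMap_comp _ _ _ F.property H.property
            (IsPreMorphismOfSites.comp F.property H.property))
          (Eq.symm <| relMap_comp _ _ _ G.property H.property
            (IsPreMorphismOfSites.comp G.property H.property))
          fun _ => HEq.rfl }

/-- The 2-functor `Rel_κ` from `κ`-ary sites, morphisms of sites and natural transformations to
weakly `κ`-tabular framed allegories with local maxima and weak `κ`-units. -/
noncomputable def rel (κ : ArityClass.{w}) :
    StrictPseudofunctor (site κ).Carrier (fallWTX κ).Carrier :=
  StrictPseudofunctor.mk''
    { obj := fun C => ⟨relFramed C.obj (WeakTopology.HasFiniteLocalPrelimits.connected C.property),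
        isWeaklyTabular_relFramed _ _, hasLocalMaxima_relFramed _ C.property,
        hasWeakUnit_relFramed _ C.property⟩
      map := fun {C D} F => ⟨relMap _ _ F.hom (IsMorphismOfSites.isPreMorphismOfSites F.property),
        preservesLocalMaxima_relMap C.property D.property F.property,
        preservesWeakUnits_relMap C.property D.property F.property⟩
      map₂ := fun {C D F G} α => relMap₂ _ _
        (IsMorphismOfSites.isPreMorphismOfSites F.property)
        (IsMorphismOfSites.isPreMorphismOfSites G.property) α
      map₂_id := fun _ => FramedAllegory.Transformation.ext' fun _ => rfl
      map₂_comp := fun _ _ => FramedAllegory.Transformation.ext' fun _ => rfl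
      map_id := fun C => SubTwoCategory.OneCell.ext (relMap_id _ IsPreMorphismOfSites.id)
      map_comp := fun {C D E} F G => SubTwoCategory.OneCell.ext
        (relMap_comp _ _ _ (IsMorphismOfSites.isPreMorphismOfSites F.property)
          (IsMorphismOfSites.isPreMorphismOfSites G.property)
          (IsPreMorphismOfSites.comp (IsMorphismOfSites.isPreMorphismOfSites F.property)
            (IsMorphismOfSites.isPreMorphismOfSites G.property)))
      map₂_whisker_left := fun {C D E} F G H α => by
        rw [SubTwoCategory.eqToHom_eq, SubTwoCategory.eqToHom_eq]
        exact relMap₂_eq _ _ _ _ _ _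
          (relMap_comp _ _ _ (IsMorphismOfSites.isPreMorphismOfSites F.property) (IsMorphismOfSites.isPreMorphismOfSites G.property)
            (IsPreMorphismOfSites.comp (IsMorphismOfSites.isPreMorphismOfSites F.property) (IsMorphismOfSites.isPreMorphismOfSites G.property)))
          (Eq.symm <| relMap_comp _ _ _ (IsMorphismOfSites.isPreMorphismOfSites F.property) (IsMorphismOfSites.isPreMorphismOfSites H.property)
            (IsPreMorphismOfSites.comp (IsMorphismOfSites.isPreMorphismOfSites F.property) (IsMorphismOfSites.isPreMorphismOfSites H.property)))
          fun _ => HEq.rfl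
      map₂_whisker_right := fun {C D E F G} α H => by
        rw [SubTwoCategory.eqToHom_eq, SubTwoCategory.eqToHom_eq]
        exact relMap₂_eq _ _ _ _ _ _
          (relMap_comp _ _ _ (IsMorphismOfSites.isPreMorphismOfSites F.property) (IsMorphismOfSites.isPreMorphismOfSites H.property)
            (IsPreMorphismOfSites.comp (IsMorphismOfSites.isPreMorphismOfSites F.property) (IsMorphismOfSites.isPreMorphismOfSites H.property)))
          (Eq.symm <| relMap_comp _ _ _ (IsMorphismOfSites.isPreMorphismOfSites G.property) (IsMorphismOfSites.isPreMorphismOfSites H.property)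
            (IsPreMorphismOfSites.comp (IsMorphismOfSites.isPreMorphismOfSites G.property) (IsMorphismOfSites.isPreMorphismOfSites H.property)))
          fun _ => HEq.rfl }

end TwoFunctors

end RelSite

namespace RelSite

/-! ## Generalities on joins -/

/-! Composition is written in diagrammatic order and `φ°` stands for the inverse of `φ`.

A relation is known by the spans that factor locally through it, and the class of an array is the
join of the relations `l° ≫ r` formed from its legs (`RelHom.isLUB_tabulation`). A framed functor
preserves joins, composites, inverses and the relations underlying tight maps, so its action on
relations is forced by its action on tight maps (`relAction_mk`). On 1-cells it remains to see that
the tight part of a framed functor is a pre-morphism of sites. This holds because the site structure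
is equational in the allegory: a cocone covers exactly if the class of its diagonal spans is the
identity, a local pre-pullback of `f` and `g` has class `f ≫ g°`, and a local pre-equalizer has
class `𝟙 ⊓ f ≫ g°`. Framed functors respect these equations, and local prelimits of finite connected
diagrams can be assembled from pre-pullbacks and pre-equalizers. For arbitrary finite diagrams,
binary pre-products and a pre-terminal family are needed instead of pre-pullbacks; they are encoded
by top relations and weak units. A framed transformation is determined by its tight components, and
every natural transformation gives one because the oplax inequality can be checked on spans.

For essential surjectivity, the tight maps of a weakly tabular allegory carry the topology in which
a cocone covers when the join of all `p° ≫ p` is the identity. The central fact is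
`holds_iff_spanHom_le`: if the array `P` has join `φ`, a tight span `(f, g)` factors locally through
`P` exactly if `f° ≫ g ≤ φ`. The hard direction is `exists_covering_of_spanHom_le`: the modular law
produces a covering, and the second tabularity condition turns equality of underlying relations into
equality of tight maps after refinement. Hence local refinement of arrays is the order on their
joins, and since every morphism is such a join, the relations of the site of tight maps are the
morphisms of the original allegory. The resulting isomorphism is the identity on objects and on
tight maps. -/

theorem isLUB_range_sigma {α I : Type*} {A : I → Type*} [Preorder α] {φ : ∀ i, A i → α}
    {s : I → α} {t : α} (hs : ∀ i, IsLUB (Set.range (φ i)) (s i)) (ht : IsLUB (Set.range s) t) :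
    IsLUB (Set.range fun k : Σ i, A i => φ k.1 k.2) t := by
  constructor
  · rintro _ ⟨⟨i, k⟩, rfl⟩
    exact ((hs i).1 ⟨k, rfl⟩).trans (ht.1 ⟨i, rfl⟩)
  · intro b hb
    refine ht.2 ?_
    rintro _ ⟨i, rfl⟩
    refine (hs i).2 ?_
    rintro _ ⟨k, rfl⟩
    exact hb ⟨⟨i, k⟩, rfl⟩

theorem isLUB_range_orderIso {α β : Type*} [Preorder α] [Preorder β] (e : α ≃o β) {I : Type*}
    {φ : I → α} {s : α} (h : IsLUB (Set.range φ) s) : IsLUB (Set.range fun i => e (φ i)) (e s) := by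
  have := (e.isLUB_image' (s := Set.range φ) (x := s)).2 h
  rwa [← Set.range_comp] at this

/-! ## Calculus of maps in an allegory -/

namespace Allegory

variable {κ : ArityClass.{w}} (A : Allegory κ)

theorem inv_le_iff {x y : A.Obj} {φ : x ⟶ y} {ψ : y ⟶ x} : A.inv φ ≤ ψ ↔ φ ≤ A.inv ψ := by
  constructor <;> intro h <;> have := A.inv_le_inv h <;> rwa [A.inv_inv] at this

theorem inv_inf {x y : A.Obj} (φ ψ : x ⟶ y) : A.inv (φ ⊓ ψ) = A.inv φ ⊓ A.inv ψ := by
  apply le_antisymm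
  · exact le_inf (A.inv_le_inv inf_le_left) (A.inv_le_inv inf_le_right)
  · rw [← A.inv_inv (A.inv φ ⊓ A.inv ψ)]
    refine A.inv_le_inv (le_inf ?_ ?_)
    · exact A.inv_le_iff.2 inf_le_left
    · exact A.inv_le_iff.2 inf_le_right

/-- The mirror image of `modular` under the involution. -/
theorem modular' {x y z : A.Obj} (φ : x ⟶ y) (ψ : y ⟶ z) (χ : x ⟶ z) :
    φ ≫ ψ ⊓ χ ≤ (φ ⊓ χ ≫ A.inv ψ) ≫ ψ := by
  have h := A.inv_le_inv (A.modular (A.inv ψ) (A.inv φ) (A.inv χ))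
  simpa only [inv_inf, A.inv_comp, A.inv_inv] using h

/-- The modular law, applied to the unit met with the identity, allows `ψ` to be replaced by `ψ ⊓
A.inv φ` inside the unit; the counit then cancels `ψ ≫ φ`. -/
theorem le_inv_of_adjoint {x y : A.Obj} {φ : x ⟶ y} {ψ : y ⟶ x} (h : 𝟙 x ≤ φ ≫ ψ)
    (h' : ψ ≫ φ ≤ 𝟙 y) : ψ ≤ A.inv φ := by
  have h1 : 𝟙 x ≤ φ ≫ (ψ ⊓ A.inv φ) := by
    refine (le_inf h le_rfl).trans ((A.modular φ ψ (𝟙 x)).trans ?_)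
    rw [Category.comp_id]
  calc ψ = ψ ≫ 𝟙 x := (Category.comp_id ψ).symm
    _ ≤ ψ ≫ φ ≫ (ψ ⊓ A.inv φ) := A.comp_le_comp le_rfl h1
    _ = (ψ ≫ φ) ≫ (ψ ⊓ A.inv φ) := (Category.assoc _ _ _).symm
    _ ≤ 𝟙 y ≫ A.inv φ := A.comp_le_comp h' inf_le_right
    _ = A.inv φ := Category.id_comp _

variable {A}

/-- Applying the involution to an adjunction gives an adjunction with left adjoint `A.inv ψ` and
right adjoint `A.inv φ`. So `le_inv_of_adjoint` bounds `ψ` and `A.inv φ` by each other, and the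
right adjoint of a map can only be its inverse. -/
theorem IsMap.unit_counit {x y : A.Obj} {φ : x ⟶ y} (h : A.IsMap φ) :
    𝟙 x ≤ φ ≫ A.inv φ ∧ A.inv φ ≫ φ ≤ 𝟙 y := by
  obtain ⟨ψ, h1, h2⟩ := h
  have h3 : A.inv φ ≤ A.inv (A.inv ψ) := by
    refine A.le_inv_of_adjoint ?_ ?_
    · have := A.inv_le_inv h1
      rwa [A.inv_id, A.inv_comp] at this
    · have := A.inv_le_inv h2
      rwa [A.inv_id, A.inv_comp] at this
  obtain rfl : ψ = A.inv φ := le_antisymm (A.le_inv_of_adjoint h1 h2) (by rwa [A.inv_inv] at h3)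
  exact ⟨h1, h2⟩

/-- The order on maps is discrete. -/
theorem IsMap.eq_of_le {x y : A.Obj} {φ ψ : x ⟶ y} (h : A.IsMap φ) (h' : A.IsMap ψ)
    (hle : φ ≤ ψ) : φ = ψ := by
  refine le_antisymm hle ?_
  calc ψ = 𝟙 x ≫ ψ := (Category.id_comp ψ).symm
    _ ≤ (φ ≫ A.inv φ) ≫ ψ := A.comp_le_comp h.unit_counit.1 le_rfl
    _ ≤ (φ ≫ A.inv ψ) ≫ ψ :=
      A.comp_le_comp (A.comp_le_comp le_rfl (A.inv_le_inv hle)) le_rfl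
    _ = φ ≫ A.inv ψ ≫ ψ := Category.assoc _ _ _
    _ ≤ φ ≫ 𝟙 y := A.comp_le_comp le_rfl h'.unit_counit.2
    _ = φ := Category.comp_id φ

theorem IsMap.inv_comp_le_iff {x y z : A.Obj} {φ : z ⟶ x} {ψ : z ⟶ y} {χ : x ⟶ y}
    (h : A.IsMap φ) : A.inv φ ≫ ψ ≤ χ ↔ ψ ≤ φ ≫ χ := by
  constructor
  · intro H
    calc ψ = 𝟙 z ≫ ψ := (Category.id_comp ψ).symm
      _ ≤ (φ ≫ A.inv φ) ≫ ψ := A.comp_le_comp h.unit_counit.1 le_rfl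
      _ = φ ≫ A.inv φ ≫ ψ := Category.assoc _ _ _
      _ ≤ φ ≫ χ := A.comp_le_comp le_rfl H
  · intro H
    calc A.inv φ ≫ ψ ≤ A.inv φ ≫ φ ≫ χ := A.comp_le_comp le_rfl H
      _ = (A.inv φ ≫ φ) ≫ χ := (Category.assoc _ _ _).symm
      _ ≤ 𝟙 x ≫ χ := A.comp_le_comp h.unit_counit.2 le_rfl
      _ = χ := Category.id_comp χ

theorem IsMap.le_comp_inv_iff {x y z : A.Obj} {φ : z ⟶ y} {ψ : x ⟶ y} {χ : x ⟶ z}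
    (h : A.IsMap φ) : χ ≤ ψ ≫ A.inv φ ↔ χ ≫ φ ≤ ψ := by
  constructor
  · intro H
    calc χ ≫ φ ≤ (ψ ≫ A.inv φ) ≫ φ := A.comp_le_comp H le_rfl
      _ = ψ ≫ A.inv φ ≫ φ := Category.assoc _ _ _
      _ ≤ ψ ≫ 𝟙 y := A.comp_le_comp le_rfl h.unit_counit.2
      _ = ψ := Category.comp_id ψ
  · intro H
    calc χ = χ ≫ 𝟙 z := (Category.comp_id χ).symm
      _ ≤ χ ≫ φ ≫ A.inv φ := A.comp_le_comp le_rfl h.unit_counit.1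
      _ = (χ ≫ φ) ≫ A.inv φ := (Category.assoc _ _ _).symm
      _ ≤ ψ ≫ A.inv φ := A.comp_le_comp H le_rfl

/-- A span of maps lies below a cospan of maps exactly if the resulting square commutes. -/
theorem IsMap.inv_comp_le_comp_inv_iff {a x y z : A.Obj} {f : a ⟶ x} {g : a ⟶ y} {h : x ⟶ z}
    {k : y ⟶ z} (hf : A.IsMap f) (hg : A.IsMap g) (hh : A.IsMap h) (hk : A.IsMap k) :
    A.inv f ≫ g ≤ h ≫ A.inv k ↔ f ≫ h = g ≫ k := by
  rw [hf.inv_comp_le_iff, ← Category.assoc, hk.le_comp_inv_iff]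
  exact ⟨fun H => ((hg.comp hk).eq_of_le (hf.comp hh) H).symm, fun H => H.ge⟩

/-- The part of the identity below a relation that starts with the inverse of `p` lies below the
image of `p`. -/
theorem id_inf_inv_comp_le {x y : A.Obj} (p : y ⟶ x) (χ : y ⟶ x) :
    𝟙 x ⊓ A.inv p ≫ χ ≤ A.inv p ≫ p := by
  rw [inf_comm]
  -- The modular law keeps `A.inv p` as first factor and bounds the second by `A.inv (A.inv p) ≫ 𝟙
  -- x`, which is `p`.
  refine (A.modular (A.inv p) χ (𝟙 x)).trans (A.comp_le_comp le_rfl (inf_le_right.trans ?_))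
  rw [A.inv_inv, Category.comp_id]

end Allegory

/-! ## Finite local prelimits from elementary ones -/

section Prelimits

open WeakTopology

variable {κ : ArityClass.{w}} {C : Type u} [Category.{v} C] {D : Type u₁} [Category.{v₁} D]

/-- Every cospan in `C` has a commuting array whose image under `F` is a local
`κ`-pre-pullback. -/
def HasMappedPrePullbacks (σ : WeakTopology κ D) (F : C ⥤ D) : Prop :=
  ∀ ⦃x y z : C⦄ (f : x ⟶ z) (g : y ⟶ z), ∃ R : SpanArray κ x y,
    (∀ i, R.l i ≫ f = R.r i ≫ g) ∧ ∀ ⦃a : D⦄ (h : a ⟶ F.obj x) (k : a ⟶ F.obj y),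
      h ≫ F.map f = k ≫ F.map g → σ.Holds (R.map F) h k

/-- Every parallel pair in `C` has an equalizing cocone whose image under `F` is a local
`κ`-pre-equalizer. -/
def HasMappedPreEqualizers (σ : WeakTopology κ D) (F : C ⥤ D) : Prop :=
  ∀ ⦃x y : C⦄ (f g : x ⟶ y), ∃ R : AryCocone κ x,
    (∀ i, R.hom i ≫ f = R.hom i ≫ g) ∧ ∀ ⦃a : D⦄ (h : a ⟶ F.obj x),
      h ≫ F.map f = h ≫ F.map g →
        σ.Locally a fun b p => ∃ (i : R.I) (m : b ⟶ F.obj (R.dom i)), p ≫ h = m ≫ F.map (R.hom i)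

/-- Every pair of objects of `C` has an array whose image under `F` is a local
`κ`-pre-product. -/
def HasMappedPreProducts (σ : WeakTopology κ D) (F : C ⥤ D) : Prop :=
  ∀ x y : C, ∃ R : SpanArray κ x y, ∀ ⦃a : D⦄ (h : a ⟶ F.obj x) (k : a ⟶ F.obj y),
    σ.Holds (R.map F) h k

/-- Some `κ`-ary family of objects of `C` has an image under `F` that is locally weakly terminal. -/
def HasMappedPreTerminal (σ : WeakTopology κ D) (F : C ⥤ D) : Prop :=
  ∃ (I : Type w) (X : I → C), κ.Small I ∧
    ∀ a : D, σ.Locally a fun b _ => ∃ i, Nonempty (b ⟶ F.obj (X i))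

/-! ### Arrays of families over part of a diagram -/

variable {J : Type} [SmallCategory J]

/-- A `κ`-ary array of families of morphisms to the objects of a diagram with indices in `S`. -/
structure PartialFamily (κ : ArityClass.{w}) (g : J ⥤ C) (S : Set J) where
  I : Type w
  small : κ.Small I
  src : I → C
  hom : ∀ i j, j ∈ S → (src i ⟶ g.obj j)

namespace PartialFamily

variable {g : J ⥤ C} {S : Set J}

/-- Every cone over the image of the whole diagram factors locally through the image of the
array. -/
def IsUniversal (R : PartialFamily κ g S) (σ : WeakTopology κ D) (F : C ⥤ D) : Prop :=
  ∀ K : Limits.Cone (g ⋙ F), σ.Locally K.pt fun b p =>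
    ∃ (i : R.I) (m : b ⟶ F.obj (R.src i)), ∀ j hj, p ≫ K.π.app j = m ≫ F.map (R.hom i j hj)

/-- Adding an index to an array of families. -/
noncomputable def insert (R : PartialFamily κ g S) (k : J)
    (B : ∀ i, SpanArray κ (R.src i) (g.obj k)) : PartialFamily κ g (Insert.insert k S) where
  I := Σ i, (B i).I
  small := κ.small_sigma R.small fun i => (B i).small
  src t := (B t.1).src t.2
  hom t j hj := by
    classical
    -- The new leg takes precedence at `k` even if `k` already lies in `S`, so no hypothesis `k ∉ S`
    -- is needed. The equality morphism only transports along `j = k`.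
    exact if h : j = k then (B t.1).r t.2 ≫ eqToHom (by rw [h]) else
      (B t.1).l t.2 ≫ R.hom t.1 j (hj.resolve_left h)

variable {σ : WeakTopology κ D} {F : C ⥤ D}

/-- The new leg has to be found only for pairs `(p, m)` already compatible with a cone. This weak
requirement covers all three uses: a forced leg, a leg from a pre-pullback, and a leg from a
pre-product. -/
theorem IsUniversal.insert {R : PartialFamily κ g S} (hR : R.IsUniversal σ F) (k : J)
    (B : ∀ i, SpanArray κ (R.src i) (g.obj k))
    (hB : ∀ (K : Limits.Cone (g ⋙ F)) (i : R.I) ⦃b : D⦄ (p : b ⟶ K.pt)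
      (m : b ⟶ F.obj (R.src i)), (∀ j hj, p ≫ K.π.app j = m ≫ F.map (R.hom i j hj)) →
        σ.Holds ((B i).map F) m (p ≫ K.π.app k)) : (R.insert k B).IsUniversal σ F := by
  intro K
  refine (hR K).bind ?_
  rintro b p ⟨i, m, e⟩
  refine Locally.mono (hB K i p m e) ?_
  rintro c q ⟨(t : (B i).I), (n : c ⟶ F.obj ((B i).src t)), (e1 : q ≫ m = n ≫ F.map ((B i).l t)),
    (e2 : q ≫ p ≫ K.π.app k = n ≫ F.map ((B i).r t))⟩
  refine ⟨⟨i, t⟩, n, fun j hj => ?_⟩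
  by_cases h : j = k
  · subst h
    simpa [PartialFamily.insert] using e2
  · simp only [PartialFamily.insert, h, ↓reduceDIte, F.map_comp]
    rw [Category.assoc, e j (hj.resolve_left h), ← Category.assoc, e1, Category.assoc]

/-- Restricting an array of families along cocones on its sources. -/
def restrict (R : PartialFamily κ g S) (E : ∀ i, AryCocone κ (R.src i)) :
    PartialFamily κ g S where
  I := Σ i, (E i).I
  small := κ.small_sigma R.small fun i => (E i).small
  src t := (E t.1).dom t.2
  hom t j hj := (E t.1).hom t.2 ≫ R.hom t.1 j hj

/-- Arrows are treated one at a time. Restricting along a pre-equalizer makes one arrow commute, and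
it keeps the earlier equations because they are stable under precomposition. Universality survives
because the legs of a cone satisfy the equation to be enforced. -/
theorem IsUniversal.exists_equalized {R : PartialFamily κ g Set.univ} (hR : R.IsUniversal σ F)
    (hF : HasMappedPreEqualizers σ F) (E : Finset (Σ p : J × J, (p.1 ⟶ p.2))) :
    ∃ R' : PartialFamily κ g Set.univ, R'.IsUniversal σ F ∧ ∀ f ∈ E, ∀ i,
      R'.hom i f.1.1 trivial ≫ g.map f.2 = R'.hom i f.1.2 trivial := by
  classical
  induction E using Finset.induction_on with
  | empty => exact ⟨R, hR, by simp⟩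
  | insert f E _ ih =>
    obtain ⟨R', hR', h⟩ := ih
    choose T hT hT' using fun i => hF (R'.hom i f.1.1 trivial ≫ g.map f.2) (R'.hom i f.1.2 trivial)
    refine ⟨R'.restrict T, fun K => ?_, ?_⟩
    · refine (hR' K).bind ?_
      rintro b p ⟨i, m, e⟩
      refine (hT' i m ?_).mono ?_
      -- The cone condition of `K` at the arrow is exactly the statement that `m` equalizes the
      -- images of the two morphisms.
      · have h1 := K.w f.2
        rw [F.map_comp, ← Category.assoc, ← e _ trivial, ← e _ trivial, ← h1, Category.assoc]
        rfl
      · rintro c q ⟨t, n, e'⟩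
        refine ⟨⟨i, t⟩, n, fun j hj => ?_⟩
        simp only [restrict, F.map_comp]
        rw [Category.assoc, e j hj, ← Category.assoc, e', Category.assoc]
    · rintro f' hf' ⟨i, t⟩
      rcases Finset.mem_insert.1 hf' with rfl | hf'
      · exact (Category.assoc _ _ _).trans (hT i t)
      · exact (Category.assoc _ _ _).trans (congrArg _ (h f' hf' i))

variable [FinCategory J]

/-- Once all arrows of the finite category `J` have been made to commute, the families in the array
are cones. -/
theorem IsUniversal.exists_isLocalPrelimit {R : PartialFamily κ g Set.univ}
    (hR : R.IsUniversal σ F) (hF : HasMappedPreEqualizers σ F) :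
    ∃ T : ConeArray.{w} g, σ.IsLocalPrelimit (T.map F) := by
  obtain ⟨R', hR', h⟩ := hR.exists_equalized hF Finset.univ
  refine ⟨⟨R'.I, fun i => ⟨R'.src i, ⟨fun j => R'.hom i j trivial, fun j k f => ?_⟩⟩⟩,
    R'.small, fun K => (FactorsLocally_iff _ _).2 ((hR' K).mono ?_)⟩
  · exact (Category.id_comp _).trans (h ⟨(j, k), f⟩ (Finset.mem_univ _) i).symm
  · rintro b p ⟨i, m, e⟩
    exact ⟨i, m, fun j => e j trivial⟩

/-- Finiteness of `J` provides a maximal index set carrying a universal array; by the extension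
property it cannot be proper. -/
theorem exists_isUniversal_of_extends (S₀ : Set J)
    (h₀ : ∃ R : PartialFamily κ g S₀, R.IsUniversal σ F)
    (H : ∀ S, S₀ ⊆ S → (∃ R : PartialFamily κ g S, R.IsUniversal σ F) → S ≠ Set.univ →
      ∃ k ∉ S, ∃ R : PartialFamily κ g (Insert.insert k S), R.IsUniversal σ F) :
    ∃ R : PartialFamily κ g Set.univ, R.IsUniversal σ F := by
  obtain ⟨S, hS, hmax⟩ := (Set.toFinite {S : Set J | S₀ ⊆ S ∧
    ∃ R : PartialFamily κ g S, R.IsUniversal σ F}).exists_maximal ⟨S₀, subset_rfl, h₀⟩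
  by_cases e : S = Set.univ
  · exact e ▸ hS.2
  · obtain ⟨k, hk, h⟩ := H S hS.1 hS.2 e
    exact absurd (hmax ⟨hS.1.trans (Set.subset_insert k S), h⟩ (Set.subset_insert k S)
      (Set.mem_insert k S)) hk

end PartialFamily

/-! ### Local prelimits of finite diagrams and their images -/

variable {σ : WeakTopology κ D} {F : C ⥤ D}

/-- If `F` sends some array over `g` to a local prelimit, it preserves all local prelimits
of `g`. -/
theorem isLocalPrelimit_map_of_exists {τ : WeakTopology κ C} (hF : PreservesCovers τ σ F)
    {g : J ⥤ C} (h : ∃ T : ConeArray.{w} g, σ.IsLocalPrelimit (T.map F)) {T : ConeArray.{w} g}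
    (hT : τ.IsLocalPrelimit T) : σ.IsLocalPrelimit (T.map F) := by
  obtain ⟨T₀, hT₀⟩ := h
  refine ⟨hT.1, fun K => (FactorsLocally_iff _ _).2 ?_⟩
  refine Locally.bind ((FactorsLocally_iff _ _).1 (hT₀.2 K)) ?_
  rintro b p ⟨i, m, e⟩
  -- The cones of `T₀` lie over `g` itself, so they factor locally through `T` already in `C`; `F`
  -- carries these factorizations along because it preserves covers.
  have h1 : σ.Locally (F.obj (T₀.cone i).pt) fun c q => ∃ (k : T.I) (n : c ⟶ F.obj (T.cone k).pt),
      ∀ j, q ≫ F.map ((T₀.cone i).π.app j) = n ≫ F.map ((T.cone k).π.app j) := by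
    refine hF.locally ((FactorsLocally_iff _ _).1 (hT.2 (T₀.cone i))) ?_
    rintro c q ⟨k, n, e'⟩
    exact ⟨k, F.map n, fun j => by rw [← F.map_comp, e' j, F.map_comp]⟩
  refine (h1.pullback ?_ m).mono ?_
  · rintro c d r q ⟨k, n, e'⟩
    exact ⟨k, r ≫ n, fun j => by rw [Category.assoc, e' j, Category.assoc]⟩
  · rintro c q ⟨k, n, e'⟩
    refine ⟨k, n, fun j => ?_⟩
    rw [Category.assoc, e j]
    exact (Category.assoc _ _ _).symm.trans (e' j)

variable [FinCategory J]

open PartialFamily in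
-- The index set grows from a single object along arrows of `J`, and connectedness ensures that it
-- reaches every object. Commutativity is ignored meanwhile and imposed at the end by
-- pre-equalizers.
theorem exists_isLocalPrelimit_map_of_isConnected (hp : HasMappedPrePullbacks σ F)
    (he : HasMappedPreEqualizers σ F) [IsConnected J] (g : J ⥤ C) :
    ∃ T : ConeArray.{w} g, σ.IsLocalPrelimit (T.map F) := by
  obtain ⟨j₀⟩ : Nonempty J := inferInstance
  suffices ∃ R : PartialFamily κ g Set.univ, R.IsUniversal σ F by
    obtain ⟨R, hR⟩ := this
    exact hR.exists_isLocalPrelimit he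
  refine exists_isUniversal_of_extends {j₀} ⟨⟨PUnit, κ.small_punit, fun _ => g.obj j₀,
    fun _ j hj => eqToHom (by rw [Set.mem_singleton_iff.1 hj])⟩, fun K => ?_⟩ ?_
  · refine Locally.of ⟨⟨⟩, K.π.app j₀, fun j hj => ?_⟩
    obtain rfl := Set.mem_singleton_iff.1 hj
    simp
  · rintro S hS ⟨R, hR⟩ hne
    -- If no index outside `S` can be added, then `S` is closed under arrows of `J` in both
    -- directions, hence is everything by connectedness.
    by_contra! hcon
    refine hne (Set.eq_univ_of_forall fun j => ?_)
    refine induct_on_objects S (j₀ := j₀) (hS rfl) (fun {j k} f => ⟨fun hj => ?_, fun hk => ?_⟩) j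
    · by_contra hk
      -- For an arrow leaving `S`, the leg at its target is forced, so the one-member array of a
      -- graph suffices.
      refine hcon k hk _ (hR.insert k (fun i => SpanArray.graph κ (R.hom i j hj ≫ g.map f)) ?_)
      intro K i b p m e
      have h1 : K.π.app j ≫ F.map (g.map f) = K.π.app k := K.w f
      refine Locally.of ⟨⟨⟩, m, ?_, ?_⟩
      · simp [SpanArray.map, SpanArray.graph]
      · simp only [SpanArray.map, SpanArray.graph, F.map_comp]
        rw [Category.id_comp, ← h1, ← Category.assoc, e j hj, Category.assoc]
    · by_contra hj
      -- For an arrow entering `S`, the legs at its source come from a pre-pullback. That its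
      -- squares commute in `C` can be discarded, since all arrows are equalized later.
      choose B _ hB using fun i => hp (R.hom i k hk) (g.map f)
      refine hcon j hj _ (hR.insert j B ?_)
      intro K i b p m e
      refine hB i _ _ ?_
      have h1 : K.π.app j ≫ F.map (g.map f) = K.π.app k := K.w f
      rw [Category.assoc, h1, e k hk]

open PartialFamily in
-- Without connectedness the construction starts from the empty index set, where universality means
-- pre-terminality, and adds objects by pre-products.
theorem exists_isLocalPrelimit_map (ht : HasMappedPreTerminal σ F)
    (hp : HasMappedPreProducts σ F) (he : HasMappedPreEqualizers σ F) (g : J ⥤ C) :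
    ∃ T : ConeArray.{w} g, σ.IsLocalPrelimit (T.map F) := by
  suffices ∃ R : PartialFamily κ g Set.univ, R.IsUniversal σ F by
    obtain ⟨R, hR⟩ := this
    exact hR.exists_isLocalPrelimit he
  obtain ⟨I, X, hI, hX⟩ := ht
  refine exists_isUniversal_of_extends ∅ ⟨⟨I, hI, X, fun _ _ h => h.elim⟩, fun K => ?_⟩ ?_
  · exact (hX K.pt).mono fun b _ ⟨i, ⟨m⟩⟩ => ⟨i, m, fun _ h => h.elim⟩
  · rintro S - ⟨R, hR⟩ hne
    obtain ⟨k, hk⟩ := (Set.ne_univ_iff_exists_notMem S).1 hne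
    choose B hB using fun i => hp (R.src i) (g.obj k)
    exact ⟨k, hk, _, hR.insert k B fun K i b p m _ => hB i _ _⟩

end Prelimits

/-! ## Local properties of arrays in terms of relations -/

section RelHomArrays

open WeakTopology RelSite.RelHom

variable {κ : ArityClass.{w}} {C : Type u} [Category.{v} C] {τ : WeakTopology κ C}

/-- The diagonal spans always lie below the identity; the converse inequality, tested on the span
`(𝟙 x, 𝟙 x)`, says that the identity of `x` factors locally through `P`. Covering thus becomes an
equation between relations, which framed functors preserve. -/
theorem covers_iff_mk_eq {x : C} (P : AryCocone κ x) :
    τ.Covers P ↔ RelHom.mk τ (⟨P.I, P.small, P.dom, P.hom, P.hom⟩ : SpanArray κ x x) =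
      RelHom.graph τ (𝟙 x) := by
  rw [covers_iff_locally]
  constructor
  · intro h
    refine le_antisymm (mk_le_iff.2 fun i => ?_) (mk_le_iff.2 fun _ => ?_)
    · exact (RelHom.holds_graph _ _ _).2 (Locally.of (by simp))
    · refine RelHom.holds_mk.2 (Locally.mono h ?_)
      rintro b p ⟨i, m, e⟩
      exact ⟨i, m, (Category.comp_id p).trans e, (Category.comp_id p).trans e⟩
  · intro h
    have h1 : (RelHom.graph τ (𝟙 x)).Holds (𝟙 x) (𝟙 x) :=
      (RelHom.holds_graph _ _ _).2 (Locally.of (by simp))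
    rw [← h] at h1
    refine Locally.mono (RelHom.holds_mk.1 h1) ?_
    rintro b p ⟨i, m, e, _⟩
    exact ⟨i, m, (Category.comp_id p).symm.trans e⟩

variable (hτ : τ.HasFiniteConnectedLocalPrelimits)

theorem holds_comp_inv_graph {x y z a : C} (f : x ⟶ z) (g : y ⟶ z) (h : a ⟶ x) (k : a ⟶ y) :
    (comp hτ (graph τ f) (inv (graph τ g))).Holds h k ↔
      τ.Locally a fun _ p => p ≫ h ≫ f = p ≫ k ≫ g := by
  rw [holds_graph_comp, RelHom.holds_inv, RelHom.holds_graph]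
  constructor <;> exact fun H => H.mono fun _ _ e => e.symm

/-- Both relations hold of exactly those spans whose composites with `f` and `g` agree locally. -/
theorem WeakTopology.IsLocalPrePullback.mk_eq {x y z : C} {f : x ⟶ z} {g : y ⟶ z} {R : SpanArray κ x y}
    (h : τ.IsLocalPrePullback f g R) :
    RelHom.mk τ R = comp hτ (graph τ f) (inv (graph τ g)) := by
  refine le_antisymm (mk_le_iff.2 fun i => ?_) (le_iff.2 fun a p q H => ?_)
  · exact (holds_comp_inv_graph hτ _ _ _ _).2 (Locally.of (by rw [h.1 i]))
  · refine WeakTopology.Holds.glue (((holds_comp_inv_graph hτ _ _ _ _).1 H).mono ?_)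
    intro b r e
    exact h.2 _ _ (by simpa using e)

/-- Meeting with the identity forces the two legs of a span to agree locally; the other conjunct
then says that this common leg equalizes `f` and `g` locally. -/
theorem WeakTopology.IsLocalPreEqualizer.mk_eq {x y : C} {f g : x ⟶ y} {R : AryCocone κ x}
    (h : τ.IsLocalPreEqualizer f g R) :
    RelHom.mk τ (⟨R.I, R.small, R.dom, R.hom, R.hom⟩ : SpanArray κ x x) =
      RelHom.inf hτ (graph τ (𝟙 x)) (comp hτ (graph τ f) (inv (graph τ g))) := by
  refine le_antisymm (mk_le_iff.2 fun i => ?_) (le_iff.2 fun a p q H => ?_)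
  · refine (holds_inf hτ _ _ _ _).2 ⟨(RelHom.holds_graph _ _ _).2 (Locally.of (by simp)), ?_⟩
    exact (holds_comp_inv_graph hτ _ _ _ _).2 (Locally.of (by
      change 𝟙 _ ≫ R.hom i ≫ f = 𝟙 _ ≫ R.hom i ≫ g
      rw [h.1 i]))
  · obtain ⟨h1, h2⟩ := (holds_inf hτ _ _ _ _).1 H
    refine WeakTopology.Holds.glue (((RelHom.holds_graph _ _ _).1 h1).bind ?_)
    intro b r e
    refine (((holds_comp_inv_graph hτ _ _ _ _).1 h2).pullback ?_ r).mono ?_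
    · intro c d s t e'
      rw [Category.assoc, e', Category.assoc]
    · intro c s e'
      rw [Category.comp_id] at e
      -- The identity conjunct yields `r ≫ p = r ≫ q`, so `q` can be exchanged for `p` in the other
      -- one and the pre-equalizer applies to a single morphism.
      have e1 : ((s ≫ r) ≫ p) ≫ f = ((s ≫ r) ≫ p) ≫ g := by
        refine (Category.assoc _ _ _).trans (e'.trans ?_)
        simp only [Category.assoc]
        rw [← Category.assoc r q, ← e, Category.assoc]
      refine WeakTopology.Holds.glue (P := ⟨R.I, R.small, R.dom, R.hom, R.hom⟩)
        ((h.2 _ e1).mono ?_)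
      rintro d t ⟨i, m, e2⟩
      have := holds_of_factor (τ := τ)
        (⟨R.I, R.small, R.dom, R.hom, R.hom⟩ : SpanArray κ x x) i m
      change τ.Holds _ (m ≫ R.hom i) (m ≫ R.hom i) at this
      rw [← e2] at this
      convert this using 1
      simp only [Category.assoc] at e ⊢
      rw [e]

end RelHomArrays

/-! ## Framed functors between allegories of relations -/

section OneCells

open WeakTopology

variable {κ : ArityClass.{w}} {C D : WeakSite κ} {hC : C.top.HasFiniteConnectedLocalPrelimits}
  {hD : D.top.HasFiniteConnectedLocalPrelimits}

namespace FramedAllegory.Functor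

variable (H : FramedAllegory.Functor (relFramed C hC) (relFramed D hD))

/-- The action on tight maps of a framed functor between allegories of relations. -/
def tightFunctor : C.Obj ⥤ D.Obj where
  obj x := H.obj x
  map f := H.tmap f
  map_id x := H.tmap_tid x
  map_comp f g := H.tmap_tcomp f g

/-- The action on relations of a framed functor between allegories of relations. -/
def relAction {x y : C.Obj} (φ : RelHom C.top x y) :
    RelHom D.top (H.tightFunctor.obj x) (H.tightFunctor.obj y) :=
  H.map (X := x) (Y := y) φ

theorem relAction_graph {x y : C.Obj} (f : x ⟶ y) :
    H.relAction (RelHom.graph C.top f) = RelHom.graph D.top (H.tightFunctor.map f) :=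
  (H.J_tmap f).symm

theorem relAction_comp {x y z : C.Obj} (φ : RelHom C.top x y) (ψ : RelHom C.top y z) :
    H.relAction (RelHom.comp hC φ ψ) = RelHom.comp hD (H.relAction φ) (H.relAction ψ) :=
  H.map_comp (X := x) (Y := y) (Z := z) φ ψ

theorem relAction_inv {x y : C.Obj} (φ : RelHom C.top x y) :
    H.relAction (RelHom.inv φ) = RelHom.inv (H.relAction φ) :=
  H.map_inv (x := x) (y := y) φ

theorem relAction_inf {x y : C.Obj} (φ ψ : RelHom C.top x y) :
    H.relAction (RelHom.inf hC φ ψ) = RelHom.inf hD (H.relAction φ) (H.relAction ψ) :=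
  H.map_inf (x := x) (y := y) φ ψ

/-- The class of an array is a join of composites built from its legs by the involution and
composition, all of which `H` preserves. So `H` acts on arrays by applying its tight part to the
legs. -/
theorem relAction_mk {x y : C.Obj} (P : SpanArray κ x y) :
    H.relAction (RelHom.mk C.top P) = RelHom.mk D.top (P.map H.tightFunctor) := by
  have h1 : IsLUB (Set.range fun i => H.relAction
      (RelHom.comp hC (RelHom.inv (RelHom.graph C.top (P.l i))) (RelHom.graph C.top (P.r i))))
      (H.relAction (RelHom.mk C.top P)) :=
    H.map_join (x := x) (y := y) P.small (RelHom.isLUB_tabulation hC P)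
  simp only [relAction_comp, relAction_inv, relAction_graph] at h1
  exact h1.unique (RelHom.isLUB_tabulation hD (P.map H.tightFunctor))

theorem preservesCovers_tightFunctor : PreservesCovers C.top D.top H.tightFunctor := by
  intro u P hP
  refine (covers_iff_mk_eq _).2 ?_
  have h := congrArg H.relAction ((covers_iff_mk_eq P).1 hP)
  rw [relAction_mk, relAction_graph, CategoryTheory.Functor.map_id] at h
  exact h

/-- The equation of `IsLocalPrePullback.mk_eq` is preserved by `H`, and its image says which spans
factor locally through the image array. -/
theorem hasMappedPrePullbacks_tightFunctor : HasMappedPrePullbacks D.top H.tightFunctor := by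
  intro x y z f g
  have hR := prePullback_spec hC f g
  refine ⟨_, hR.1, fun a h k e => RelHom.holds_mk.1 ?_⟩
  rw [← relAction_mk, hR.mk_eq hC, relAction_comp, relAction_inv, relAction_graph,
    relAction_graph, holds_comp_inv_graph]
  exact Locally.of (by rw [e])

theorem hasMappedPreEqualizers_tightFunctor :
    HasMappedPreEqualizers D.top H.tightFunctor := by
  intro x y f g
  obtain ⟨R, hR⟩ := exists_preEqualizer hC f g
  refine ⟨R, hR.1, fun a h e => ?_⟩
  -- The diagonal span `(h, h)` satisfies both conjuncts of the meet, so it factors locally through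
  -- the image of `R`; either leg gives the required factorization.
  have key : (H.relAction (RelHom.mk C.top
      (⟨R.I, R.small, R.dom, R.hom, R.hom⟩ : SpanArray κ x x))).Holds h h := by
    rw [hR.mk_eq hC, relAction_inf, relAction_comp, relAction_inv, relAction_graph,
      relAction_graph, relAction_graph, RelHom.holds_inf, holds_comp_inv_graph,
      RelHom.holds_graph]
    exact ⟨Locally.of (by simp), Locally.of (by rw [e])⟩
  rw [relAction_mk] at key
  refine Locally.mono (RelHom.holds_mk.1 key) ?_
  rintro b p ⟨i, m, e', _⟩
  exact ⟨i, m, e'⟩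

/-- One array over `g` with a local prelimit as image is obtained by assembly; preservation of
covers extends the conclusion to every local prelimit of `g`. -/
theorem isPreMorphismOfSites_tightFunctor :
    IsPreMorphismOfSites C.top D.top H.tightFunctor := by
  intro J _ _ _ g T hT
  exact isLocalPrelimit_map_of_exists H.preservesCovers_tightFunctor
    (exists_isLocalPrelimit_map_of_isConnected H.hasMappedPrePullbacks_tightFunctor
      H.hasMappedPreEqualizers_tightFunctor g) hT

theorem relMap_tightFunctor :
    relMap hC hD H.tightFunctor H.isPreMorphismOfSites_tightFunctor = H := by
  refine FramedAllegory.Functor.ext' rfl (fun {x y} φ => heq_of_eq ?_) (fun _ => HEq.rfl)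
  exact Quotient.inductionOn φ fun P => (H.relAction_mk P).symm

/-- Any array representing the top relation serves: its image represents a top relation, and every
span lies below that. -/
theorem hasMappedPreProducts_tightFunctor (hC' : C.top.HasFiniteLocalPrelimits)
    (hH : H.toAllegoryFunctor.PreservesLocalMaxima) :
    HasMappedPreProducts D.top H.tightFunctor := by
  intro x y
  obtain ⟨t, ht⟩ := RelHom.exists_isTop C hC' x y
  induction t using Quotient.inductionOn with | _ P
  refine ⟨P, fun a h k => ?_⟩
  have h1 : IsTop (H.relAction (RelHom.mk C.top P)) := hH (x := x) (y := y) (RelHom.mk C.top P) ht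
  rw [relAction_mk] at h1
  exact RelHom.mk_le_iff.1
    (h1 (RelHom.mk D.top ⟨PUnit, κ.small_punit, fun _ => a, fun _ => h, fun _ => k⟩)) ⟨⟩

theorem hasMappedPreTerminal_tightFunctor (hC' : C.top.HasFiniteLocalPrelimits)
    (hH : H.toAllegoryFunctor.PreservesWeakUnits) :
    HasMappedPreTerminal D.top H.tightFunctor := by
  obtain ⟨T, hT⟩ := hC' _ (Functor.empty.{0} C.Obj)
  refine ⟨T.I, fun i => (T.cone i).pt, hT.1, fun a => ?_⟩
  -- The vertices of a local prelimit of the empty diagram form a weak unit, so their images do too.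
  -- Evaluating the join that bounds the identity at `(𝟙 a, 𝟙 a)` yields, locally, a morphism to one
  -- of them.
  obtain ⟨Φ, s, hs, hs'⟩ := (hH (I := T.I) (fun i => (T.cone i).pt)
    ⟨hT.1, RelHom.exists_unit_le C hC' hT⟩).2 a
  have h0 : (RelHom.graph D.top (𝟙 a)).Holds (𝟙 a) (𝟙 a) :=
    (RelHom.holds_graph _ _ _).2 (Locally.of (by simp))
  have h1 : RelHom.Holds (τ := D.top) (x := a) (y := a) s (𝟙 a) (𝟙 a) :=
    RelHom.le_iff.1 hs' _ _ h0
  refine (((RelHom.isLUB_iff hT.1 _ s).1 hs _ _).1 h1).bind ?_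
  rintro b p ⟨i, hi⟩
  refine ((RelHom.holds_comp hD _ _ _ _).1 hi).mono ?_
  rintro c q ⟨m, _⟩
  exact ⟨i, ⟨m⟩⟩

/-- An array over `g` whose image is a local prelimit is more than covering-flatness asks: it is one
array through which all cones factor locally. -/
theorem isMorphismOfSites_tightFunctor (hC' : C.top.HasFiniteLocalPrelimits)
    (hH : H.toAllegoryFunctor.PreservesLocalMaxima)
    (hH' : H.toAllegoryFunctor.PreservesWeakUnits) :
    IsMorphismOfSites C.top D.top H.tightFunctor := by
  refine ⟨fun J _ _ g S => ?_, H.preservesCovers_tightFunctor⟩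
  obtain ⟨T, hT⟩ := exists_isLocalPrelimit_map (H.hasMappedPreTerminal_tightFunctor hC' hH')
    (H.hasMappedPreProducts_tightFunctor hC' hH) H.hasMappedPreEqualizers_tightFunctor g
  exact ⟨T, hT.2 S⟩

end FramedAllegory.Functor

/-- The tight part of `relMap` recovers the original functor by definition. -/
theorem relMap_injective {F G : C.Obj ⥤ D.Obj} (hF : IsPreMorphismOfSites C.top D.top F)
    (hG : IsPreMorphismOfSites C.top D.top G) (h : relMap hC hD F hF = relMap hC hD G hG) :
    F = G :=
  congrArg FramedAllegory.Functor.tightFunctor h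

/-- The loose components of a framed transformation are the graphs of its tight ones, so only the
tight natural transformation is data. -/
theorem relMap₂_bijective {F G : C.Obj ⥤ D.Obj} (hF : IsPreMorphismOfSites C.top D.top F)
    (hG : IsPreMorphismOfSites C.top D.top G) :
    Function.Bijective (relMap₂ hC hD hF hG) := by
  constructor
  · intro α β h
    ext x
    exact congrFun (congrArg (fun γ : FramedAllegory.Transformation _ _ => γ.tapp) h) x
  · intro β
    exact ⟨{ app := fun x => β.tapp x, naturality := fun x y f => β.tnaturality f },
      FramedAllegory.Transformation.ext' fun _ => rfl⟩

end OneCells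

/-! ### Isomorphisms of hom-categories -/

theorem relPre_bijective_map {κ : ArityClass.{w}} (C D : (lsite κ).Carrier) :
    Function.Bijective fun F : C ⟶ D => (relPre κ).map F := by
  constructor
  · intro F G h
    exact SubTwoCategory.OneCell.ext (relMap_injective F.property G.property
      (congrArg SubTwoCategory.OneCell.hom h))
  · rintro ⟨H, _⟩
    exact ⟨⟨_, H.isPreMorphismOfSites_tightFunctor⟩,
      SubTwoCategory.OneCell.ext H.relMap_tightFunctor⟩

theorem rel_bijective_map {κ : ArityClass.{w}} (C D : (site κ).Carrier) :
    Function.Bijective fun F : C ⟶ D => (rel κ).map F := by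
  constructor
  · intro F G h
    exact SubTwoCategory.OneCell.ext (relMap_injective
      (IsMorphismOfSites.isPreMorphismOfSites F.property)
      (IsMorphismOfSites.isPreMorphismOfSites G.property)
      (congrArg SubTwoCategory.OneCell.hom h))
  · rintro ⟨H, hH, hH'⟩
    exact ⟨⟨_, H.isMorphismOfSites_tightFunctor C.property hH hH'⟩,
      SubTwoCategory.OneCell.ext H.relMap_tightFunctor⟩

theorem relPre_bijective_map₂ {κ : ArityClass.{w}} {C D : (lsite κ).Carrier} (F G : C ⟶ D) :
    Function.Bijective fun α : F ⟶ G => (relPre κ).map₂ α :=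
  relMap₂_bijective F.property G.property

theorem rel_bijective_map₂ {κ : ArityClass.{w}} {C D : (site κ).Carrier} (F G : C ⟶ D) :
    Function.Bijective fun α : F ⟶ G => (rel κ).map₂ α :=
  relMap₂_bijective (IsMorphismOfSites.isPreMorphismOfSites F.property)
    (IsMorphismOfSites.isPreMorphismOfSites G.property)

/-! ## The site of tight maps of a weakly tabular framed allegory -/

namespace FramedAllegory

variable {κ : ArityClass.{w}} (A : FramedAllegory κ)

/-- The object of the allegory underlying an object of the category of tight maps. -/
def TMap.un {A : FramedAllegory κ} (x : A.TMap) : A.Obj := x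

/-- The relation underlying a tight map, as a morphism between the underlying objects. -/
def graph {x y : A.TMap} (f : x ⟶ y) : x.un ⟶ y.un := A.J f

/-- The right adjoint of the relation underlying a tight map. -/
abbrev cograph {x y : A.TMap} (f : x ⟶ y) : y.un ⟶ x.un := A.inv (A.graph f)

theorem isMap_graph {x y : A.TMap} (f : x ⟶ y) : A.IsMap (A.graph f) := A.isMap_J f

theorem graph_id (x : A.TMap) : A.graph (𝟙 x) = 𝟙 x.un := A.J_tid x

theorem cograph_id (x : A.TMap) : A.cograph (𝟙 x) = 𝟙 x.un := by
  rw [cograph, graph_id, A.inv_id]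

theorem graph_comp {x y z : A.TMap} (f : x ⟶ y) (g : y ⟶ z) :
    A.graph (f ≫ g) = A.graph f ≫ A.graph g := A.J_tcomp f g

/-- The relation `f^• g_•` of a span of tight maps. -/
def spanHom {a x y : A.TMap} (f : a ⟶ x) (g : a ⟶ y) : x.un ⟶ y.un :=
  A.cograph f ≫ A.graph g

variable {A}

theorem spanHom_comp {a b x y : A.TMap} (h : b ⟶ a) (f : a ⟶ x) (g : a ⟶ y) :
    A.spanHom (h ≫ f) (h ≫ g) = A.cograph f ≫ A.spanHom h h ≫ A.graph g := by
  simp only [spanHom, cograph, graph_comp, A.inv_comp, Category.assoc]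

theorem spanHom_self_le {a x : A.TMap} (f : a ⟶ x) :
    A.spanHom f f ≤ 𝟙 x.un :=
  (A.isMap_graph f).unit_counit.2

theorem spanHom_precomp_le {a b x y : A.TMap} (h : b ⟶ a) (f : a ⟶ x) (g : a ⟶ y) :
    A.spanHom (h ≫ f) (h ≫ g) ≤ A.spanHom f g := by
  rw [spanHom_comp]
  refine (A.comp_le_comp le_rfl (A.comp_le_comp (spanHom_self_le h) le_rfl)).trans ?_
  rw [Category.id_comp]
  exact le_rfl

theorem spanHom_id_left {x y : A.TMap} (f : x ⟶ y) : A.spanHom (𝟙 x) f = A.graph f := by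
  rw [spanHom, cograph_id, Category.id_comp]

theorem inv_spanHom {a x y : A.TMap} (f : a ⟶ x) (g : a ⟶ y) :
    A.inv (A.spanHom f g) = A.spanHom g f := by
  rw [spanHom, A.inv_comp, A.inv_inv, spanHom]

/-- Maps are discretely ordered, so the inequality amounts to commutation of the square, but only
for underlying relations and not yet for tight maps. -/
theorem spanHom_le_iff {a x y z : A.TMap} {f : a ⟶ x} {g : a ⟶ y} {h : x ⟶ z} {k : y ⟶ z} :
    A.spanHom f g ≤ A.graph h ≫ A.cograph k ↔ A.graph (f ≫ h) = A.graph (g ≫ k) := by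
  rw [graph_comp, graph_comp]
  exact Allegory.IsMap.inv_comp_le_comp_inv_iff (A.isMap_graph f) (A.isMap_graph g)
    (A.isMap_graph h) (A.isMap_graph k)

/-! ### Covering cocones of tight maps -/

theorem isCovering_iff {u : A.TMap} {P : AryCocone κ u} :
    A.IsCovering P ↔ IsLUB (Set.range fun i => A.spanHom (P.hom i) (P.hom i)) (𝟙 u.un) := Iff.rfl

/-- A criterion with slack: the relations that follow the inverses of the legs may be arbitrary.
Meeting the join with the identity cuts the `i`-th term down to the image of the `i`-th leg, by
`id_inf_inv_comp_le`. -/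
theorem isCovering_of_isLUB {u : A.TMap} {P : AryCocone κ u}
    {χ : ∀ i, (P.dom i).un ⟶ u.un} {s : u.un ⟶ u.un}
    (hs : IsLUB (Set.range fun i => A.cograph (P.hom i) ≫ χ i) s) (h : 𝟙 u.un ≤ s) :
    A.IsCovering P := by
  have h1 := A.join_inf (𝟙 u.un) P.small hs
  rw [inf_eq_right.2 h] at h1
  refine ⟨?_, fun b hb => h1.2 ?_⟩
  · rintro _ ⟨i, rfl⟩
    exact spanHom_self_le _
  · rintro _ ⟨i, rfl⟩
    refine le_trans ?_ (hb ⟨i, rfl⟩)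
    change A.cograph (P.hom i) ≫ χ i ⊓ 𝟙 u.un ≤ _
    rw [inf_comm]
    exact Allegory.id_inf_inv_comp_le _ _

/-- The join expressing the identity of `a` is inserted between `A.cograph f` and `A.graph g`, and
composition distributes over it. -/
theorem IsCovering.isLUB_spanHom {a x y : A.TMap} {V : AryCocone κ a} (hV : A.IsCovering V)
    (f : a ⟶ x) (g : a ⟶ y) :
    IsLUB (Set.range fun i => A.spanHom (V.hom i ≫ f) (V.hom i ≫ g)) (A.spanHom f g) := by
  have h := A.comp_join (A.cograph f) V.small (A.join_comp (A.graph g) V.small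
    (isCovering_iff.1 hV))
  rw [Category.id_comp] at h
  simp only [spanHom_comp]
  exact h

theorem isCovering_single_id (x : A.TMap) : A.IsCovering (AryCocone.single κ (𝟙 x)) := by
  have : (fun _ : PUnit.{w + 1} => A.spanHom (𝟙 x) (𝟙 x)) =
      fun _ => 𝟙 x.un := by
    rw [spanHom_id_left, graph_id]
  refine isCovering_iff.2 ?_
  change IsLUB (Set.range fun _ : PUnit.{w + 1} => A.spanHom (𝟙 x) (𝟙 x)) _
  rw [this, Set.range_const]
  exact isLUB_singleton

theorem IsCovering.bind {u : A.TMap} {P : AryCocone κ u} {Q : ∀ i, AryCocone κ (P.dom i)}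
    (hP : A.IsCovering P) (hQ : ∀ i, A.IsCovering (Q i)) : A.IsCovering (P.bind Q) :=
  isLUB_range_sigma (fun i => (hQ i).isLUB_spanHom (P.hom i) (P.hom i)) hP

/-- The counits keep every such join below the identity, so covering only asks that the join be
large enough, and passing to a coarser cocone can only enlarge it. -/
theorem IsCovering.of_refines {u : A.TMap} {P Q : AryCocone κ u} (hP : A.IsCovering P)
    (h : P.Refines Q) : A.IsCovering Q := by
  refine isCovering_iff.2 ⟨?_, fun b hb => (isCovering_iff.1 hP).2 ?_⟩
  · rintro _ ⟨i, rfl⟩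
    exact spanHom_self_le _
  · rintro _ ⟨i, rfl⟩
    obtain ⟨j, m, e⟩ := h i
    refine le_trans ?_ (hb ⟨j, rfl⟩)
    change A.spanHom (P.hom i) (P.hom i) ≤ _
    rw [e]
    exact spanHom_precomp_le _ _ _

/-- The class of a `κ`-ary family of spans of tight maps is the relation `φ`. -/
def IsTabulation {x y : A.TMap} (P : SpanArray κ x y) (φ : x.un ⟶ y.un) : Prop :=
  IsLUB (Set.range fun i => A.spanHom (P.l i) (P.r i)) φ

/-! ### Local factorization through a tabulation -/

namespace IsWeaklyTabular

variable (hA : A.IsWeaklyTabular)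

include hA

theorem exists_isTabulation {x y : A.TMap} (φ : x.un ⟶ y.un) :
    ∃ P : SpanArray κ x y, IsTabulation P φ := hA.exists_tabulation φ

theorem exists_covering₂ {x y z : A.TMap} {f g : x ⟶ y} {h k : x ⟶ z} (e : A.graph f = A.graph g)
    (e' : A.graph h = A.graph k) :
    ∃ P : AryCocone κ x, A.IsCovering P ∧ ∀ i, P.hom i ≫ f = P.hom i ≫ g ∧
      P.hom i ≫ h = P.hom i ≫ k := by
  obtain ⟨P, hP, h1⟩ := hA.exists_covering f g e
  have h2 : ∀ i, A.graph (P.hom i ≫ h) = A.graph (P.hom i ≫ k) := fun i => by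
    rw [graph_comp, graph_comp, e']
  choose Q hQ h3 using fun i => hA.exists_covering _ _ (h2 i)
  refine ⟨P.bind Q, hP.bind hQ, fun t => ⟨?_, ?_⟩⟩
  · exact (Category.assoc _ _ _).trans ((congrArg _ (h1 t.1)).trans (Category.assoc _ _ _).symm)
  · exact (Category.assoc _ _ _).trans ((h3 t.1 t.2).trans (Category.assoc _ _ _).symm)

/-- An inequality in the allegory yields actual factorizations of tight maps on a cover. The
possible factorizations through the `i`-th span form a relation from `a` to its source; these
relations are jointly total by the modular law, and their tabulations provide both the cover and the
factoring tight maps. -/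
theorem exists_covering_of_spanHom_le {a x y : A.TMap} {P : SpanArray κ x y}
    {φ : x.un ⟶ y.un} (hP : IsTabulation P φ) {f : a ⟶ x} {g : a ⟶ y}
    (h : A.spanHom f g ≤ φ) : ∃ V : AryCocone κ a, A.IsCovering V ∧
      ∀ k, ∃ (i : P.I) (m : V.dom k ⟶ P.src i),
        V.hom k ≫ f = m ≫ P.l i ∧ V.hom k ≫ g = m ≫ P.r i := by
  let ψ : ∀ i, (P.src i).un ⟶ a.un := fun i => A.graph (P.r i) ≫ A.cograph g
  -- In terms of elements, `β i` relates `s` to `t` when `f s = l t` and `g s = r t` for the legs of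
  -- the `i`-th span.
  let β : ∀ i, a.un ⟶ (P.src i).un := fun i =>
    A.graph f ≫ A.cograph (P.l i) ⊓ A.graph g ≫ A.cograph (P.r i)
  have inv_ψ : ∀ i, A.inv (ψ i) = A.graph g ≫ A.cograph (P.r i) := fun i => by
    rw [A.inv_comp, A.inv_inv]
  choose T hT using fun i => hA.exists_isTabulation (β i)
  obtain ⟨s, hs⟩ := A.exists_join P.small fun i => β i ≫ ψ i
  -- Transposing `f` and `g` in `h` puts the identity below `A.graph f ≫ φ ≫ A.cograph g`, a join
  -- over the members of `P`. Met with the identity, its `i`-th term is at most `β i ≫ ψ i` by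
  -- `modular'`.
  have h1 : 𝟙 a.un ≤ s := by
    have h2 := A.join_inf (𝟙 _) P.small (A.comp_join (A.graph f) P.small
      (A.join_comp (A.cograph g) P.small hP))
    have h3 : 𝟙 a.un ≤ A.graph f ≫ φ ≫ A.cograph g := by
      rw [← Category.assoc, (A.isMap_graph g).le_comp_inv_iff, Category.id_comp]
      exact ((A.isMap_graph f).inv_comp_le_iff).1 h
    rw [inf_eq_right.2 h3] at h2
    refine h2.2 ?_
    rintro _ ⟨i, rfl⟩
    refine le_trans ?_ (hs.1 ⟨i, rfl⟩)
    have h4 := A.modular' (A.graph f ≫ A.cograph (P.l i)) (ψ i) (𝟙 _)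
    rw [Category.id_comp, inv_ψ] at h4
    refine le_trans (le_of_eq ?_) h4
    simp only [spanHom, ψ, Category.assoc]
  -- The left legs of the tabulations of all `β i` give the cover; the right legs are the candidate
  -- factorizations.
  let W : AryCocone κ a := ⟨Σ i, (T i).I, κ.small_sigma P.small fun i => (T i).small,
    fun t => (T t.1).src t.2, fun t => (T t.1).l t.2⟩
  have hW : A.IsCovering W := by
    refine isCovering_of_isLUB (χ := fun t => A.graph ((T t.1).r t.2) ≫ ψ t.1)
      (isLUB_range_sigma (A := fun i => (T i).I)
        (φ := fun i t => A.cograph ((T i).l t) ≫ A.graph ((T i).r t) ≫ ψ i) (fun i => ?_) hs) h1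
    have h5 := A.join_comp (ψ i) (T i).small (hT i)
    simpa only [spanHom, Category.assoc] using h5
  -- The spans tabulating `β i` lie below both of its conjuncts, so both squares commute for
  -- underlying relations.
  have h6 : ∀ t : W.I, A.graph (W.hom t ≫ f) = A.graph ((T t.1).r t.2 ≫ P.l t.1) := fun t =>
    spanHom_le_iff.1 (((hT t.1).1 ⟨t.2, rfl⟩).trans inf_le_left)
  have h7 : ∀ t : W.I, A.graph (W.hom t ≫ g) = A.graph ((T t.1).r t.2 ≫ P.r t.1) := fun t =>
    spanHom_le_iff.1 (((hT t.1).1 ⟨t.2, rfl⟩).trans inf_le_right)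
  -- A further covering makes both squares commute as squares of tight maps.
  choose Q hQ h8 using fun t => hA.exists_covering₂ (h6 t) (h7 t)
  refine ⟨W.bind Q, hW.bind hQ, fun k => ⟨k.1.1, (Q k.1).hom k.2 ≫ (T k.1.1).r k.1.2, ?_, ?_⟩⟩
  · exact (Category.assoc _ _ _).trans
      (((h8 k.1 k.2).1).trans (Category.assoc _ _ _).symm)
  · exact (Category.assoc _ _ _).trans
      (((h8 k.1 k.2).2).trans (Category.assoc _ _ _).symm)

end IsWeaklyTabular

/-- The weak topology of tight maps. -/
def tightTopology (hA : A.IsWeaklyTabular) : WeakTopology κ A.TMap where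
  Covers P := A.IsCovering P
  covers_id u := isCovering_single_id u
  exists_pullback {u x} P f hP := by
    -- The diagonal spans of a covering tabulate the identity, and the span `(f, f)` lies below it
    -- by the counit; a local factorization of this span is the required pullback of the covering.
    obtain ⟨V, hV, h⟩ := hA.exists_covering_of_spanHom_le
      (P := ⟨P.I, P.small, P.dom, P.hom, P.hom⟩) hP (spanHom_self_le f)
    refine ⟨V, hV, fun k => ?_⟩
    obtain ⟨i, m, e, _⟩ := h k
    exact ⟨i, m, e⟩
  covers_bind _ _ hP hQ := hP.bind hQ
  covers_of_refines _ _ hP h := hP.of_refines h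

variable (hA : A.IsWeaklyTabular)

/-- This is the dictionary between site and allegory. In the direction from left to right, a
covering writes the relation of `(f, g)` as a join of restrictions, each below a member of `P`. -/
theorem holds_iff_spanHom_le {a x y : A.TMap} {P : SpanArray κ x y}
    {φ : x.un ⟶ y.un} (hP : IsTabulation P φ) {f : a ⟶ x} {g : a ⟶ y} :
    (tightTopology hA).Holds P f g ↔ A.spanHom f g ≤ φ := by
  constructor
  · rintro ⟨V, hV, h⟩
    refine (IsCovering.isLUB_spanHom hV f g).2 ?_
    rintro _ ⟨k, rfl⟩
    obtain ⟨i, m, e, e'⟩ := h k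
    refine le_trans ?_ (hP.1 ⟨i, rfl⟩)
    change A.spanHom (V.hom k ≫ f) (V.hom k ≫ g) ≤ _
    rw [e, e']
    exact spanHom_precomp_le _ _ _
  · exact hA.exists_covering_of_spanHom_le hP

/-! ### Local prelimits of tight maps -/

include hA in
-- The squares of a tabulation commute only for underlying relations; restricting each span along a
-- suitable covering makes them strict without changing the join. The new spans are recorded as
-- factoring through the old ones so that several equations can be imposed in succession.
theorem IsTabulation.exists_commuting {x y z : A.TMap} {P : SpanArray κ x y}
    {φ : x.un ⟶ y.un} (hP : IsTabulation P φ) {f : x ⟶ z} {g : y ⟶ z}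
    (h : φ ≤ A.graph f ≫ A.cograph g) : ∃ P' : SpanArray κ x y, IsTabulation P' φ ∧
      ∀ i, P'.l i ≫ f = P'.r i ≫ g ∧
        ∃ (j : P.I) (m : P'.src i ⟶ P.src j), P'.l i = m ≫ P.l j ∧ P'.r i = m ≫ P.r j := by
  choose Q hQ e using fun i => hA.exists_covering (P.l i ≫ f) (P.r i ≫ g)
    (spanHom_le_iff.1 ((hP.1 ⟨i, rfl⟩).trans h))
  refine ⟨⟨Σ i, (Q i).I, κ.small_sigma P.small fun i => (Q i).small, fun t => (Q t.1).dom t.2,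
    fun t => (Q t.1).hom t.2 ≫ P.l t.1, fun t => (Q t.1).hom t.2 ≫ P.r t.1⟩, ?_, ?_⟩
  · exact isLUB_range_sigma (fun i => (hQ i).isLUB_spanHom (P.l i) (P.r i)) hP
  · rintro ⟨i, t⟩
    exact ⟨by simpa using e i t, i, (Q i).hom t, rfl, rfl⟩

theorem hasMappedPrePullbacks_id : HasMappedPrePullbacks (tightTopology hA) (𝟭 A.TMap) := by
  intro x y z f g
  obtain ⟨P, hP⟩ := hA.exists_isTabulation (A.graph f ≫ A.cograph g)
  obtain ⟨R, hR, h⟩ := hP.exists_commuting hA le_rfl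
  refine ⟨R, fun i => (h i).1, fun a p q e => ?_⟩
  exact (holds_iff_spanHom_le hA hR).2 (spanHom_le_iff.2 (congrArg A.graph e))

theorem hasMappedPreEqualizers_id : HasMappedPreEqualizers (tightTopology hA) (𝟭 A.TMap) := by
  intro x y f g
  -- The identity is written as a cospan relation, so that the first refinement makes the two legs
  -- equal and the second makes them equalize `f` and `g`.
  obtain ⟨P, hP⟩ := hA.exists_isTabulation
    (A.graph (𝟙 x) ≫ A.cograph (𝟙 x) ⊓ A.graph f ≫ A.cograph g)
  obtain ⟨P', hP', h'⟩ := hP.exists_commuting hA inf_le_left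
  obtain ⟨R, hR, h⟩ := hP'.exists_commuting hA inf_le_right
  -- Equality of the legs, won in the first refinement, is inherited by the second because its spans
  -- factor through the first.
  have key : ∀ i, R.l i = R.r i := fun i => by
    obtain ⟨j, m, e, e'⟩ := (h i).2
    have := (h' j).1
    rw [Category.comp_id, Category.comp_id] at this
    rw [e, e', this]
  refine ⟨⟨R.I, R.small, R.src, R.l⟩, fun i => ?_, fun a p e => ?_⟩
  · exact (h i).1.trans (congrArg (· ≫ g) (key i).symm)
  · have := (holds_iff_spanHom_le hA hR).2 (le_inf (spanHom_le_iff.2 rfl)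
      (spanHom_le_iff.2 (congrArg A.graph e)))
    refine WeakTopology.Locally.mono this ?_
    rintro b q ⟨i, m, e', _⟩
    exact ⟨i, m, e'⟩

theorem hasMappedPreProducts_id (h : A.HasLocalMaxima) :
    HasMappedPreProducts (tightTopology hA) (𝟭 A.TMap) := by
  intro x y
  obtain ⟨t, ht⟩ := h x y
  obtain ⟨P, hP⟩ := hA.exists_isTabulation t
  exact ⟨P, fun a p q => (holds_iff_spanHom_le hA hP).2 (ht _)⟩

theorem hasMappedPreTerminal_id (h : A.HasWeakUnit) :
    HasMappedPreTerminal (tightTopology hA) (𝟭 A.TMap) := by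
  obtain ⟨I, U, hI, h⟩ := h
  refine ⟨I, U, hI, fun a => ?_⟩
  obtain ⟨Φ, s, hs, hs'⟩ : ∃ (Φ : ∀ i, a.un ⟶ TMap.un (A := A) (U i)) (s : a.un ⟶ a.un),
    IsLUB (Set.range fun i => Φ i ≫ A.inv (Φ i)) s ∧ 𝟙 a.un ≤ s := h a.un
  choose T hT using fun i => hA.exists_isTabulation (x := a) (y := U i) (Φ i)
  refine ⟨⟨Σ i, (T i).I, κ.small_sigma hI fun i => (T i).small,
    fun t => (T t.1).src t.2, fun t => (T t.1).l t.2⟩, ?_, fun t => ⟨t.1, ⟨(T t.1).r t.2⟩⟩⟩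
  -- The left legs of the tabulations of all `Φ i` cover `a`, and the right legs are the morphisms
  -- to the unit objects.
  refine isCovering_of_isLUB (χ := fun t => A.graph ((T t.1).r t.2) ≫ A.inv (Φ t.1))
    (isLUB_range_sigma (A := fun i => (T i).I)
      (φ := fun i t => A.cograph ((T i).l t) ≫ A.graph ((T i).r t) ≫ A.inv (Φ i))
      (fun i => ?_) hs) hs'
  have h5 := A.join_comp (A.inv (Φ i)) (T i).small (hT i)
  simpa only [spanHom, Category.assoc] using h5

theorem hasFiniteConnectedLocalPrelimits_tightTopology :
    (tightTopology hA).HasFiniteConnectedLocalPrelimits := fun _ _ _ _ g =>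
  exists_isLocalPrelimit_map_of_isConnected (F := 𝟭 A.TMap) (hasMappedPrePullbacks_id hA)
    (hasMappedPreEqualizers_id hA) g

theorem hasFiniteLocalPrelimits_tightTopology (h : A.HasLocalMaxima) (h' : A.HasWeakUnit) :
    (tightTopology hA).HasFiniteLocalPrelimits := fun _ _ _ g =>
  exists_isLocalPrelimit_map (F := 𝟭 A.TMap) (hasMappedPreTerminal_id hA h')
    (hasMappedPreProducts_id hA h) (hasMappedPreEqualizers_id hA) g

end FramedAllegory

/-! ## Relations in the site of tight maps -/

namespace FramedAllegory

open WeakTopology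

variable {κ : ArityClass.{w}} {A : FramedAllegory κ} (hA : A.IsWeaklyTabular)

/-! ### Arrays of tight spans and their joins -/

theorem exists_isTabulation_of (A : FramedAllegory κ) {x y : A.TMap} (P : SpanArray κ x y) :
    ∃ φ : x.un ⟶ y.un, IsTabulation P φ :=
  A.exists_join P.small _

theorem IsTabulation.le_iff {x y : A.TMap} {P : SpanArray κ x y} {φ ψ : x.un ⟶ y.un}
    (hP : IsTabulation P φ) : φ ≤ ψ ↔ ∀ i, A.spanHom (P.l i) (P.r i) ≤ ψ :=
  (isLUB_le_iff hP).trans Set.forall_mem_range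

theorem IsTabulation.le_iff_locallyRefines {x y : A.TMap} {P Q : SpanArray κ x y}
    {φ ψ : x.un ⟶ y.un} (hP : IsTabulation P φ) (hQ : IsTabulation Q ψ) :
    φ ≤ ψ ↔ (tightTopology hA).LocallyRefines P Q :=
  hP.le_iff.trans (forall_congr' fun _ => (holds_iff_spanHom_le hA hQ).symm)

/-- The relation represented by the class of an array of tight spans. -/
noncomputable def ofRelHom {x y : A.TMap} (φ : RelHom (tightTopology hA) x y) : x.un ⟶ y.un :=
  Quotient.lift (s := spanSetoid (tightTopology hA) x y)
    (fun P => (exists_isTabulation_of A P).choose) (fun P Q h =>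
      le_antisymm
        (((exists_isTabulation_of A P).choose_spec.le_iff_locallyRefines hA
          (exists_isTabulation_of A Q).choose_spec).2 h.1)
        (((exists_isTabulation_of A Q).choose_spec.le_iff_locallyRefines hA
          (exists_isTabulation_of A P).choose_spec).2 h.2)) φ

theorem isTabulation_ofRelHom_mk {x y : A.TMap} (P : SpanArray κ x y) :
    IsTabulation P (ofRelHom hA (RelHom.mk _ P)) :=
  (exists_isTabulation_of A P).choose_spec

theorem ofRelHom_le_ofRelHom {x y : A.TMap} {φ ψ : RelHom (tightTopology hA) x y} :
    ofRelHom hA φ ≤ ofRelHom hA ψ ↔ φ ≤ ψ :=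
  Quotient.inductionOn₂ φ ψ fun P Q =>
    (isTabulation_ofRelHom_mk hA P).le_iff_locallyRefines hA (isTabulation_ofRelHom_mk hA Q)

theorem ofRelHom_surjective {x y : A.TMap} :
    Function.Surjective (ofRelHom hA : RelHom (tightTopology hA) x y → _) := fun φ => by
  obtain ⟨P, hP⟩ := hA.exists_isTabulation φ
  exact ⟨RelHom.mk _ P, (isTabulation_ofRelHom_mk hA P).unique hP⟩

/-- The relations between two objects of the site of tight maps are those of the allegory. -/
noncomputable def relHomIso (x y : A.TMap) :
    RelHom (tightTopology hA) x y ≃o (x.un ⟶ y.un) :=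
  RelIso.ofSurjective (OrderEmbedding.ofMapLEIff (ofRelHom hA)
    fun _ _ => ofRelHom_le_ofRelHom hA) (ofRelHom_surjective hA)

theorem isTabulation_relHomIso_mk {x y : A.TMap} (P : SpanArray κ x y) :
    IsTabulation P (relHomIso hA x y (RelHom.mk _ P)) :=
  isTabulation_ofRelHom_mk hA P

theorem relHomIso_graph {x y : A.TMap} (f : x ⟶ y) :
    relHomIso hA x y (RelHom.graph _ f) = A.graph f := by
  have h := isTabulation_relHomIso_mk hA (SpanArray.graph κ f)
  change IsLUB (Set.range fun _ : PUnit.{w + 1} => A.spanHom (𝟙 x) f) _ at h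
  rw [Set.range_const, spanHom_id_left] at h
  exact h.unique isLUB_singleton

theorem relHomIso_inv {x y : A.TMap} (φ : RelHom (tightTopology hA) x y) :
    relHomIso hA y x (RelHom.inv φ) = A.inv (relHomIso hA x y φ) := by
  induction φ using Quotient.inductionOn with | _ P
  have h := isTabulation_relHomIso_mk hA P
  have h' := isTabulation_relHomIso_mk hA P.inv
  refine le_antisymm (h'.le_iff.2 fun i => ?_) ((A.inv_le_iff).2 (h.le_iff.2 fun i => ?_))
  · refine le_trans (le_of_eq ?_) (A.inv_le_inv (h.1 ⟨i, rfl⟩))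
    exact (inv_spanHom _ _).symm
  · refine le_trans (le_of_eq ?_) (A.inv_le_inv (h'.1 ⟨i, rfl⟩))
    exact (inv_spanHom _ _).symm

/-- Commutativity bounds the join of `R` from above. For the converse, a strictly commuting
tabulation of the cospan relation refines `R` locally by universality. -/
theorem isTabulation_of_isLocalPrePullback {x y z : A.TMap} {f : x ⟶ z} {g : y ⟶ z}
    {R : SpanArray κ x y} (h : (tightTopology hA).IsLocalPrePullback f g R) :
    IsTabulation R (A.graph f ≫ A.cograph g) := by
  obtain ⟨P, hP⟩ := hA.exists_isTabulation (A.graph f ≫ A.cograph g)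
  obtain ⟨P', hP', e⟩ := hP.exists_commuting hA le_rfl
  obtain ⟨φ, hR⟩ := exists_isTabulation_of A R
  obtain rfl : φ = A.graph f ≫ A.cograph g := by
    refine le_antisymm (hR.le_iff.2 fun i => spanHom_le_iff.2 (congrArg A.graph (h.1 i)))
      ((hP'.le_iff_locallyRefines hA hR).2 fun i => h.2 _ _ (e i).1)
  exact hR

/-- The middle factor `A.graph r ≫ A.cograph m` is the join over the pre-pullback; composing with
the outer legs preserves it. -/
theorem isLUB_spanHom_comp {a b x y z : A.TMap} {l : a ⟶ x} {r : a ⟶ y} {m : b ⟶ y} {n : b ⟶ z}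
    {R : SpanArray κ a b} (h : (tightTopology hA).IsLocalPrePullback r m R) :
    IsLUB (Set.range fun t => A.spanHom (R.l t ≫ l) (R.r t ≫ n))
      (A.spanHom l r ≫ A.spanHom m n) := by
  have h' := A.comp_join (A.cograph l) R.small (A.join_comp (A.graph n) R.small
    (isTabulation_of_isLocalPrePullback hA h))
  have e : ∀ t, A.spanHom (R.l t ≫ l) (R.r t ≫ n) =
      A.cograph l ≫ A.spanHom (R.l t) (R.r t) ≫ A.graph n := fun t => by
    simp only [spanHom, cograph, graph_comp, A.inv_comp, Category.assoc]
  have e' : A.spanHom l r ≫ A.spanHom m n =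
      A.cograph l ≫ (A.graph r ≫ A.cograph m) ≫ A.graph n := by
    simp only [spanHom, cograph, Category.assoc]
  simp only [e]
  rw [e']
  exact h'

/-- Distributivity reduces the composite to pairs of single spans; the nested joins match the index
type of `compArray`. -/
theorem IsTabulation.comp (hτ : (tightTopology hA).HasFiniteConnectedLocalPrelimits)
    {x y z : A.TMap} {P : SpanArray κ x y} {Q : SpanArray κ y z} {φ : x.un ⟶ y.un}
    {ψ : y.un ⟶ z.un} (hP : IsTabulation P φ) (hQ : IsTabulation Q ψ) :
    IsTabulation (RelHom.compArray hτ P Q) (φ ≫ ψ) := by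
  have h1 : ∀ i, IsLUB (Set.range fun t : Σ j, (prePullback hτ (P.r i) (Q.l j)).I =>
      A.spanHom ((prePullback hτ (P.r i) (Q.l t.1)).l t.2 ≫ P.l i)
        ((prePullback hτ (P.r i) (Q.l t.1)).r t.2 ≫ Q.r t.1))
      (A.spanHom (P.l i) (P.r i) ≫ ψ) := fun i =>
    isLUB_range_sigma (A := fun j => (prePullback hτ (P.r i) (Q.l j)).I)
      (fun j => isLUB_spanHom_comp hA (prePullback_spec hτ (P.r i) (Q.l j)))
      (A.comp_join _ Q.small hQ)
  exact isLUB_range_sigma (A := fun i => Σ j, (prePullback hτ (P.r i) (Q.l j)).I) h1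
    (A.join_comp ψ P.small hP)

theorem relHomIso_comp (hτ : (tightTopology hA).HasFiniteConnectedLocalPrelimits) {x y z : A.TMap}
    (φ : RelHom (tightTopology hA) x y) (ψ : RelHom (tightTopology hA) y z) :
    relHomIso hA x z (RelHom.comp hτ φ ψ) = relHomIso hA x y φ ≫ relHomIso hA y z ψ := by
  induction φ using Quotient.inductionOn with | _ P
  induction ψ using Quotient.inductionOn with | _ Q
  exact (isTabulation_relHomIso_mk hA (RelHom.compArray hτ P Q)).unique
    ((isTabulation_relHomIso_mk hA P).comp hA hτ (isTabulation_relHomIso_mk hA Q))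

/-- Meets are determined by the order, so no computation with arrays is needed. -/
theorem relHomIso_inf (hτ : (tightTopology hA).HasFiniteConnectedLocalPrelimits) {x y : A.TMap}
    (φ ψ : RelHom (tightTopology hA) x y) :
    relHomIso hA x y (RelHom.inf hτ φ ψ) = relHomIso hA x y φ ⊓ relHomIso hA x y ψ := by
  refine le_antisymm (le_inf ?_ ?_) ?_
  · exact (relHomIso hA x y).monotone (RelHom.inf_le_left hτ φ ψ)
  · exact (relHomIso hA x y).monotone (RelHom.inf_le_right hτ φ ψ)
  · rw [← (relHomIso hA x y).symm_apply_le]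
    exact RelHom.le_inf hτ ((relHomIso hA x y).symm_apply_le.2 inf_le_left)
      ((relHomIso hA x y).symm_apply_le.2 inf_le_right)

/-- The class of the tabulations of a relation. -/
noncomputable def toRelHom {x y : A.TMap} (φ : x.un ⟶ y.un) : RelHom (tightTopology hA) x y :=
  (relHomIso hA x y).symm φ

theorem relHomIso_toRelHom {x y : A.TMap} (φ : x.un ⟶ y.un) :
    relHomIso hA x y (toRelHom hA φ) = φ := (relHomIso hA x y).apply_symm_apply φ

theorem toRelHom_relHomIso {x y : A.TMap} (φ : RelHom (tightTopology hA) x y) :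
    toRelHom hA (relHomIso hA x y φ) = φ := (relHomIso hA x y).symm_apply_apply φ

theorem toRelHom_le_iff {x y : A.TMap} {φ : x.un ⟶ y.un} {ψ : RelHom (tightTopology hA) x y} :
    toRelHom hA φ ≤ ψ ↔ φ ≤ relHomIso hA x y ψ := (relHomIso hA x y).symm_apply_le

theorem le_toRelHom_iff {x y : A.TMap} {φ : x.un ⟶ y.un} {ψ : RelHom (tightTopology hA) x y} :
    ψ ≤ toRelHom hA φ ↔ relHomIso hA x y ψ ≤ φ := (relHomIso hA x y).le_symm_apply

theorem toRelHom_le_toRelHom {x y : A.TMap} {φ ψ : x.un ⟶ y.un} (h : φ ≤ ψ) :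
    toRelHom hA φ ≤ toRelHom hA ψ := (relHomIso hA x y).symm.monotone h

theorem toRelHom_graph {x y : A.TMap} (f : x ⟶ y) :
    toRelHom hA (A.graph f) = RelHom.graph _ f := by
  rw [← relHomIso_graph hA, toRelHom_relHomIso]

theorem toRelHom_inv {x y : A.TMap} (φ : x.un ⟶ y.un) :
    toRelHom hA (A.inv φ) = RelHom.inv (toRelHom hA φ) := by
  apply (relHomIso hA y x).injective
  rw [relHomIso_inv, relHomIso_toRelHom, relHomIso_toRelHom]

theorem toRelHom_comp (hτ : (tightTopology hA).HasFiniteConnectedLocalPrelimits) {x y z : A.TMap}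
    (φ : x.un ⟶ y.un) (ψ : y.un ⟶ z.un) :
    toRelHom hA (φ ≫ ψ) = RelHom.comp hτ (toRelHom hA φ) (toRelHom hA ψ) := by
  apply (relHomIso hA x z).injective
  rw [relHomIso_comp, relHomIso_toRelHom, relHomIso_toRelHom, relHomIso_toRelHom]

theorem toRelHom_inf (hτ : (tightTopology hA).HasFiniteConnectedLocalPrelimits) {x y : A.TMap}
    (φ ψ : x.un ⟶ y.un) :
    toRelHom hA (φ ⊓ ψ) = RelHom.inf hτ (toRelHom hA φ) (toRelHom hA ψ) := by
  apply (relHomIso hA x y).injective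
  rw [relHomIso_inf, relHomIso_toRelHom, relHomIso_toRelHom, relHomIso_toRelHom]

theorem isLUB_toRelHom {x y : A.TMap} {I : Type*} {φ : I → (x.un ⟶ y.un)} {s : x.un ⟶ y.un}
    (h : IsLUB (Set.range φ) s) :
    IsLUB (Set.range fun i => toRelHom hA (φ i)) (toRelHom hA s) :=
  isLUB_range_orderIso (relHomIso hA x y).symm h

/-! ### The isomorphism of framed allegories -/

variable (A) in
/-- The site of tight maps of a weakly tabular framed allegory. -/
def tightSite (hA : A.IsWeaklyTabular) : WeakSite κ where
  Obj := A.TMap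
  top := tightTopology hA

variable (hτ : (tightSite A hA).top.HasFiniteConnectedLocalPrelimits)

/-- The comparison from the allegory of relations of the site of tight maps. -/
noncomputable def fromRel : Functor (relFramed (tightSite A hA) hτ) A where
  obj x := x
  map {x y} φ := relHomIso hA x y φ
  map_id x := (relHomIso_graph hA _).trans (A.graph_id x)
  map_comp φ ψ := relHomIso_comp hA hτ φ ψ
  map_le_map h := (relHomIso hA _ _).monotone h
  map_inv φ := relHomIso_inv hA φ
  map_inf φ ψ := relHomIso_inf hA hτ φ ψ
  map_join _ h := isLUB_range_orderIso (relHomIso hA _ _) h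
  tmap f := f
  tmap_tid _ := rfl
  tmap_tcomp _ _ := rfl
  J_tmap f := (relHomIso_graph hA f).symm

/-- The comparison to the allegory of relations of the site of tight maps. -/
noncomputable def toRel : Functor A (relFramed (tightSite A hA) hτ) where
  obj x := x
  map φ := toRelHom hA φ
  map_id x := (congrArg _ (A.graph_id x).symm).trans (toRelHom_graph hA _)
  map_comp φ ψ := toRelHom_comp hA hτ φ ψ
  map_le_map h := toRelHom_le_toRelHom hA h
  map_inv φ := toRelHom_inv hA φ
  map_inf φ ψ := toRelHom_inf hA hτ φ ψ
  map_join _ h := isLUB_toRelHom hA h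
  tmap f := f
  tmap_tid _ := rfl
  tmap_tcomp _ _ := rfl
  J_tmap f := (toRelHom_graph hA f).symm

theorem fromRel_comp_toRel :
    (fromRel hA hτ).comp (toRel hA hτ) = Functor.id (relFramed (tightSite A hA) hτ) :=
  Functor.ext' rfl
    (fun φ => heq_of_eq (toRelHom_relHomIso hA φ)) (fun _ => HEq.rfl)

theorem toRel_comp_fromRel : (toRel hA hτ).comp (fromRel hA hτ) = Functor.id A :=
  Functor.ext' rfl
    (fun φ => heq_of_eq (relHomIso_toRelHom hA φ)) (fun _ => HEq.rfl)

theorem preservesLocalMaxima_fromRel :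
    (fromRel hA hτ).toAllegoryFunctor.PreservesLocalMaxima := fun _ _ _ ht ψ =>
  (toRelHom_le_iff hA).1 (ht (toRelHom hA ψ))

theorem preservesLocalMaxima_toRel :
    (toRel hA hτ).toAllegoryFunctor.PreservesLocalMaxima := fun x y _ ht ψ =>
  (le_toRelHom_iff hA).2 (ht (relHomIso hA x y ψ))

end FramedAllegory

/-! ### Essential surjectivity -/

theorem AllegoryFunctor.preservesWeakUnits_of_surjective {κ : ArityClass.{w}} {A B : Allegory κ}
    (F : AllegoryFunctor A B) (hF : Function.Surjective F.obj) : F.PreservesWeakUnits := by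
  intro I U hU
  refine ⟨hU.1, fun x => ?_⟩
  -- Any allegory functor carries the witnesses of a weak unit from `x` to its image; surjectivity
  -- is needed only so that these images exhaust the target.
  obtain ⟨x, rfl⟩ := hF x
  obtain ⟨Φ, s, hs, hs'⟩ := hU.2 x
  refine ⟨fun i => F.map (Φ i), F.map s, ?_, ?_⟩
  · simpa only [F.map_comp, F.map_inv] using F.map_join hU.1 hs
  · simpa only [F.map_id] using F.map_le_map hs'

theorem relPre_exists_iso {κ : ArityClass.{w}} (A : (fallWT κ).Carrier) :
    ∃ (C : (lsite κ).Carrier) (e : (relPre κ).obj C ⟶ A) (e' : A ⟶ (relPre κ).obj C),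
      e ≫ e' = 𝟙 ((relPre κ).obj C) ∧ e' ≫ e = 𝟙 A := by
  obtain ⟨A, hA⟩ := A
  have hτ : (FramedAllegory.tightSite A hA).top.HasFiniteConnectedLocalPrelimits :=
    FramedAllegory.hasFiniteConnectedLocalPrelimits_tightTopology hA
  exact ⟨⟨FramedAllegory.tightSite A hA, hτ⟩, ⟨FramedAllegory.fromRel hA hτ, trivial⟩,
    ⟨FramedAllegory.toRel hA hτ, trivial⟩,
    SubTwoCategory.OneCell.ext (FramedAllegory.fromRel_comp_toRel hA hτ),
    SubTwoCategory.OneCell.ext (FramedAllegory.toRel_comp_fromRel hA hτ)⟩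

theorem rel_exists_iso {κ : ArityClass.{w}} (A : (fallWTX κ).Carrier) :
    ∃ (C : (site κ).Carrier) (e : (rel κ).obj C ⟶ A) (e' : A ⟶ (rel κ).obj C),
      e ≫ e' = 𝟙 ((rel κ).obj C) ∧ e' ≫ e = 𝟙 A := by
  obtain ⟨A, hA, h, h'⟩ := A
  have hτ' : (FramedAllegory.tightSite A hA).top.HasFiniteLocalPrelimits :=
    FramedAllegory.hasFiniteLocalPrelimits_tightTopology hA h h'
  have hτ := hτ'.connected
  exact ⟨⟨FramedAllegory.tightSite A hA, hτ'⟩,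
    ⟨FramedAllegory.fromRel hA hτ, FramedAllegory.preservesLocalMaxima_fromRel hA hτ,
      AllegoryFunctor.preservesWeakUnits_of_surjective _ fun x => ⟨x, rfl⟩⟩,
    ⟨FramedAllegory.toRel hA hτ, FramedAllegory.preservesLocalMaxima_toRel hA hτ,
      AllegoryFunctor.preservesWeakUnits_of_surjective _ fun x => ⟨x, rfl⟩⟩,
    SubTwoCategory.OneCell.ext (FramedAllegory.fromRel_comp_toRel hA hτ),
    SubTwoCategory.OneCell.ext (FramedAllegory.toRel_comp_fromRel hA hτ)⟩

end RelSite

theorem mainTheorem2 (κ : RelSite.ArityClass.{w}) :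
    RelSite.IsTwoEquivalence (RelSite.rel κ) ∧ RelSite.IsTwoEquivalence (RelSite.relPre κ) :=
  ⟨⟨RelSite.rel_bijective_map, RelSite.rel_bijective_map₂, RelSite.rel_exists_iso⟩,
    ⟨RelSite.relPre_bijective_map, RelSite.relPre_bijective_map₂, RelSite.relPre_exists_iso⟩⟩
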